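/- Let $B\ge 4$ be an integer, $G=I-\frac1B\mathbf 1\mathbf 1^T\in\mathbb R^{B\times B}$, and let $\phi:\mathbb R\to\mathbb R$ be measurable. Put $\mathsf n(x)=\sqrt B\,x/\|x\|$ and $\mathcal B_\phi(h)=\phi(\mathsf n(Gh))$, with $\phi$ applied coordinatewise, and for $\Phi:\mathbb R^B\to\mathbb R^A$ write $V_\Phi(\Sigma)=\mathbb E[\Phi(h)\Phi(h)^T:h\sim\mathcal N(0,\Sigma)]$. Let $C_l=C_l^{((B-3)/2)}$ be the Gegenbauer polynomials, $C_0=1$, $C_1(x)=(B-3)x$, $nC_n(x)=(2n+B-5)\,x\,C_{n-1}(x)-(n+B-5)\,C_{n-2}(x)$ for $n\ge2$, with the convention $C_{-1}=0$. Let $c_l=\frac{B-3}{B-3+2l}$. Suppose that $\phi(\sqrt{B-1}\,x)\in L^2([-1,1],(1-x^2)^{(B-4)/2}dx)$ has the Gegenbauer expansion $\sum_{l\ge0}a_l\,c_l^{-1}C_l(x)$, convergent in this space. Let $\Sigma^*=\upsilon^*I+\nu^*\mathbf 1\mathbf 1^T$ be a positive semidefinite fixed point of $\Sigma\mapsto V_{\mathcal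 B_\phi}(\Sigma)$ with $\upsilon^*\ne0$ (a nondegenerate BSB1 fixed point). Let $\mathcal H$ be the space of symmetric $B\times B$ matrices and $\mathcal H^G=\{\Sigma\in\mathcal H:G\Sigma G=\Sigma\}$. Then the map $\mathcal H^G\to\mathcal H$, $\Sigma\mapsto V_{\phi\circ\mathsf n}(\Sigma)$, is Fréchet differentiable at $G\Sigma^*G$. With $J$ its derivative there, let $\mathcal U:\mathcal H^G\to\mathcal H^G$, $\mathcal U\{\Lambda\}=G\,J\{\Lambda\}\,G$. The nonzero subspaces $$\mathbb L=\{GDG: D\text{ diagonal},\ \operatorname{tr}D=0\},\qquad \mathbb M=\{\Sigma\in\mathcal H^G:\operatorname{Diag}\Sigma=0\}$$ consist of eigenvectors of $\mathcal U$ (and $0$), with the respective eigenvalues $$\lambda^\uparrow_{\mathbb L}=\frac{\sum_{l\ge0}\left(a_l^2w_l+a_la_{l+2}u_l\right)}{\sum_{l\ge0}a_l^2v_l},\qquad \lambda^\uparrow_{\mathbb M}=\frac{\sum_{l\ge0}\left(a_l^2\tilde w_l+a_la_{l+2}\tilde u_l\right)}{\sum_{l\ge0}a_l^2v_l},$$ where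 all three series converge and the denominator is nonzero. The coefficients are as follows. Write $y=-\frac1{B-1}$, $\Delta_l=C_l(1)-\frac{2(B-1)}{B-2}C_l(y)$, and $$\kappa_0(l)=\frac{(l+1)(l+B-3)}{(B-3+2l)(B-1+2l)}+\frac{(l+B-4)\,l}{(B-3+2l)(B-5+2l)},$$ the second summand being $0$ for $l=0$ (also if $B=5$). Then $$v_l=c_l^{-1}\left(C_l(1)-C_l(y)\right),$$ $$w_l=\frac{B-1}2\left(\kappa_0(l)-\frac1{B-1}\right)c_l^{-1}\Delta_l=\frac{l(B-3+l)(B-3)}{(B-5+2l)(B-1+2l)}c_l^{-1}\Delta_l=\frac{l(B-3+l)(B-3+2l)}{(B-5+2l)(B-1+2l)}\Delta_l$$ (the last two fractions read as $0$ for $l=0$), $$u_l=\frac{B-1}2\left(c_{l+2}^{-1}\kappa_{-2}(l+2)\,\Delta_l+c_l^{-1}\kappa_2(l)\,\Delta_{l+2}\right)=\frac{B-1}2\left(\frac{(B-3+l)(B-2+l)}{(B-3)(B-1+2l)}\Delta_l+\frac{(l+1)(l+2)}{(B-3)(B-1+2l)}\Delta_{l+2}\right),$$ where $\kappa_2(n)=\frac{(n+1)(n+2)}{(B-3+2n)(B-1+2n)}$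 and $\kappa_{-2}(n)=\frac{(n+B-4)(n+B-5)}{(B-3+2n)(B-5+2n)}$, $$\tilde w_l=\frac{B-1}{(B-3)^2(B-2)}\Big[\Big(\frac{2(B-1)^2(B-3+2l)}{B}\kappa_0(l)-(B-3+2l)\Big)C_l(y)+\frac{(B-2)(B-1)^2(l+1)^2}{B(B+2l-1)}C_{l+1}(y)+\frac{(B-2)(B-1)^2(B-4+l)^2}{B(B+2l-5)}C_{l-1}(y)\Big]$$ (the last summand being $0$ for $l=0$), where for $(B,l)\ne(5,0)$ one has $(B-3+2l)\,\kappa_0(l)=\frac{(B+2l-3)(2Bl+B+2l^2-6l-5)}{(B+2l-5)(B+2l-1)}$, and $$\tilde u_l=\frac{2(B-1)^3}{(B-3)^2(B-2)B}\Big(\frac{(B-3+l)(B-2+l)}{B-1+2l}C_l(y)+\frac{(B-2)(l+1)(B-2+l)}{B-1+2l}C_{l+1}(y)+\frac{(l+1)(l+2)}{B-1+2l}C_{l+2}(y)\Big).$$ -/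

import Mathlib

open MeasureTheory ProbabilityTheory Filter Topology

noncomputable section

/-! ### Gegenbauer polynomials and expansions -/

/-- Gegenbauer polynomials `C_l^{(α)}`, through the three term recurrence
`n C_n = 2 (n - 1 + α) x C_{n-1} - (n - 2 + 2 α) C_{n-2}`. -/
def gegenbauer (α : ℝ) : ℕ → ℝ → ℝ
  | 0, _ => 1
  | 1, x => 2 * α * x
  | n + 2, x =>
      (2 * ((n : ℝ) + 1 + α) * x * gegenbauer α (n + 1) x
        - ((n : ℝ) + 2 * α) * gegenbauer α n x) / ((n : ℝ) + 2)

/-- The index `α = (B - 3) / 2` belonging to the sphere `S^{B-2}`. -/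
def gegIndex (B : ℕ) : ℝ := ((B : ℝ) - 3) / 2

/-- `c_{N,l} = (N - 2) / (N + 2 l - 2)` with `N = B - 1`, i.e. `(B - 3) / (B - 3 + 2 l)`. -/
def zonalConst (B l : ℕ) : ℝ := ((B : ℝ) - 3) / ((B : ℝ) - 3 + 2 * l)

/-- The orthogonality measure `(1 - x²)^{α - 1/2} dx` on `[-1, 1]`. -/
def gegMeasure (α : ℝ) : Measure ℝ :=
  (volume.restrict (Set.Icc (-1 : ℝ) 1)).withDensity
    (fun x => ENNReal.ofReal ((1 - x ^ 2) ^ (α - 1 / 2)))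

/-- `φ (√(B-1) x)` lies in `L²((1 - x²)^{α - 1/2})` with `α = (B - 3) / 2`, and it has the
Gegenbauer expansion `∑ a_l c_{B-1,l}⁻¹ C_l^{(α)}(x)`, convergent in that space. -/
def HasGegenbauerExpansion (B : ℕ) (φ : ℝ → ℝ) (a : ℕ → ℝ) : Prop :=
  MemLp (fun x => φ (√((B : ℝ) - 1) * x)) 2 (gegMeasure (gegIndex B)) ∧
  Tendsto
    (fun n => eLpNorm
      (fun x => φ (√((B : ℝ) - 1) * x)
        - ∑ l ∈ Finset.range n, a l * (zonalConst B l)⁻¹ * gegenbauer (gegIndex B) l x)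
      2 (gegMeasure (gegIndex B)))
    atTop (𝓝 0)

/-! ### Coefficients -/

/-- `C_l^{((B-3)/2)}(1)`. -/
def gegOne (B l : ℕ) : ℝ := gegenbauer (gegIndex B) l 1

/-- `C_l^{((B-3)/2)}(-1/(B-1))`. -/
def gegOff (B l : ℕ) : ℝ := gegenbauer (gegIndex B) l (-1 / ((B : ℝ) - 1))

def kappaUp (n : ℕ) (lam : ℝ) : ℝ :=
  ((n : ℝ) + 1) * (n + 2) / (4 * (n + lam) * (n + 1 + lam))

/-- `κ₀(n, λ)`. For `n = 0` the second summand is `0`, also when `λ = 1`. -/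
def kappaZero (n : ℕ) (lam : ℝ) : ℝ :=
  ((n : ℝ) + 1) * (n + 2 * lam) / (4 * (n + lam) * (n + 1 + lam))
    + ((n : ℝ) - 1 + 2 * lam) * n / (4 * (n + lam) * (n - 1 + lam))

def kappaDown (n : ℕ) (lam : ℝ) : ℝ :=
  ((n : ℝ) - 1 + 2 * lam) * (n - 2 + 2 * lam) / (4 * (n + lam) * (n - 1 + lam))

/-- `C_l(1) - (2 (B - 1) / (B - 2)) C_l(-1/(B-1))`. -/
def gegDiff (B l : ℕ) : ℝ :=
  gegOne B l - 2 * ((B : ℝ) - 1) / ((B : ℝ) - 2) * gegOff B l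

/-- `v_{B-1,l}`. -/
def coeffV (B l : ℕ) : ℝ := (zonalConst B l)⁻¹ * (gegOne B l - gegOff B l)

/-- `w_{B-1,l}`. -/
def coeffW (B l : ℕ) : ℝ :=
  ((B : ℝ) - 1) / 2 * (kappaZero l (gegIndex B) - 1 / ((B : ℝ) - 1))
    * (zonalConst B l)⁻¹ * gegDiff B l

/-- `u_{B-1,l}`. -/
def coeffU (B l : ℕ) : ℝ :=
  ((B : ℝ) - 1) / 2 *
    ((zonalConst B (l + 2))⁻¹ * kappaDown (l + 2) (gegIndex B) * gegDiff B l
      + (zonalConst B l)⁻¹ * kappaUp l (gegIndex B) * gegDiff B (l + 2))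

/-- `w̃_{B-1,l}`, with the convention `C_{-1} = 0`. -/
def coeffWTilde (B l : ℕ) : ℝ :=
  ((B : ℝ) - 1) / (((B : ℝ) - 3) ^ 2 * ((B : ℝ) - 2)) *
    ((2 * ((B : ℝ) - 1) ^ 2 / B * (((B : ℝ) - 3 + 2 * l) * kappaZero l (gegIndex B))
        - ((B : ℝ) - 3 + 2 * l)) * gegOff B l
      + ((B : ℝ) - 2) * ((B : ℝ) - 1) ^ 2 * ((l : ℝ) + 1) ^ 2 / (B * ((B : ℝ) + 2 * l - 1))
          * gegOff B (l + 1)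
      + (if l = 0 then 0 else
          ((B : ℝ) - 2) * ((B : ℝ) - 1) ^ 2 * ((B : ℝ) - 4 + l) ^ 2
            / (B * ((B : ℝ) + 2 * l - 5)) * gegOff B (l - 1)))

/-- `ũ_{B-1,l}`. -/
def coeffUTilde (B l : ℕ) : ℝ :=
  2 * ((B : ℝ) - 1) ^ 3 / (((B : ℝ) - 3) ^ 2 * ((B : ℝ) - 2) * B) *
    (((B : ℝ) - 3 + l) * ((B : ℝ) - 2 + l) / ((B : ℝ) - 1 + 2 * l) * gegOff B l
      + ((B : ℝ) - 2) * ((l : ℝ) + 1) * ((B : ℝ) - 2 + l) / ((B : ℝ) - 1 + 2 * l)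
          * gegOff B (l + 1)
      + ((l : ℝ) + 1) * ((l : ℝ) + 2) / ((B : ℝ) - 1 + 2 * l) * gegOff B (l + 2))

/-! ### Batch normalization and its covariance map -/

/-- The all-ones matrix. -/
def onesMat (B : ℕ) : Matrix (Fin B) (Fin B) ℝ := Matrix.of fun _ _ => 1

/-- The mean-centering projection `G = I - (1/B) 1 1ᵀ`. -/
def centering (B : ℕ) : Matrix (Fin B) (Fin B) ℝ := 1 - (1 / (B : ℝ)) • onesMat B

/-- `n(x) = √B x / ‖x‖` (Euclidean norm). -/
def normalizeVec {B : ℕ} (x : EuclideanSpace ℝ (Fin B)) : EuclideanSpace ℝ (Fin B) :=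
  (√(B : ℝ) / ‖x‖) • x

/-- `φ ∘ n`, with `φ` acting coordinatewise. -/
def actNormalize {B : ℕ} (φ : ℝ → ℝ) (x : EuclideanSpace ℝ (Fin B)) : Fin B → ℝ :=
  fun i => φ (normalizeVec x i)

/-- Batch normalization followed by `φ`: `𝓑_φ(h) = φ (√B G h / ‖G h‖)`. -/
def batchNorm {B : ℕ} (φ : ℝ → ℝ) (h : EuclideanSpace ℝ (Fin B)) : Fin B → ℝ :=
  actNormalize φ (WithLp.toLp 2 ((centering B).mulVec h))

/-- `V_Φ(Σ) = E[Φ(h) Φ(h)ᵀ : h ∼ N(0, Σ)]`. -/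
def covTransform {A B : ℕ} (Φ : EuclideanSpace ℝ (Fin B) → Fin A → ℝ)
    (S : Matrix (Fin B) (Fin B) ℝ) : Matrix (Fin A) (Fin A) ℝ :=
  Matrix.of fun i j => ∫ h, Φ h i * Φ h j ∂(multivariateGaussian 0 S)

/-- `S` is a fixed point of `Σ ↦ V_{𝓑_φ}(Σ)` of the form `S = υ I + ν 1 1ᵀ`, and `υ ≠ 0`
(so that `G S G = υ G` is nonzero). -/
structure IsBSB1FixedPoint {B : ℕ} (φ : ℝ → ℝ) (S : Matrix (Fin B) (Fin B) ℝ) : Prop where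
  posSemidef : S.PosSemidef
  bsb1 : ∃ υ ν : ℝ, υ ≠ 0 ∧ S = υ • (1 : Matrix (Fin B) (Fin B) ℝ) + ν • onesMat B
  fixed : covTransform (batchNorm φ) S = S

/-! ### Spaces of symmetric matrices and the linearized dynamics -/

/-- Symmetric `B × B` matrices. -/
def symSpace (B : ℕ) : Submodule ℝ (Matrix (Fin B) (Fin B) ℝ) where
  carrier := {S | S.transpose = S}
  add_mem' := by
    intro a b ha hb
    simp only [Set.mem_ofPred_eq] at *
    rw [Matrix.transpose_add, ha, hb]
  zero_mem' := by simp
  smul_mem' := by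
    intro c a ha
    simp only [Set.mem_ofPred_eq] at *
    rw [Matrix.transpose_smul, ha]

/-- Symmetric `B × B` matrices `S` with `G S G = S`. -/
def symSpaceG (B : ℕ) : Submodule ℝ (Matrix (Fin B) (Fin B) ℝ) where
  carrier := {S | S.transpose = S ∧ centering B * S * centering B = S}
  add_mem' := by
    rintro a b ⟨ha, ha'⟩ ⟨hb, hb'⟩
    exact ⟨by rw [Matrix.transpose_add, ha, hb],
      by rw [Matrix.mul_add, Matrix.add_mul, ha', hb']⟩
  zero_mem' := by simp
  smul_mem' := by
    rintro c a ⟨ha, ha'⟩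
    exact ⟨by rw [Matrix.transpose_smul, ha],
      by rw [Matrix.mul_smul, Matrix.smul_mul, ha']⟩

theorem centering_transpose (B : ℕ) : (centering B).transpose = centering B := by
  have h : (onesMat B).transpose = onesMat B := rfl
  rw [centering, Matrix.transpose_sub, Matrix.transpose_one, Matrix.transpose_smul, h]

theorem centering_mul_self (B : ℕ) : centering B * centering B = centering B := by
  have h : onesMat B * onesMat B = (B : ℝ) • onesMat B := by
    ext i j; simp [onesMat, Matrix.mul_apply]
  rcases Nat.eq_zero_or_pos B with rfl | hB
  · ext i; exact i.elim0
  · have hB' : (B : ℝ) ≠ 0 := by positivity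
    simp [centering, Matrix.mul_sub, Matrix.sub_mul, h, smul_smul, hB']

/-- `G^{⊗2} : S ↦ G S G`, from the symmetric matrices onto those fixed by it. -/
def gTensor (B : ℕ) : symSpace B →ₗ[ℝ] symSpaceG B where
  toFun S := ⟨centering B * S.1 * centering B, by
    have hS : S.1.transpose = S.1 := S.2
    refine ⟨?_, ?_⟩
    · rw [Matrix.transpose_mul, Matrix.transpose_mul, hS, centering_transpose, Matrix.mul_assoc]
    · calc centering B * (centering B * S.1 * centering B) * centering B
          = (centering B * centering B) * S.1 * (centering B * centering B) := by
            simp only [Matrix.mul_assoc]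
        _ = _ := by rw [centering_mul_self]⟩
  map_add' S T := by
    ext1
    simp [Matrix.mul_add, Matrix.add_mul]
  map_smul' c S := by
    ext1
    simp

/-- The map `S ↦ V_{φ∘n}(S)`, restricted to `S = G S G`. -/
def normCov (B : ℕ) (φ : ℝ → ℝ) (S : symSpaceG B) : symSpace B :=
  ⟨covTransform (actNormalize φ) S.1, by
    change Matrix.transpose _ = _
    ext i j
    simp [covTransform, mul_comm]⟩

/-- `U = G^{⊗2} ∘ J`, where `J` is the Fréchet derivative of `V_{φ∘n}` at the point `S₀`. -/
def linearized (B : ℕ) (φ : ℝ → ℝ) (S₀ : symSpaceG B) : symSpaceG B →ₗ[ℝ] symSpaceG B :=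
  gTensor B ∘ₗ (fderiv ℝ (normCov B φ) S₀).toLinearMap

/-- `𝕃 = {G D G : D diagonal, tr D = 0}`. -/
def spaceL (B : ℕ) : Submodule ℝ (symSpaceG B) where
  carrier := {S | ∃ d : Fin B → ℝ, ∑ i, d i = 0 ∧
    S.1 = centering B * Matrix.diagonal d * centering B}
  add_mem' := by
    rintro a b ⟨d, hd, ha⟩ ⟨e, he, hb⟩
    refine ⟨d + e, by simp [Finset.sum_add_distrib, hd, he], ?_⟩
    rw [Submodule.coe_add, ha, hb, ← Matrix.add_mul, ← Matrix.mul_add, Matrix.diagonal_add]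
    rfl
  zero_mem' := ⟨0, by simp, by simp⟩
  smul_mem' := by
    rintro c a ⟨d, hd, ha⟩
    refine ⟨c • d, by simp [← Finset.mul_sum, hd], ?_⟩
    rw [Submodule.coe_smul, ha, Matrix.diagonal_smul, Matrix.mul_smul, Matrix.smul_mul]

/-- `𝕄 = {S : G S G = S, Diag S = 0}`. -/
def spaceM (B : ℕ) : Submodule ℝ (symSpaceG B) where
  carrier := {S | ∀ i, S.1 i i = 0}
  add_mem' := by
    intro a b ha hb i
    simp [ha i, hb i]
  zero_mem' := by intro i; simp
  smul_mem' := by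
    intro c a ha i
    simp [ha i]

/-- The nonzero subspace `E` consists of eigenvectors of `T` (and `0`) for the eigenvalue `μ`. -/
def IsEigenvalueOn {B : ℕ} (T : symSpaceG B →ₗ[ℝ] symSpaceG B) (E : Submodule ℝ (symSpaceG B))
    (μ : ℝ) : Prop :=
  E ≠ ⊥ ∧ ∀ S ∈ E, T S = μ • S

end

/-! Only the direction of a centred Gaussian vector enters `φ ∘ n`, so everything takes place on the
unit sphere of the hyperplane E of vectors with coordinate sum zero, of dimension n = B - 1. For a
covariance P positive definite on E, the direction has density proportional to ⟨ω, P⁻¹ω⟩^(-n/2) with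
respect to the uniform measure. At GΣ*G = υG this density is constant. Differentiating the quotient
of integrals in a traceless direction T gives J{T}_ij = n/(2υ) · E[F_ij(ω) ⟨ω, Tω⟩], where F_ij(ω) =
φ(√n u_i·ω) φ(√n u_j·ω) and the unit vectors u_i, the normalised projections of the coordinate
vectors, satisfy u_i·u_j = -1/(B-1) for i ≠ j (`exists_hasFDerivAt_angularMean`,
`exists_hasFDerivAt_normCov`).

The form (a, b) ↦ E[F_ij (a·ω)(b·ω)] is invariant under the reflections that fix u_i and u_j. It
therefore equals A(u_i⊗u_i + u_j⊗u_j) + C(u_i⊗u_j + u_j⊗u_i) + τ id (`exists_sphereForm_eq`).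
Contracted with T, this gives J{T}_ij = p(T_ii + T_jj) + 2q T_ij off the diagonal and J{T}_ii = r
T_ii on it, with p, q, r independent of the indices. On 𝕄 the diagonal vanishes and the eigenvalue
is 2q. On 𝕃 the rank-two part d1ᵀ + 1dᵀ is killed by G, and the eigenvalue is ((B-2)(r-2p) + 4q)/B.

The constants A, C, τ solve a linear system with right-hand sides X = E[F (u_i·ω)²], Y = E[F
(u_i·ω)(u_j·ω)] and Z = E[F]. These are computed from the reproducing property E[C_l(u·ω) C_m(w·ω)]
= δ_lm α/(l+α) C_l(u·w) (`IsZonalPairing.diag`). Since multiplication by x moves the degree by ±1,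
only the pairs with m - l ∈ {0, ±2} contribute (`hasSum_of_banded`). The fixed point equation gives
υ = E[F_ii] - E[F_ij], which is the series in the denominator.

The reproducing property and the law of a coordinate on the sphere both follow from the moment
recursion `sphereMoment_rec`, which is Gaussian integration by parts read in polar coordinates. -/

noncomputable section

/-! ### Differential identities of Gegenbauer polynomials -/

open Polynomial in
/-- Gegenbauer polynomials as elements of `ℝ[X]`. -/
def gegPoly (α : ℝ) : ℕ → ℝ[X]
  | 0 => 1
  | 1 => C (2 * α) * X
  | n + 2 => C (((n : ℝ) + 2)⁻¹) *
      (C (2 * ((n : ℝ) + 1 + α)) * X * gegPoly α (n + 1) - C ((n : ℝ) + 2 * α) * gegPoly α n)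

theorem eval_gegPoly (α x : ℝ) : ∀ n : ℕ, (gegPoly α n).eval x = gegenbauer α n x
  | 0 => by simp [gegPoly, gegenbauer]
  | 1 => by simp [gegPoly, gegenbauer]
  | n + 2 => by
    simp only [gegPoly, gegenbauer, Polynomial.eval_mul, Polynomial.eval_C, Polynomial.eval_sub,
      Polynomial.eval_X, eval_gegPoly α x n, eval_gegPoly α x (n + 1)]
    rw [div_eq_inv_mul]

section Identities

open Polynomial

variable (α : ℝ)

theorem gegPoly_add_two (n : ℕ) :
    C ((n : ℝ) + 2) * gegPoly α (n + 2) =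
      C (2 * ((n : ℝ) + 1 + α)) * X * gegPoly α (n + 1) - C ((n : ℝ) + 2 * α) * gegPoly α n := by
  rw [gegPoly, ← mul_assoc, ← C_mul, mul_inv_cancel₀ (by positivity), C_1, one_mul]

/-- The two identities need each other: the differentiated recurrence and the first identity at `n`
give the second at `n + 1`, and the first at `n + 1` then follows from this, the identities at `n`
and the recurrence. -/
theorem derivative_gegPoly_aux (n : ℕ) :
    X * derivative (gegPoly α (n + 1)) - derivative (gegPoly α n)
        = C ((n : ℝ) + 1) * gegPoly α (n + 1) ∧
      derivative (gegPoly α (n + 1)) - X * derivative (gegPoly α n)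
        = C ((n : ℝ) + 2 * α) * gegPoly α n := by
  induction n with
  | zero =>
    constructor
    · simp [gegPoly]; ring
    · simp [gegPoly]
  | succ n ih =>
    obtain ⟨hb, hd⟩ := ih
    have hrec := gegPoly_add_two α n
    have hrec' := congrArg derivative hrec
    simp only [derivative_mul, derivative_C, derivative_sub, derivative_X, zero_mul, zero_add,
      mul_one] at hrec'
    have key : derivative (gegPoly α (n + 2)) - X * derivative (gegPoly α (n + 1))
        = C ((n : ℝ) + 1 + 2 * α) * gegPoly α (n + 1) := by
      have h2 : (C ((n : ℝ) + 2) : ℝ[X]) ≠ 0 := by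
        rw [Ne, C_eq_zero]; positivity
      apply mul_left_cancel₀ h2
      simp only [map_add, map_mul, map_one, map_ofNat] at *
      linear_combination hrec' + (C (n : ℝ) + 2 * C α) * hb
    refine ⟨?_, ?_⟩
    · simp only [map_add, map_mul, map_one, map_ofNat, Nat.cast_add, Nat.cast_one] at *
      linear_combination X * key + X * hb - hd - hrec
    · simpa using key

theorem X_mul_derivative_gegPoly (n : ℕ) :
    X * derivative (gegPoly α (n + 1)) =
      C ((n : ℝ) + 1) * gegPoly α (n + 1) + derivative (gegPoly α n) := by
  linear_combination (derivative_gegPoly_aux α n).1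

theorem derivative_gegPoly_add_two (n : ℕ) :
    derivative (gegPoly α (n + 2)) =
      derivative (gegPoly α n) + C (2 * ((n : ℝ) + 1 + α)) * gegPoly α (n + 1) := by
  have h1 := (derivative_gegPoly_aux α n).1
  have h2 := (derivative_gegPoly_aux α (n + 1)).2
  simp only [map_add, map_mul, map_one, map_ofNat, Nat.cast_add, Nat.cast_one] at *
  linear_combination h1 + h2

theorem one_sub_sq_mul_derivative_gegPoly (n : ℕ) :
    (1 - X ^ 2) * derivative (gegPoly α (n + 1)) =
      C ((n : ℝ) + 2 * α) * gegPoly α n - C ((n : ℝ) + 1) * X * gegPoly α (n + 1) := by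
  obtain ⟨h1, h2⟩ := derivative_gegPoly_aux α n
  linear_combination h2 - X * h1

theorem gegPoly_ode (n : ℕ) :
    (1 - X ^ 2) * derivative (derivative (gegPoly α n))
      - C (2 * α + 1) * X * derivative (gegPoly α n)
      = - C ((n : ℝ) * (n + 2 * α)) * gegPoly α n := by
  rcases n with _ | n
  · simp [gegPoly]
  · have h := congrArg derivative (one_sub_sq_mul_derivative_gegPoly α n)
    obtain ⟨h1, h2⟩ := derivative_gegPoly_aux α n
    simp only [derivative_mul, derivative_C, derivative_sub, derivative_X, zero_mul, zero_add,
      mul_one, derivative_one, derivative_X_pow, zero_sub, Nat.cast_ofNat, Nat.add_one_sub_one,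
      pow_one] at h
    simp only [map_add, map_mul, map_one, map_ofNat, Nat.cast_add, Nat.cast_one] at *
    linear_combination h - (C (n : ℝ) + 2 * C α) * h1

/-- `x C_n` in terms of the neighbouring polynomials. -/
theorem X_mul_gegPoly_succ {α : ℝ} (hα : 0 < α) (n : ℕ) :
    X * gegPoly α (n + 1) = C (((n : ℝ) + 2) / (2 * (n + 1 + α))) * gegPoly α (n + 2)
      + C (((n : ℝ) + 2 * α) / (2 * (n + 1 + α))) * gegPoly α n := by
  have h := gegPoly_add_two α n
  have hne : 2 * ((n : ℝ) + 1 + α) ≠ 0 := by positivity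
  have h2 : (C (2 * ((n : ℝ) + 1 + α)) : ℝ[X]) ≠ 0 := by rwa [Ne, C_eq_zero]
  apply mul_left_cancel₀ h2
  rw [mul_add (C _), ← mul_assoc, ← mul_assoc, ← mul_assoc, ← C_mul, ← C_mul,
    mul_div_cancel₀ _ hne, mul_div_cancel₀ _ hne]
  linear_combination -h

theorem X_mul_gegPoly_zero {α : ℝ} (hα : 0 < α) :
    X * gegPoly α 0 = C (1 / (2 * α)) * gegPoly α 1 := by
  simp only [gegPoly]
  rw [← mul_assoc, ← C_mul, one_div_mul_cancel (by positivity)]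
  simp

end Identities

/-! ### The reproducing property from integration by parts alone -/

section Reproducing

open Polynomial

/-- A bilinear functional on polynomials satisfying the integration by parts rule of
`E[g(x·u) h(x·w)]` on the sphere of dimension `2 α + 1` with `u·w = y`. -/
structure IsZonalPairing (α y : ℝ) (Φ : ℝ[X] →ₗ[ℝ] ℝ[X] →ₗ[ℝ] ℝ) : Prop where
  one_one : Φ 1 1 = 1
  left : ∀ g h, Φ ((1 - X ^ 2) * derivative g - C (2 * α + 1) * X * g) h
    + y * Φ g (derivative h) - Φ (X * g) (X * derivative h) = 0
  right : ∀ g h, Φ g ((1 - X ^ 2) * derivative h - C (2 * α + 1) * X * h)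
    + y * Φ (derivative g) h - Φ (X * derivative g) (X * h) = 0

namespace IsZonalPairing

variable {α y : ℝ} {Φ : ℝ[X] →ₗ[ℝ] ℝ[X] →ₗ[ℝ] ℝ}

theorem map_C_mul_left (c : ℝ) (g h : ℝ[X]) : Φ (C c * g) h = c * Φ g h := by
  rw [← smul_eq_C_mul, map_smul, LinearMap.smul_apply, smul_eq_mul]

theorem map_C_mul_right (c : ℝ) (g h : ℝ[X]) : Φ g (C c * h) = c * Φ g h := by
  rw [← smul_eq_C_mul, map_smul, smul_eq_mul]

/-- Self-adjointness of the spherical Laplacian: `left` at `C_l'` and `right` at `C_m'` have the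
same cross terms, and the differential equation turns the rest into the eigenvalues, whose
difference l(l+2α) - m(m+2α) factors. -/
theorem orthogonal (H : IsZonalPairing α y Φ) (hα : 0 < α) {l m : ℕ} (hlm : l ≠ m) :
    Φ (gegPoly α l) (gegPoly α m) = 0 := by
  have h1 := H.left (derivative (gegPoly α l)) (gegPoly α m)
  have h2 := H.right (gegPoly α l) (derivative (gegPoly α m))
  rw [gegPoly_ode, neg_mul, map_neg, LinearMap.neg_apply, map_C_mul_left] at h1
  rw [gegPoly_ode, neg_mul, map_neg, map_C_mul_right] at h2
  have h3 : ((l : ℝ) - m) * (l + m + 2 * α) * Φ (gegPoly α l) (gegPoly α m) = 0 := by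
    linear_combination h2 - h1
  have h4 : ((l : ℝ) - m) ≠ 0 := sub_ne_zero.2 (by exact_mod_cast hlm)
  have h5 : ((l : ℝ) + m + 2 * α) ≠ 0 := by positivity
  simpa [h4, h5] using h3

/-- `C_m'` is a combination of `C_k` with `k < m`, all orthogonal to `C_l`. -/
theorem derivative_of_le (H : IsZonalPairing α y Φ) (hα : 0 < α) (l : ℕ) :
    ∀ m : ℕ, m ≤ l → Φ (gegPoly α l) (derivative (gegPoly α m)) = 0
  | 0, _ => by simp [gegPoly]
  | 1, h => by
    have : derivative (gegPoly α 1) = C (2 * α) * gegPoly α 0 := by simp [gegPoly]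
    rw [this, map_C_mul_right, H.orthogonal hα (by omega), mul_zero]
  | m + 2, h => by
    rw [derivative_gegPoly_add_two, map_add, map_C_mul_right, H.orthogonal hα (by omega),
      derivative_of_le H hα l m (by omega), mul_zero, add_zero]

theorem derivative_succ (H : IsZonalPairing α y Φ) (hα : 0 < α) (l : ℕ) :
    Φ (gegPoly α l) (derivative (gegPoly α (l + 1))) =
      2 * (l + α) * Φ (gegPoly α l) (gegPoly α l) := by
  rcases l with _ | l
  · have : derivative (gegPoly α 1) = C (2 * α) * gegPoly α 0 := by simp [gegPoly]
    rw [zero_add, this, map_C_mul_right]; simp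
  · rw [derivative_gegPoly_add_two, map_add, map_C_mul_right,
      H.derivative_of_le hα (l + 1) l (by omega)]
    push_cast; ring

/-- Orthogonality reduces `left` at `C_{l+1}`, `C_{l+2}` to diagonal pairings. With `α / (l + α) *
C_l(y)` inserted for these, the outcome is the three-term recurrence at `y`. -/
theorem diag_rec (H : IsZonalPairing α y Φ) (hα : 0 < α) (l : ℕ) :
    ((l : ℝ) + 2) * (l + 2 + α) * Φ (gegPoly α (l + 2)) (gegPoly α (l + 2)) =
      2 * (l + 1 + α) ^ 2 * y * Φ (gegPoly α (l + 1)) (gegPoly α (l + 1))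
        - (l + α) * (l + 2 * α) * Φ (gegPoly α l) (gegPoly α l) := by
  have h1 := H.left (gegPoly α (l + 1)) (gegPoly α (l + 2))
  have hne : ((l : ℝ) + 1 + α) ≠ 0 := by positivity
  have e1 : (1 - X ^ 2) * derivative (gegPoly α (l + 1)) - C (2 * α + 1) * X * gegPoly α (l + 1)
      = C ((l : ℝ) + 2 * α) * gegPoly α l
        - C ((l : ℝ) + 2 + 2 * α) * (X * gegPoly α (l + 1)) := by
    rw [one_sub_sq_mul_derivative_gegPoly]
    simp only [map_add, map_mul, map_one, map_ofNat]
    ring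
  have e2 := X_mul_derivative_gegPoly α (l + 1)
  have e3 := H.derivative_succ hα (l + 1)
  have e4 := H.derivative_succ hα l
  simp only [show l + 1 + 1 = l + 2 from rfl, Nat.cast_add, Nat.cast_one] at *
  rw [e1, e2, e3, X_mul_gegPoly_succ hα] at h1
  simp only [Φ.map_add, Φ.map_sub, (Φ _).map_add, LinearMap.add_apply, LinearMap.sub_apply,
    map_C_mul_left,
    map_C_mul_right, e4, H.orthogonal hα (show l ≠ l + 2 by omega),
    H.derivative_of_le hα (l + 2) (l + 1) (by omega)] at h1
  field_simp at h1
  linear_combination (-1 / 2) * h1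

theorem diag_one (H : IsZonalPairing α y Φ) :
    (1 + α) * Φ (gegPoly α 1) (gegPoly α 1) = 2 * α ^ 2 * y := by
  have h1 := H.left 1 X
  have h2 := H.one_one
  have e : gegPoly α 1 = C (2 * α) * X := rfl
  rw [e, map_C_mul_left, map_C_mul_right]
  simp only [derivative_one, mul_zero, mul_one, zero_sub, map_neg, LinearMap.neg_apply,
    map_C_mul_left, derivative_X] at h1
  rw [h2] at h1
  linear_combination (-2 * α ^ 2) * h1

/-- The reproducing property of Gegenbauer polynomials. -/
theorem diag (H : IsZonalPairing α y Φ) (hα : 0 < α) :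
    ∀ l : ℕ, Φ (gegPoly α l) (gegPoly α l) = α / (l + α) * gegenbauer α l y
  | 0 => by simp [gegPoly, gegenbauer, H.one_one, hα.ne']
  | 1 => by
    have h := H.diag_one
    have h1 : 1 + α ≠ 0 := by positivity
    simp only [gegenbauer, Nat.cast_one]
    field_simp
    linear_combination h
  | l + 2 => by
    have h := H.diag_rec hα l
    rw [diag H hα l, diag H hα (l + 1)] at h
    have h1 : (l : ℝ) + 2 + α ≠ 0 := by positivity
    have h2 : (l : ℝ) + α ≠ 0 := by positivity
    have h3 : (l : ℝ) + 1 + α ≠ 0 := by positivity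
    simp only [gegenbauer, Nat.cast_add, Nat.cast_ofNat, Nat.cast_one] at *
    field_simp at h ⊢
    linear_combination h

end IsZonalPairing

end Reproducing

/-! ### Polar coordinates and the uniform measure on the sphere -/

section Polar

open Metric Set Module

variable {E : Type*} [NormedAddCommGroup E] [InnerProductSpace ℝ E] [FiniteDimensional ℝ E]
  [MeasurableSpace E] [BorelSpace E] [Nontrivial E]

theorem integral_eq_integral_toSphere_prod (H : E → ℝ) :
    ∫ x, H x = ∫ p : sphere (0 : E) 1 × Ioi (0 : ℝ), H (p.2.1 • p.1.1)
      ∂((volume : Measure E).toSphere.prod (Measure.volumeIoiPow (finrank ℝ E - 1))) := by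
  have h := (volume : Measure E).measurePreserving_homeomorphUnitSphereProd.integral_comp
    (Homeomorph.measurableEmbedding _) (fun p => H (p.2.1 • p.1.1))
  rw [← h]
  calc ∫ x, H x = ∫ x : ({(0)}ᶜ : Set E), H x.1 ∂((volume : Measure E).comap (↑)) := by
        rw [integral_subtype_comap (measurableSet_singleton _).compl H, restrict_compl_singleton]
    _ = _ := by
        congr 1 with x
        congr 1
        have hx : ‖x.1‖ ≠ 0 := norm_ne_zero_iff.2 x.2
        simp [smul_smul, hx]

theorem integral_volumeIoiPow (n : ℕ) (h : ℝ → ℝ) :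
    ∫ r : Ioi (0 : ℝ), h r ∂(Measure.volumeIoiPow n) = ∫ r in Ioi (0 : ℝ), r ^ n * h r := by
  simp only [Measure.volumeIoiPow, ENNReal.ofReal]
  rw [integral_withDensity_eq_integral_smul,
    integral_subtype_comap measurableSet_Ioi fun a ↦ Real.toNNReal (a ^ n) • h a,
    setIntegral_congr_fun measurableSet_Ioi fun x hx ↦ ?_]
  · rw [NNReal.smul_def, Real.coe_toNNReal _ (pow_nonneg hx.out.le _), smul_eq_mul]
  · exact (measurable_subtype_coe.pow_const _).real_toNNReal

/-- The moments of the half-line Gaussian. -/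
def halfGaussMoment (m : ℕ) : ℝ := ∫ r in Ioi (0 : ℝ), r ^ m * Real.exp (-(1 / 2) * r ^ 2)

theorem integrableOn_pow_mul_gauss (m : ℕ) {b : ℝ} (hb : 0 < b) :
    IntegrableOn (fun r : ℝ => r ^ m * Real.exp (-b * r ^ 2)) (Ioi 0) := by
  have := integrableOn_rpow_mul_exp_neg_mul_sq hb (s := m) (by linarith [(m.cast_nonneg : (0:ℝ) ≤ m)])
  simpa using this

theorem integral_pow_mul_gauss (m : ℕ) {b : ℝ} (hb : 0 < b) :
    ∫ r in Ioi (0 : ℝ), r ^ m * Real.exp (-b * r ^ 2)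
      = b ^ (-((m : ℝ) + 1) / 2) * (1 / 2) * Real.Gamma (((m : ℝ) + 1) / 2) := by
  have := integral_rpow_mul_exp_neg_mul_rpow (p := 2) (q := m) (b := b) two_pos
    (by linarith [(m.cast_nonneg : (0:ℝ) ≤ m)]) hb
  simpa using this

theorem halfGaussMoment_eq (m : ℕ) : halfGaussMoment m
    = (1 / 2 : ℝ) ^ (-((m : ℝ) + 1) / 2) * (1 / 2) * Real.Gamma (((m : ℝ) + 1) / 2) :=
  integral_pow_mul_gauss m (by norm_num)

theorem halfGaussMoment_pos (m : ℕ) : 0 < halfGaussMoment m := by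
  rw [halfGaussMoment_eq]
  have : 0 < Real.Gamma (((m : ℝ) + 1) / 2) := Real.Gamma_pos_of_pos (by positivity)
  positivity

theorem halfGaussMoment_add_two (m : ℕ) :
    halfGaussMoment (m + 2) = (m + 1) * halfGaussMoment m := by
  rw [halfGaussMoment_eq, halfGaussMoment_eq]
  have h1 : (((m + 2 : ℕ) : ℝ) + 1) / 2 = ((m : ℝ) + 1) / 2 + 1 := by push_cast; ring
  have h2 : -(((m + 2 : ℕ) : ℝ) + 1) / 2 = -((m : ℝ) + 1) / 2 + (-1) := by push_cast; ring
  rw [h1, h2, Real.Gamma_add_one (by positivity), Real.rpow_add (by norm_num), Real.rpow_neg_one]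
  ring

theorem integrable_norm_pow_mul_gauss (m : ℕ) {b : ℝ} (hb : 0 < b) :
    Integrable (fun x : E => ‖x‖ ^ m * Real.exp (-b * ‖x‖ ^ 2)) := by
  rw [integrable_fun_norm_addHaar (volume : Measure E)
    (f := fun r => r ^ m * Real.exp (-b * r ^ 2))]
  have := integrableOn_pow_mul_gauss (finrank ℝ E - 1 + m) hb
  simpa [pow_add, mul_assoc] using this

variable (E) in
/-- The uniform probability measure on the unit sphere. -/
def sphereProb : Measure (sphere (0 : E) 1) :=
  ((volume : Measure E).toSphere univ)⁻¹ • (volume : Measure E).toSphere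

instance : IsProbabilityMeasure (sphereProb E) := by
  refine ⟨?_⟩
  rw [sphereProb, Measure.smul_apply, smul_eq_mul]
  exact ENNReal.inv_mul_cancel (Measure.measure_univ_ne_zero.2 (Measure.toSphere_ne_zero _)) (measure_ne_top _ _)

theorem toSphere_eq_smul_sphereProb :
    (volume : Measure E).toSphere = (volume : Measure E).toSphere univ • sphereProb E := by
  rw [sphereProb, smul_smul, ENNReal.mul_inv_cancel (Measure.measure_univ_ne_zero.2 (Measure.toSphere_ne_zero _))
    (measure_ne_top _ _), one_smul]

variable (E) in
/-- The area of the unit sphere. -/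
def sphereArea : ℝ := (volume : Measure E).toSphere.real univ

theorem sphereArea_pos : 0 < sphereArea E := by
  rw [sphereArea, Measure.real, ENNReal.toReal_pos_iff]
  exact ⟨pos_iff_ne_zero.2 (Measure.measure_univ_ne_zero.2 (Measure.toSphere_ne_zero _)),
    measure_lt_top _ _⟩

theorem integral_toSphere (F : sphere (0 : E) 1 → ℝ) :
    ∫ ω, F ω ∂(volume : Measure E).toSphere = sphereArea E * ∫ ω, F ω ∂(sphereProb E) := by
  conv_lhs => rw [toSphere_eq_smul_sphereProb]
  rw [integral_smul_measure, smul_eq_mul]; rfl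

/-- Homogeneity separates radius from direction. Through this lemma, Gaussian identities become
identities on the sphere. -/
theorem integral_homogeneous_mul_gauss (F : E → ℝ) (d : ℕ)
    (hF : ∀ r : ℝ, 0 < r → ∀ x, F (r • x) = r ^ d * F x) :
    ∫ x, F x * Real.exp (-(1 / 2) * ‖x‖ ^ 2) =
      sphereArea E * halfGaussMoment (finrank ℝ E - 1 + d) * ∫ ω, F ω ∂(sphereProb E) := by
  rw [integral_eq_integral_toSphere_prod]
  have h : ∀ p : sphere (0 : E) 1 × Ioi (0 : ℝ),
      F (p.2.1 • p.1.1) * Real.exp (-(1 / 2) * ‖p.2.1 • p.1.1‖ ^ 2) =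
        F p.1.1 * (p.2.1 ^ d * Real.exp (-(1 / 2) * p.2.1 ^ 2)) := by
    rintro ⟨ω, r⟩
    have h1 : ‖r.1 • ω.1‖ = r.1 := by
      rw [norm_smul, Real.norm_of_nonneg (le_of_lt r.2)]; simp
    simp only [h1, hF r.1 r.2]
    ring
  simp_rw [h]
  rw [integral_prod_mul (fun ω : sphere (0 : E) 1 => F ω)
    (fun r : Ioi (0 : ℝ) => r.1 ^ d * Real.exp (-(1 / 2) * r.1 ^ 2)), integral_toSphere,
    integral_volumeIoiPow _ (fun r => r ^ d * Real.exp (-(1 / 2) * r ^ 2))]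
  have : ∫ r in Ioi (0 : ℝ), r ^ (finrank ℝ E - 1) * (r ^ d * Real.exp (-(1 / 2) * r ^ 2))
      = halfGaussMoment (finrank ℝ E - 1 + d) := by
    simp only [halfGaussMoment, pow_add, mul_assoc]
  rw [this]
  ring

end Polar

/-! ### Moments of linear forms on the sphere -/

section Moments

open Metric Set Module

variable {E : Type*} [NormedAddCommGroup E] [InnerProductSpace ℝ E] [FiniteDimensional ℝ E]
  [MeasurableSpace E] [BorelSpace E] [Nontrivial E]

local notation "⟪" x ", " y "⟫" => inner ℝ x y

theorem integrable_inner_pow_mul_gauss (u w : E) (j k : ℕ) :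
    Integrable (fun x : E => ⟪u, x⟫ ^ j * ⟪w, x⟫ ^ k * Real.exp (-(1 / 2) * ‖x‖ ^ 2)) := by
  refine ((integrable_norm_pow_mul_gauss (E := E) (j + k) (b := 1 / 2)
    (by norm_num)).const_mul (‖u‖ ^ j * ‖w‖ ^ k)).mono' (by fun_prop) (ae_of_all _ fun x => ?_)
  rw [norm_mul, norm_mul, norm_pow, norm_pow, Real.norm_of_nonneg (Real.exp_pos _).le]
  have h1 := pow_le_pow_left₀ (norm_nonneg _) (norm_inner_le_norm (𝕜 := ℝ) u x) j
  have h2 := pow_le_pow_left₀ (norm_nonneg _) (norm_inner_le_norm (𝕜 := ℝ) w x) k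
  calc _ ≤ (‖u‖ * ‖x‖) ^ j * (‖w‖ * ‖x‖) ^ k * Real.exp (-(1 / 2) * ‖x‖ ^ 2) := by gcongr
    _ = _ := by rw [mul_pow, mul_pow, pow_add]; ring

/-- Stein's identity: along `u` the Gaussian weight has derivative -⟨u, x⟩ times itself. The
truncated exponents `j - 1`, `k - 1` at zero are harmless, being multiplied by `j`, `k`. -/
theorem gauss_stein (u w : E) (j k : ℕ) :
    ∫ x : E, ⟪u, x⟫ ^ (j + 1) * ⟪w, x⟫ ^ k * Real.exp (-(1 / 2) * ‖x‖ ^ 2) =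
      j * ⟪u, u⟫ * (∫ x : E, ⟪u, x⟫ ^ (j - 1) * ⟪w, x⟫ ^ k * Real.exp (-(1 / 2) * ‖x‖ ^ 2))
      + k * ⟪u, w⟫ * ∫ x : E, ⟪u, x⟫ ^ j * ⟪w, x⟫ ^ (k - 1) * Real.exp (-(1 / 2) * ‖x‖ ^ 2) := by
  have hf : ∀ x : E, HasLineDerivAt ℝ (fun x : E => ⟪u, x⟫ ^ j * ⟪w, x⟫ ^ k)
      (j * ⟪u, x⟫ ^ (j - 1) * ⟪u, u⟫ * ⟪w, x⟫ ^ k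
        + ⟪u, x⟫ ^ j * (k * ⟪w, x⟫ ^ (k - 1) * ⟪u, w⟫)) x u := by
    intro x
    have e1 : HasDerivAt (fun t : ℝ => ⟪u, x + t • u⟫) ⟪u, u⟫ 0 := by
      simp only [inner_add_right, inner_smul_right]
      simpa using ((hasDerivAt_id (0 : ℝ)).mul_const ⟪u, u⟫).const_add ⟪u, x⟫
    have e2 : HasDerivAt (fun t : ℝ => ⟪w, x + t • u⟫) ⟪u, w⟫ 0 := by
      simp only [inner_add_right, inner_smul_right]
      rw [real_inner_comm w u]
      simpa using ((hasDerivAt_id (0 : ℝ)).mul_const ⟪w, u⟫).const_add ⟪w, x⟫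
    have := (e1.pow j).mul (e2.pow k)
    exact HasDerivAt.congr_deriv this (by simp)
  have hg : ∀ x : E, HasLineDerivAt ℝ (fun x : E => Real.exp (-(1 / 2) * ‖x‖ ^ 2))
      (-(⟪u, x⟫ * Real.exp (-(1 / 2) * ‖x‖ ^ 2))) x u := by
    intro x
    have e1 : HasDerivAt (fun t : ℝ => ‖x + t • u‖ ^ 2) (2 * ⟪u, x⟫) 0 := by
      have : HasDerivAt (fun t : ℝ => x + t • u) u 0 := by
        simpa using ((hasDerivAt_id (0 : ℝ)).smul_const u).const_add x
      have := this.norm_sq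
      simpa [real_inner_comm] using this
    have := (e1.const_mul (-(1 / 2))).exp
    refine HasDerivAt.congr_deriv this ?_
    simp; ring
  have i0 := integrable_inner_pow_mul_gauss u w j k
  have i1 := integrable_inner_pow_mul_gauss u w (j + 1) k
  have i2 := (integrable_inner_pow_mul_gauss u w (j - 1) k).const_mul (j * ⟪u, u⟫)
  have i3 := (integrable_inner_pow_mul_gauss u w j (k - 1)).const_mul (k * ⟪u, w⟫)
  have key := integral_bilinear_hasLineDerivAt_right_eq_neg_left_of_integrable
    (μ := (volume : Measure E)) (B := ContinuousLinearMap.mul ℝ ℝ) (v := u)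
    (f := fun x : E => ⟪u, x⟫ ^ j * ⟪w, x⟫ ^ k)
    (g := fun x : E => Real.exp (-(1 / 2) * ‖x‖ ^ 2))
    (f' := fun x : E => j * ⟪u, x⟫ ^ (j - 1) * ⟪u, u⟫ * ⟪w, x⟫ ^ k
        + ⟪u, x⟫ ^ j * (k * ⟪w, x⟫ ^ (k - 1) * ⟪u, w⟫))
    (g' := fun x : E => -(⟪u, x⟫ * Real.exp (-(1 / 2) * ‖x‖ ^ 2)))
    (by refine (i2.add i3).congr (ae_of_all _ fun x => ?_); simp; ring)
    (by refine i1.neg.congr (ae_of_all _ fun x => ?_); simp; ring)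
    (by simpa using i0) (fun x _ => hf x) (fun x _ => hg x)
  rw [← integral_const_mul, ← integral_const_mul, ← integral_add i2 i3]
  have e1 : ∀ x : E, ContinuousLinearMap.mul ℝ ℝ (⟪u, x⟫ ^ j * ⟪w, x⟫ ^ k)
      (-(⟪u, x⟫ * Real.exp (-(1 / 2) * ‖x‖ ^ 2))) =
      -(⟪u, x⟫ ^ (j + 1) * ⟪w, x⟫ ^ k * Real.exp (-(1 / 2) * ‖x‖ ^ 2)) := by
    intro x; simp; ring
  simp only [e1, integral_neg, neg_inj] at key
  rw [key]
  refine integral_congr_ae (ae_of_all _ fun x => ?_)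
  simp; ring

/-- Joint moments of two linear forms on the sphere. -/
def sphereMoment (u w : E) (j k : ℕ) : ℝ := ∫ ω, ⟪u, ω.1⟫ ^ j * ⟪w, ω.1⟫ ^ k ∂(sphereProb E)

theorem gauss_eq_sphereMoment (u w : E) (j k : ℕ) :
    ∫ x : E, ⟪u, x⟫ ^ j * ⟪w, x⟫ ^ k * Real.exp (-(1 / 2) * ‖x‖ ^ 2) =
      sphereArea E * halfGaussMoment (finrank ℝ E - 1 + (j + k)) * sphereMoment u w j k := by
  apply integral_homogeneous_mul_gauss (F := fun x => ⟪u, x⟫ ^ j * ⟪w, x⟫ ^ k)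
  intro r _ x
  simp only [inner_smul_right, mul_pow, pow_add]
  ring

/-- The radial factors in Stein's identity differ by two degrees, and their ratio is n - 1 + j + k.
-/
theorem sphereMoment_rec {u : E} (hu : ‖u‖ = 1) (w : E) (j k : ℕ) :
    ((finrank ℝ E : ℝ) - 1 + j + k) * sphereMoment u w (j + 1) k =
      j * sphereMoment u w (j - 1) k + k * ⟪u, w⟫ * sphereMoment u w j (k - 1) := by
  have h := gauss_stein u w j k
  have hn : 1 ≤ finrank ℝ E := finrank_pos
  rw [gauss_eq_sphereMoment, gauss_eq_sphereMoment, gauss_eq_sphereMoment,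
    real_inner_self_eq_norm_sq, hu] at h
  have hA := (sphereArea_pos (E := E)).ne'
  set n := finrank ℝ E
  -- For `j + k = 0` the identity only says that the first moment vanishes. Otherwise the radial
  -- moments on the right all have degree `d = j + k - 1` beyond `n - 1`.
  rcases Nat.eq_zero_or_pos (j + k) with h0 | h0
  · obtain ⟨rfl, rfl⟩ : j = 0 ∧ k = 0 := by omega
    have := (halfGaussMoment_pos (n - 1 + (0 + 1 + 0))).ne'
    simp only [Nat.cast_zero, zero_mul, add_zero, mul_eq_zero, hA, this, false_or] at h
    simp [h]
  · obtain ⟨d, hd⟩ : ∃ d, j + k = d + 1 := ⟨j + k - 1, by omega⟩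
    have e1 : n - 1 + (j + 1 + k) = n - 1 + d + 2 := by omega
    have hm := (halfGaussMoment_pos (n - 1 + d)).ne'
    have e2 : j * (1 : ℝ) ^ 2 * (sphereArea E * halfGaussMoment (n - 1 + (j - 1 + k)) *
        sphereMoment u w (j - 1) k) = j * (sphereArea E * halfGaussMoment (n - 1 + d) *
        sphereMoment u w (j - 1) k) := by
      rcases Nat.eq_zero_or_pos j with rfl | hj
      · simp
      · rw [show j - 1 + k = d by omega]; ring
    have e3 : k * ⟪u, w⟫ * (sphereArea E * halfGaussMoment (n - 1 + (j + (k - 1))) *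
        sphereMoment u w j (k - 1)) = k * ⟪u, w⟫ * (sphereArea E * halfGaussMoment (n - 1 + d) *
        sphereMoment u w j (k - 1)) := by
      rcases Nat.eq_zero_or_pos k with rfl | hj
      · simp
      · rw [show j + (k - 1) = d by omega]
    rw [e1, e2, e3, halfGaussMoment_add_two] at h
    have e4 : (((n - 1 + d : ℕ) : ℝ) + 1) = (n : ℝ) - 1 + j + k := by
      have : ((j + k : ℕ) : ℝ) = ((d + 1 : ℕ) : ℝ) := by rw [hd]
      push_cast [Nat.cast_sub hn] at this ⊢
      linarith
    rw [e4] at h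
    have h3 : sphereArea E * halfGaussMoment (n - 1 + d) ≠ 0 := mul_ne_zero hA hm
    apply mul_left_cancel₀ h3
    linear_combination h

end Moments

/-! ### The spherical pairing of polynomials -/

section Pairing

open Metric Set Module Polynomial

variable {E : Type*} [NormedAddCommGroup E] [InnerProductSpace ℝ E] [FiniteDimensional ℝ E]
  [MeasurableSpace E] [BorelSpace E] [Nontrivial E]

local notation "⟪" x ", " y "⟫" => inner ℝ x y

theorem Continuous.integrable_sphereProb {f : sphere (0 : E) 1 → ℝ} (hf : Continuous f) :
    Integrable f (sphereProb E) :=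
  hf.integrable_of_hasCompactSupport (HasCompactSupport.of_compactSpace f)

/-- The pairing `E[g(u·ω) h(w·ω)]` of polynomials over the unit sphere. -/
def zonalPairing (u w : E) : ℝ[X] →ₗ[ℝ] ℝ[X] →ₗ[ℝ] ℝ :=
  LinearMap.mk₂ ℝ (fun g h => ∫ ω, g.eval ⟪u, ω.1⟫ * h.eval ⟪w, ω.1⟫ ∂(sphereProb E))
    (fun g g' h => by
      rw [← integral_add (Continuous.integrable_sphereProb (by fun_prop))
        (Continuous.integrable_sphereProb (by fun_prop))]
      simp [add_mul])
    (fun c g h => by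
      rw [smul_eq_mul, ← integral_const_mul]
      simp [mul_assoc])
    (fun g h h' => by
      rw [← integral_add (Continuous.integrable_sphereProb (by fun_prop))
        (Continuous.integrable_sphereProb (by fun_prop))]
      simp [mul_add])
    (fun c g h => by
      rw [smul_eq_mul, ← integral_const_mul]
      simp [mul_left_comm])

theorem zonalPairing_apply (u w : E) (g h : ℝ[X]) :
    zonalPairing u w g h = ∫ ω, g.eval ⟪u, ω.1⟫ * h.eval ⟪w, ω.1⟫ ∂(sphereProb E) := rfl

theorem zonalPairing_comm (u w : E) (g h : ℝ[X]) : zonalPairing u w g h = zonalPairing w u h g := by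
  simp only [zonalPairing_apply, mul_comm]

theorem zonalPairing_X_pow (u w : E) (j k : ℕ) :
    zonalPairing u w (X ^ j) (X ^ k) = sphereMoment u w j k := by
  simp [zonalPairing_apply, sphereMoment]

/-- By bilinearity it suffices to treat monomials, where this is the moment recursion with n = 2α +
2. -/
theorem zonalPairing_left {u : E} (hu : ‖u‖ = 1) (w : E) {α : ℝ}
    (hα : (finrank ℝ E : ℝ) = 2 * α + 2) (g h : ℝ[X]) :
    zonalPairing u w ((1 - X ^ 2) * derivative g - C (2 * α + 1) * X * g) h
    + ⟪u, w⟫ * zonalPairing u w g (derivative h)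
    - zonalPairing u w (X * g) (X * derivative h) = 0 := by
  induction g using Polynomial.induction_on' with
  | add g g' ih ih' =>
    simp only [mul_add, add_sub_add_comm, LinearMap.map_add,
      LinearMap.add_apply]
    linear_combination ih + ih'
  | monomial j a =>
  induction h using Polynomial.induction_on' with
  | add h h' ih ih' =>
    simp only [mul_add, LinearMap.map_add]
    linear_combination ih + ih'
  | monomial k b =>
    have hr := sphereMoment_rec hu w j k
    set Φ := zonalPairing u w
    have e1 : (1 - X ^ 2) * derivative (monomial j a) - C (2 * α + 1) * X * monomial j a
        = (a * j) • X ^ (j - 1) - (a * (j + 2 * α + 1)) • X ^ (j + 1) := by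
      simp only [← C_mul_X_pow_eq_monomial, derivative_C_mul_X_pow, smul_eq_C_mul]
      rcases j with _ | j
      · simp; ring
      · simp only [map_mul, map_add, map_one, map_ofNat, Nat.add_sub_cancel]
        ring
    have e2 : (monomial j a : ℝ[X]) = a • X ^ j := by
      rw [← C_mul_X_pow_eq_monomial, smul_eq_C_mul]
    have e3 : (monomial k b : ℝ[X]) = b • X ^ k := by
      rw [← C_mul_X_pow_eq_monomial, smul_eq_C_mul]
    have e4 : derivative (b • X ^ k : ℝ[X]) = (b * k) • X ^ (k - 1) := by
      rw [derivative_smul, derivative_X_pow, ← smul_eq_C_mul, smul_smul]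
    have e5 : X * ((b * k) • X ^ (k - 1) : ℝ[X]) = (b * k) • X ^ k := by
      rcases k with _ | k
      · simp
      · rw [mul_smul_comm, Nat.add_sub_cancel, ← pow_succ']
    have e6 : X * (a • X ^ j : ℝ[X]) = a • X ^ (j + 1) := by
      rw [mul_smul_comm, ← pow_succ']
    rw [e1, e2, e3, e4, e5, e6]
    simp only [LinearMap.map_sub, LinearMap.sub_apply, LinearMap.map_smul, LinearMap.smul_apply,
      smul_eq_mul, Φ, zonalPairing_X_pow]
    rw [hα] at hr
    linear_combination (- a * b) * hr

theorem isZonalPairing {u w : E} (hu : ‖u‖ = 1) (hw : ‖w‖ = 1) {α : ℝ}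
    (hα : (finrank ℝ E : ℝ) = 2 * α + 2) : IsZonalPairing α ⟪u, w⟫ (zonalPairing u w) where
  one_one := by simp [zonalPairing_apply]
  left := zonalPairing_left hu w hα
  right g h := by
    have := zonalPairing_left hw u hα h g
    rw [real_inner_comm w u]
    rwa [zonalPairing_comm w u, zonalPairing_comm w u, zonalPairing_comm w u] at this

end Pairing

/-! ### Determinacy of moments on a compact interval -/

section MomentProblem

open Set Polynomial

theorem integrable_polynomial_of_Icc {μ : Measure ℝ} [IsFiniteMeasure μ]
    (hμ : μ (Icc (-1) 1)ᶜ = 0) (p : ℝ[X]) : Integrable (fun x => p.eval x) μ := by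
  have h : μ.restrict (Icc (-1) 1) = μ := Measure.restrict_eq_self_of_ae_mem (by
    rw [ae_iff]; exact hμ)
  rw [← h]
  exact (p.continuous.continuousOn).integrableOn_compact isCompact_Icc

/-- Two finite measures on `[-1,1]` with the same moments coincide. -/
theorem Measure.ext_of_moments {μ ν : Measure ℝ} [IsFiniteMeasure μ] [IsFiniteMeasure ν]
    (hμ : μ (Icc (-1) 1)ᶜ = 0) (hν : ν (Icc (-1) 1)ᶜ = 0)
    (h : ∀ k : ℕ, ∫ x, x ^ k ∂μ = ∫ x, x ^ k ∂ν) : μ = ν := by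
  have hp : ∀ p : ℝ[X], ∫ x, p.eval x ∂μ = ∫ x, p.eval x ∂ν := by
    intro p
    induction p using Polynomial.induction_on' with
    | add p q hp hq =>
      simp only [eval_add]
      rw [integral_add (integrable_polynomial_of_Icc hμ p) (integrable_polynomial_of_Icc hμ q),
        integral_add (integrable_polynomial_of_Icc hν p) (integrable_polynomial_of_Icc hν q),
        hp, hq]
    | monomial k a => simp only [eval_monomial, integral_const_mul, h k]
  refine ext_of_forall_integral_eq_of_IsFiniteMeasure (μ := μ) (ν := ν) fun f => ?_
  -- Weierstrass: a polynomial uniformly `ε`-close to `f` on the interval has the same integral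
  -- against both measures.
  have key : ∀ ε > 0, |∫ x, f x ∂μ - ∫ x, f x ∂ν| ≤ ε * (μ.real univ + ν.real univ) := by
    intro ε hε
    obtain ⟨p, hpε⟩ := exists_polynomial_near_of_continuousOn (-1) 1 f
      f.continuous.continuousOn ε hε
    have hb : ∀ (ρ : Measure ℝ) [IsFiniteMeasure ρ], ρ (Icc (-1) 1)ᶜ = 0 →
        |∫ x, p.eval x ∂ρ - ∫ x, f x ∂ρ| ≤ ε * ρ.real univ := by
      intro ρ _ hρ
      rw [← integral_sub (integrable_polynomial_of_Icc hρ p) (f.integrable ρ)]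
      rw [← Real.norm_eq_abs]
      refine norm_integral_le_of_norm_le_const ?_
      have : ∀ᵐ x ∂ρ, x ∈ Icc (-1 : ℝ) 1 := by rw [ae_iff]; exact hρ
      filter_upwards [this] with x hx
      exact (hpε x hx).le
    have h1 := hb μ hμ
    have h2 := hb ν hν
    rw [hp p] at h1
    rw [abs_le] at *
    constructor <;> linarith [h1.1, h1.2, h2.1, h2.2]
  by_contra hne
  have hpos : 0 < |∫ x, f x ∂μ - ∫ x, f x ∂ν| := abs_pos.2 (sub_ne_zero.2 hne)
  set M := μ.real univ + ν.real univ
  have hM : 0 ≤ M := by positivity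
  -- This `ε` makes the bound less than the gap itself; the `+ 1` covers total mass zero.
  have := key (|∫ x, f x ∂μ - ∫ x, f x ∂ν| / (2 * (M + 1))) (by positivity)
  rw [div_mul_eq_mul_div, le_div_iff₀ (by positivity)] at this
  nlinarith

end MomentProblem

/-! ### The Gegenbauer weight and its moments -/

section GegenbauerMeasure

open Set

/-- The moments of the Gegenbauer weight. -/
def gegMoment (α : ℝ) (k : ℕ) : ℝ := ∫ x in (-1 : ℝ)..1, (1 - x ^ 2) ^ (α - 1 / 2) * x ^ k

variable {α : ℝ}

theorem continuous_gegWeight (hα : 1 / 2 ≤ α) :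
    Continuous fun x : ℝ => (1 - x ^ 2) ^ (α - 1 / 2) :=
  Continuous.rpow_const (by fun_prop) fun _ => Or.inr (by linarith)

/-- The function x^k (1 - x²)^(α + 1/2) vanishes at both endpoints, so its derivative integrates to
zero. -/
theorem gegMoment_rec (hα : 1 / 2 ≤ α) (k : ℕ) :
    (2 * α + 1 + k) * gegMoment α (k + 1) = k * gegMoment α (k - 1) := by
  have hd : ∀ x ∈ uIcc (-1 : ℝ) 1, HasDerivAt (fun x : ℝ => x ^ k * (1 - x ^ 2) ^ (α + 1 / 2))
      (k * ((1 - x ^ 2) ^ (α - 1 / 2) * x ^ (k - 1))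
        - (2 * α + 1 + k) * ((1 - x ^ 2) ^ (α - 1 / 2) * x ^ (k + 1))) x := by
    intro x hx
    rw [uIcc_of_le (by norm_num)] at hx
    have h0 : 0 ≤ 1 - x ^ 2 := by nlinarith [hx.1, hx.2]
    have h1 : HasDerivAt (fun x : ℝ => 1 - x ^ 2) (-(2 * x)) x := by
      simpa using (hasDerivAt_pow 2 x).const_sub 1
    have h2 := h1.rpow_const (p := α + 1 / 2) (Or.inr (by linarith))
    have h3 := (hasDerivAt_pow k x).mul h2
    refine HasDerivAt.congr_deriv h3 ?_
    have e1 : (1 - x ^ 2) ^ (α + 1 / 2) = (1 - x ^ 2) ^ (α - 1 / 2) * (1 - x ^ 2) := by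
      rw [← Real.rpow_add_one' h0 (by linarith)]
      congr 1; ring
    have e2 : α + 1 / 2 - 1 = α - 1 / 2 := by ring
    rw [e1, e2]
    rcases k with _ | k
    · simp; ring
    · simp only [Nat.add_sub_cancel, Nat.cast_add, Nat.cast_one]
      ring
  have c := continuous_gegWeight hα
  have i1 : IntervalIntegrable (fun x : ℝ => k * ((1 - x ^ 2) ^ (α - 1 / 2) * x ^ (k - 1)))
    volume (-1) 1 := (by fun_prop : Continuous _).intervalIntegrable _ _
  have i2 : IntervalIntegrable
    (fun x : ℝ => (2 * α + 1 + k) * ((1 - x ^ 2) ^ (α - 1 / 2) * x ^ (k + 1)))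
    volume (-1) 1 := (by fun_prop : Continuous _).intervalIntegrable _ _
  have h := intervalIntegral.integral_eq_sub_of_hasDerivAt hd (i1.sub i2)
  rw [intervalIntegral.integral_sub i1 i2, intervalIntegral.integral_const_mul,
    intervalIntegral.integral_const_mul] at h
  have e : (0 : ℝ) ^ (α + 1 / 2) = 0 := Real.zero_rpow (by linarith)
  norm_num [e] at h
  simp only [gegMoment]
  norm_num
  linarith

theorem integral_gegMeasure (hα : 1 / 2 ≤ α) (f : ℝ → ℝ) :
    ∫ x, f x ∂(gegMeasure α) = ∫ x in (-1 : ℝ)..1, (1 - x ^ 2) ^ (α - 1 / 2) * f x := by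
  rw [gegMeasure]
  simp only [ENNReal.ofReal]
  rw [integral_withDensity_eq_integral_smul (continuous_gegWeight hα).measurable.real_toNNReal,
    intervalIntegral.integral_of_le (by norm_num), ← integral_Icc_eq_integral_Ioc]
  refine setIntegral_congr_fun measurableSet_Icc fun x hx => ?_
  have h0 : 0 ≤ 1 - x ^ 2 := by nlinarith [hx.1, hx.2]
  simp only [NNReal.smul_def, smul_eq_mul]
  rw [Real.coe_toNNReal _ (Real.rpow_nonneg h0 _)]

theorem gegMeasure_compl_Icc : gegMeasure α (Icc (-1) 1)ᶜ = 0 := by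
  apply withDensity_absolutelyContinuous
  rw [Measure.restrict_apply measurableSet_Icc.compl]
  simp

theorem isFiniteMeasure_gegMeasure (hα : 1 / 2 ≤ α) : IsFiniteMeasure (gegMeasure α) :=
  isFiniteMeasure_withDensity_ofReal
    ((continuous_gegWeight hα).continuousOn.integrableOn_compact isCompact_Icc).2

theorem gegMeasure_ne_zero (hα : 1 / 2 ≤ α) : gegMeasure α univ ≠ 0 := by
  have hpos : 0 < ∫ x in (-1 : ℝ)..1, (1 - x ^ 2) ^ (α - 1 / 2) := by
    refine intervalIntegral.intervalIntegral_pos_of_pos_on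
      ((continuous_gegWeight hα).intervalIntegrable _ _) (fun x hx => ?_) (by norm_num)
    have h0 : 0 < 1 - x ^ 2 := by nlinarith [hx.1, hx.2]
    positivity
  intro h
  have := integral_gegMeasure hα (fun _ => 1)
  rw [Measure.measure_univ_eq_zero.1 h] at this
  simp only [integral_zero_measure, mul_one] at this
  linarith

end GegenbauerMeasure

/-! ### The law of one coordinate on the sphere -/

section Pushforward

open Metric Set Module

variable {E : Type*} [NormedAddCommGroup E] [InnerProductSpace ℝ E] [FiniteDimensional ℝ E]
  [MeasurableSpace E] [BorelSpace E] [Nontrivial E]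

local notation "⟪" x ", " y "⟫" => inner ℝ x y

theorem eq_of_two_step {c : ℝ} (hc : 0 < c) {m m' : ℕ → ℝ} (h0 : m 0 = m' 0)
    (h : ∀ k : ℕ, (c + k) * m (k + 1) = k * m (k - 1))
    (h' : ∀ k : ℕ, (c + k) * m' (k + 1) = k * m' (k - 1)) : ∀ k, m k = m' k
  | 0 => h0
  | 1 => by
    have h1 := h 0
    have h1' := h' 0
    simp [hc.ne'] at h1 h1'
    rw [h1, h1']
  | k + 2 => by
    have hk : c + ((k + 1 : ℕ) : ℝ) ≠ 0 := by positivity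
    apply mul_left_cancel₀ hk
    rw [h (k + 1), h' (k + 1), Nat.add_sub_cancel, eq_of_two_step hc h0 h h' k]

/-- The law of a coordinate on the sphere is the normalised Gegenbauer weight. -/
theorem map_inner_sphereProb {u : E} (hu : ‖u‖ = 1) {α : ℝ} (hα : 1 / 2 ≤ α)
    (hn : (finrank ℝ E : ℝ) = 2 * α + 2) :
    (sphereProb E).map (fun ω => ⟪u, ω.1⟫) = (gegMeasure α univ)⁻¹ • gegMeasure α := by
  have := isFiniteMeasure_gegMeasure hα
  have hne := gegMeasure_ne_zero hα
  have hmeas : Measurable fun ω : sphere (0 : E) 1 => ⟪u, ω.1⟫ := by fun_prop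
  have hfin : IsFiniteMeasure ((gegMeasure α univ)⁻¹ • gegMeasure α) := by
    refine ⟨?_⟩
    rw [Measure.smul_apply, smul_eq_mul, ENNReal.inv_mul_cancel hne (measure_ne_top _ _)]
    exact ENNReal.one_lt_top
  have hprob : IsProbabilityMeasure ((sphereProb E).map (fun ω => ⟪u, ω.1⟫)) :=
    Measure.isProbabilityMeasure_map hmeas.aemeasurable
  refine Measure.ext_of_moments ?_ ?_ ?_
  · rw [Measure.map_apply hmeas measurableSet_Icc.compl]
    convert measure_empty (μ := sphereProb E)
    ext ω
    simp only [mem_preimage, mem_compl_iff, mem_empty_iff_false, iff_false, not_not]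
    have h1 := abs_real_inner_le_norm u ω.1
    have h2 : ‖ω.1‖ = 1 := by simp
    rw [hu, h2, one_mul, abs_le] at h1
    exact h1
  · rw [Measure.smul_apply, gegMeasure_compl_Icc, smul_zero]
  · have hmap : ∀ k : ℕ, ∫ x, x ^ k ∂((sphereProb E).map (fun ω => ⟪u, ω.1⟫))
        = sphereMoment u u k 0 := by
      intro k
      rw [integral_map hmeas.aemeasurable (by fun_prop)]
      simp [sphereMoment]
    -- Both moment sequences start at 1 and obey one recursion: `2 * α + 1` is the dimension minus
    -- one, and `k = 0` forces the first moment to vanish.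
    refine eq_of_two_step (c := 2 * α + 1) (by linarith) ?_ ?_ ?_
    · simp only [pow_zero, integral_const, smul_eq_mul, mul_one, measureReal_def,
        Measure.smul_apply]
      rw [ENNReal.inv_mul_cancel hne (measure_ne_top _ _), measure_univ]
    · intro k
      rw [hmap, hmap]
      have := sphereMoment_rec hu u k 0
      rw [hn] at this
      simp only [Nat.cast_zero, zero_mul, add_zero] at this
      linarith
    · intro k
      simp only [integral_smul_measure, smul_eq_mul, integral_gegMeasure hα]
      have := gegMoment_rec hα k
      simp only [gegMoment] at this
      linear_combination (ENNReal.toReal (gegMeasure α univ)⁻¹) * this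

end Pushforward

/-! ### Second-moment forms of zonal functions -/

section Invariance

open Metric Set Module

variable {E : Type*} [NormedAddCommGroup E] [InnerProductSpace ℝ E] [FiniteDimensional ℝ E]
  [MeasurableSpace E] [BorelSpace E] [Nontrivial E]

local notation "⟪" x ", " y "⟫" => inner ℝ x y

/-- Extend `F` to be constant along rays and weight it by the Gaussian: Lebesgue measure and the
norm are both invariant under `R`. -/
theorem integral_sphereProb_comp_isometry (R : E ≃ₗᵢ[ℝ] E) (F : E → ℝ) :
    ∫ ω, F (R ω.1) ∂(sphereProb E) = ∫ ω, F ω.1 ∂(sphereProb E) := by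
  have key : ∀ F : E → ℝ, ∫ x : E, F (‖x‖⁻¹ • x) * Real.exp (-(1 / 2) * ‖x‖ ^ 2) =
      sphereArea E * halfGaussMoment (finrank ℝ E - 1 + 0) * ∫ ω, F ω.1 ∂(sphereProb E) := by
    intro F
    rw [integral_homogeneous_mul_gauss (fun x => F (‖x‖⁻¹ • x)) 0]
    · simp
    · intro r hr x
      rw [pow_zero, one_mul, norm_smul, Real.norm_of_nonneg hr.le, smul_smul, mul_inv,
        mul_assoc, mul_comm, mul_assoc, mul_inv_cancel₀ hr.ne', mul_one]
  have h1 := key F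
  have h2 := key (fun x => F (R x))
  have h3 := R.measurePreserving.integral_comp R.toHomeomorph.measurableEmbedding
    (fun x => F (‖x‖⁻¹ • x) * Real.exp (-(1 / 2) * ‖x‖ ^ 2))
  simp only [LinearIsometryEquiv.norm_map] at h3
  simp only [map_smul] at h2
  rw [h1, h2] at h3
  have hA := (sphereArea_pos (E := E)).ne'
  have hm := (halfGaussMoment_pos (finrank ℝ E - 1 + 0)).ne'
  exact mul_left_cancel₀ (mul_ne_zero hA hm) h3

theorem abs_inner_sphere_le (a : E) (ω : sphere (0 : E) 1) : |⟪a, ω.1⟫| ≤ ‖a‖ := by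
  have := abs_real_inner_le_norm a ω.1
  simpa using this

theorem MeasureTheory.Integrable.mul_inner_sphere {F : sphere (0 : E) 1 → ℝ}
    (hF : Integrable F (sphereProb E)) (a b : E) :
    Integrable (fun ω => F ω * (⟪a, ω.1⟫ * ⟪b, ω.1⟫)) (sphereProb E) := by
  refine hF.mul_bdd (c := ‖a‖ * ‖b‖) (by fun_prop) (ae_of_all _ fun ω => ?_)
  rw [norm_mul]
  exact mul_le_mul (abs_inner_sphere_le a ω) (abs_inner_sphere_le b ω) (abs_nonneg _)
    (norm_nonneg _)

/-- The bilinear form `(a, b) ↦ E[F(ω) (a·ω) (b·ω)]`. -/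
def sphereForm {F : sphere (0 : E) 1 → ℝ} (hF : Integrable F (sphereProb E)) :
    E →ₗ[ℝ] E →ₗ[ℝ] ℝ :=
  LinearMap.mk₂ ℝ (fun a b => ∫ ω, F ω * (⟪a, ω.1⟫ * ⟪b, ω.1⟫) ∂(sphereProb E))
    (fun a a' b => by
      rw [← integral_add (hF.mul_inner_sphere a b) (hF.mul_inner_sphere a' b)]
      simp only [inner_add_left, add_mul, mul_add])
    (fun c a b => by
      rw [smul_eq_mul, ← integral_const_mul]
      simp only [real_inner_smul_left, mul_left_comm, mul_assoc])
    (fun a b b' => by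
      rw [← integral_add (hF.mul_inner_sphere a b) (hF.mul_inner_sphere a b')]
      simp only [inner_add_left, mul_add])
    (fun c a b => by
      rw [smul_eq_mul, ← integral_const_mul]
      simp only [real_inner_smul_left, mul_left_comm])

theorem sphereForm_apply {F : sphere (0 : E) 1 → ℝ} (hF : Integrable F (sphereProb E)) (a b : E) :
    sphereForm hF a b = ∫ ω, F ω * (⟪a, ω.1⟫ * ⟪b, ω.1⟫) ∂(sphereProb E) := rfl

theorem sphereForm_comm {F : sphere (0 : E) 1 → ℝ} (hF : Integrable F (sphereProb E)) (a b : E) :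
    sphereForm hF a b = sphereForm hF b a := by
  simp only [sphereForm_apply, mul_comm]

/-- On the unit sphere the squared coordinates sum to 1. -/
theorem sphereForm_trace {F : sphere (0 : E) 1 → ℝ} (hF : Integrable F (sphereProb E)) :
    ∑ i, sphereForm hF (stdOrthonormalBasis ℝ E i) (stdOrthonormalBasis ℝ E i)
      = ∫ ω, F ω ∂(sphereProb E) := by
  simp only [sphereForm_apply]
  rw [← integral_finsetSum _ fun i _ => hF.mul_inner_sphere _ _]
  congr 1 with ω
  rw [← Finset.mul_sum]
  have h := (stdOrthonormalBasis ℝ E).sum_sq_norm_inner_right ω.1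
  have h2 : ‖ω.1‖ = 1 := by simp
  simp only [Real.norm_eq_abs, sq_abs, h2] at h
  simp only [← pow_two]
  rw [h]; simp

section Zonal

variable {u w : E} {G : ℝ → ℝ → ℝ}
  (hG : Integrable (fun ω : sphere (0 : E) 1 => G ⟪u, ω.1⟫ ⟪w, ω.1⟫) (sphereProb E))

/-- The reflection in the hyperplane orthogonal to `c` fixes `u`, `w` and `b` but changes the sign
of ⟨c, ω⟩. -/
theorem sphereForm_eq_zero_of_orthogonal {c b : E} (hu : ⟪c, u⟫ = 0) (hw : ⟪c, w⟫ = 0)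
    (hb : ⟪c, b⟫ = 0) : sphereForm hG c b = 0 := by
  set R := (ℝ ∙ c)ᗮ.reflection
  have hfix : ∀ v : E, ⟪c, v⟫ = 0 → ∀ x, ⟪v, R x⟫ = ⟪v, x⟫ := by
    intro v hv x
    have h1 : R v = v := (Submodule.reflection_eq_self_iff (K := (ℝ ∙ c)ᗮ) v).2
      (Submodule.mem_orthogonal_singleton_iff_inner_right.2 hv)
    conv_lhs => rw [← h1]
    exact R.inner_map_map v x
  have hneg : ∀ x, ⟪c, R x⟫ = -⟪c, x⟫ := by
    intro x
    have h1 : R c = -c := Submodule.reflection_orthogonalComplement_singleton_eq_neg c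
    have h2 := R.inner_map_map c x
    rw [h1, inner_neg_left] at h2
    linarith
  have h := integral_sphereProb_comp_isometry R
    (fun x => G ⟪u, x⟫ ⟪w, x⟫ * (⟪c, x⟫ * ⟪b, x⟫))
  simp only [hfix u hu, hfix w hw, hfix b hb, hneg, neg_mul, mul_neg, integral_neg] at h
  rw [sphereForm_apply]
  linarith

/-- The vector ⟨c,c⟩b - ⟨c,b⟩c is orthogonal to `c`, so the preceding vanishing applies to it. -/
theorem sphereForm_of_orthogonal {c : E} (hu : ⟪c, u⟫ = 0) (hw : ⟪c, w⟫ = 0) (b : E) :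
    ⟪c, c⟫ * sphereForm hG c b = ⟪c, b⟫ * sphereForm hG c c := by
  have h := sphereForm_eq_zero_of_orthogonal hG (b := ⟪c, c⟫ • b - ⟪c, b⟫ • c) hu hw (by
    rw [inner_sub_right, inner_smul_right, inner_smul_right]; ring)
  rw [map_sub, map_smul, map_smul, smul_eq_mul, smul_eq_mul] at h
  linarith

/-- For vectors of equal length, c + d ⟂ c - d. The vanishing of the form on this pair says that its
values at `c` and `d` agree; rescaling gives the general case. -/
theorem sphereForm_orthogonal_const {c d : E} (hcu : ⟪c, u⟫ = 0) (hcw : ⟪c, w⟫ = 0)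
    (hdu : ⟪d, u⟫ = 0) (hdw : ⟪d, w⟫ = 0) :
    ⟪d, d⟫ * sphereForm hG c c = ⟪c, c⟫ * sphereForm hG d d := by
  have key : ∀ c d : E, ⟪c, u⟫ = 0 → ⟪c, w⟫ = 0 → ⟪d, u⟫ = 0 → ⟪d, w⟫ = 0 → ⟪c, c⟫ = ⟪d, d⟫ →
      sphereForm hG c c = sphereForm hG d d := by
    intro c d hcu hcw hdu hdw hcd
    have h := sphereForm_eq_zero_of_orthogonal hG (c := c + d) (b := c - d)
      (by rw [inner_add_left, hcu, hdu, add_zero]) (by rw [inner_add_left, hcw, hdw, add_zero])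
      (by rw [inner_add_left, inner_sub_right, inner_sub_right, hcd, real_inner_comm c d]; ring)
    simp only [map_add, map_sub, LinearMap.add_apply] at h
    rw [sphereForm_comm hG d c] at h
    linarith
  have h := key (‖d‖ • c) (‖c‖ • d) (by simp [real_inner_smul_left, hcu])
    (by simp [real_inner_smul_left, hcw]) (by simp [real_inner_smul_left, hdu])
    (by simp [real_inner_smul_left, hdw]) (by
      simp only [real_inner_smul_left, real_inner_smul_right]
      rw [real_inner_self_eq_norm_sq, real_inner_self_eq_norm_sq]; ring)
  simp only [map_smul, LinearMap.smul_apply, smul_eq_mul] at h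
  rw [real_inner_self_eq_norm_sq, real_inner_self_eq_norm_sq]
  linear_combination h

/-- Dimension at least 3 leaves a nonzero vector `d` orthogonal to `u` and `w`, from which τ is read
off. -/
theorem exists_sphereForm_orthogonal_const (hn : 3 ≤ finrank ℝ E) :
    ∃ τ : ℝ, ∀ c : E, ⟪c, u⟫ = 0 → ⟪c, w⟫ = 0 → ∀ b, sphereForm hG c b = τ * ⟪c, b⟫ := by
  obtain ⟨d, hd0, hdu, hdw⟩ : ∃ d : E, d ≠ 0 ∧ ⟪d, u⟫ = 0 ∧ ⟪d, w⟫ = 0 := by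
    set W := Submodule.span ℝ ({u, w} : Set E)
    have h1 : finrank ℝ W ≤ 2 := by
      classical
      refine (finrank_span_le_card ({u, w} : Set E)).trans ?_
      rw [Set.toFinset_card]
      exact (Set.card_le_card (t := _) (by rfl)).trans
        (by simpa using Finset.card_le_two (a := u) (b := w))
    have h2 := Submodule.finrank_add_finrank_orthogonal W
    have h3 : Wᗮ ≠ ⊥ := by
      intro h
      rw [h, finrank_bot] at h2
      omega
    obtain ⟨d, hd, hd0⟩ := Submodule.exists_mem_ne_zero_of_ne_bot h3
    exact ⟨d, hd0, Submodule.inner_left_of_mem_orthogonal (Submodule.subset_span (by simp)) hd,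
      Submodule.inner_left_of_mem_orthogonal (Submodule.subset_span (by simp)) hd⟩
  have hdd : ⟪d, d⟫ ≠ 0 := inner_self_ne_zero.2 hd0
  refine ⟨sphereForm hG d d / ⟪d, d⟫, fun c hcu hcw b => ?_⟩
  rcases eq_or_ne c 0 with rfl | hc
  · simp
  have hcc : ⟪c, c⟫ ≠ 0 := inner_self_ne_zero.2 hc
  have h1 := sphereForm_of_orthogonal hG hcu hcw b
  have h2 := sphereForm_orthogonal_const hG hcu hcw hdu hdw
  apply mul_left_cancel₀ hcc
  rw [h1]
  field_simp
  linear_combination ⟪c, b⟫ * h2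

/-- Shape of the second moment form of a function of two coordinates. -/
theorem exists_sphereForm_eq (hn : 3 ≤ finrank ℝ E) (hu : ‖u‖ = 1) (hw : ‖w‖ = 1)
    (hy : ⟪u, w⟫ ^ 2 ≠ 1) :
    ∃ A A' C τ : ℝ, ∀ a b, sphereForm hG a b = A * (⟪u, a⟫ * ⟪u, b⟫) + A' * (⟪w, a⟫ * ⟪w, b⟫)
      + C * (⟪u, a⟫ * ⟪w, b⟫ + ⟪w, a⟫ * ⟪u, b⟫) + τ * ⟪a, b⟫ := by
  obtain ⟨τ, hτ⟩ := exists_sphereForm_orthogonal_const hG hn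
  set T := sphereForm hG with hT
  have hs : ∀ a b, T a b = T b a := sphereForm_comm hG
  set y := ⟪u, w⟫ with hydef
  have hy' : 1 - y ^ 2 ≠ 0 := sub_ne_zero.2 hy.symm
  have huu : ⟪u, u⟫ = 1 := by rw [real_inner_self_eq_norm_sq, hu]; norm_num
  have hww : ⟪w, w⟫ = 1 := by rw [real_inner_self_eq_norm_sq, hw]; norm_num
  have hwu : ⟪w, u⟫ = y := real_inner_comm _ _
  -- The form minus τ⟨·,·⟩ annihilates the complement of span(u, w), so only the projection of `a`
  -- matters. Its coordinates come from the inverse Gram matrix, of determinant 1 - y².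
  have hP : ∀ a b, T a b - τ * ⟪a, b⟫ =
      (⟪u, a⟫ - y * ⟪w, a⟫) / (1 - y ^ 2) * (T u b - τ * ⟪u, b⟫) +
      (⟪w, a⟫ - y * ⟪u, a⟫) / (1 - y ^ 2) * (T w b - τ * ⟪w, b⟫) := by
    intro a b
    have h := hτ (a - ((⟪u, a⟫ - y * ⟪w, a⟫) / (1 - y ^ 2)) • u
        - ((⟪w, a⟫ - y * ⟪u, a⟫) / (1 - y ^ 2)) • w)
      (by
        simp only [inner_sub_left, real_inner_smul_left, huu, hwu, real_inner_comm u a]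
        field_simp; ring)
      (by
        simp only [inner_sub_left, real_inner_smul_left, hww, ← hydef, real_inner_comm w a]
        field_simp; ring) b
    simp only [map_sub, map_smul, LinearMap.sub_apply, LinearMap.smul_apply, inner_sub_left,
      real_inner_smul_left, smul_eq_mul] at h
    linear_combination h
  -- Applying the projection formula in both arguments conjugates the matrix of the reduced form by
  -- the inverse Gram matrix.
  refine ⟨((T u u - τ) - 2 * y * (T u w - τ * y) + y ^ 2 * (T w w - τ)) / (1 - y ^ 2) ^ 2,
    (y ^ 2 * (T u u - τ) - 2 * y * (T u w - τ * y) + (T w w - τ)) / (1 - y ^ 2) ^ 2,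
    (-y * (T u u - τ) + (1 + y ^ 2) * (T u w - τ * y) - y * (T w w - τ)) / (1 - y ^ 2) ^ 2,
    τ, fun a b => ?_⟩
  have h0 := hP a b
  have h1 := hP b u
  have h2 := hP b w
  rw [hs b u, hs w u, huu, hwu, real_inner_comm u b] at h1
  rw [hs b w, hww, ← hydef, real_inner_comm w b] at h2
  rw [h1, h2] at h0
  rw [← sub_eq_iff_eq_add, h0]
  field_simp
  ring

/-- The case u = w, where the Gram determinant vanishes; it serves the diagonal entries of the
covariance. -/
theorem exists_sphereForm_eq_of_eq {g : ℝ → ℝ}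
    (hg : Integrable (fun ω : sphere (0 : E) 1 => g ⟪u, ω.1⟫) (sphereProb E))
    (hn : 3 ≤ finrank ℝ E) (hu : ‖u‖ = 1) :
    ∃ A τ : ℝ, ∀ a b, sphereForm hg a b = A * (⟪u, a⟫ * ⟪u, b⟫) + τ * ⟪a, b⟫ := by
  obtain ⟨τ, hτ⟩ := exists_sphereForm_orthogonal_const (u := u) (w := u) (G := fun s _ => g s) hg hn
  set T := sphereForm hg with hT
  have hs : ∀ a b, T a b = T b a := sphereForm_comm hg
  have huu : ⟪u, u⟫ = 1 := by rw [real_inner_self_eq_norm_sq, hu]; norm_num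
  have hP : ∀ a b, T a b - τ * ⟪a, b⟫ = ⟪u, a⟫ * (T u b - τ * ⟪u, b⟫) := by
    intro a b
    have hz : ⟪a - ⟪u, a⟫ • u, u⟫ = 0 := by
      simp only [inner_sub_left, real_inner_smul_left, huu, real_inner_comm u a]; ring
    have h := hτ _ hz hz b
    change T _ b = _ at h
    simp only [map_sub, map_smul, LinearMap.sub_apply, LinearMap.smul_apply, inner_sub_left,
      real_inner_smul_left, smul_eq_mul] at h
    linear_combination h
  refine ⟨T u u - τ, τ, fun a b => ?_⟩
  have h0 := hP a b
  have h1 := hP b u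
  rw [hs b u, huu, real_inner_comm u b] at h1
  rw [h1] at h0
  linear_combination h0

end Zonal

end Invariance

/-! ### Gaussian densities and the angular central Gaussian law -/

section GaussianDensity

open Metric Set Module

variable {E : Type*} [NormedAddCommGroup E] [InnerProductSpace ℝ E] [FiniteDimensional ℝ E]
  [MeasurableSpace E] [BorelSpace E]

local notation "⟪" x ", " y "⟫" => inner ℝ x y

variable (E) in
/-- The normalising constant of the standard Gaussian density. -/
def gaussConst : ℝ := ∫ x : E, Real.exp (-(1 / 2) * ‖x‖ ^ 2)

theorem gaussConst_eq : gaussConst E = (2 * Real.pi) ^ (finrank ℝ E / 2 : ℝ) := by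
  rw [gaussConst, GaussianFourier.integral_rexp_neg_mul_sq_norm (by norm_num)]
  congr 1
  ring

theorem gaussConst_pos : 0 < gaussConst E := by
  rw [gaussConst_eq]; positivity

theorem integrable_gauss : Integrable (fun x : E => Real.exp (-(1 / 2) * ‖x‖ ^ 2)) := by
  by_contra h
  have := gaussConst_pos (E := E)
  rw [gaussConst, integral_undef h] at this
  exact lt_irrefl _ this

theorem stdGaussian_eq_withDensity : stdGaussian E = volume.withDensity
    (fun x : E => ENNReal.ofReal ((gaussConst E)⁻¹ * Real.exp (-(1 / 2) * ‖x‖ ^ 2))) := by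
  have hfin : IsFiniteMeasure (volume.withDensity
    (fun x : E => ENNReal.ofReal ((gaussConst E)⁻¹ * Real.exp (-(1 / 2) * ‖x‖ ^ 2)))) :=
    isFiniteMeasure_withDensity_ofReal (integrable_gauss.const_mul _).2
  apply Measure.ext_of_charFun
  ext t
  rw [charFun_stdGaussian, charFun_apply]
  simp only [ENNReal.ofReal]
  rw [integral_withDensity_eq_integral_smul (by fun_prop)]
  have h := GaussianFourier.integral_cexp_neg_mul_sq_norm_add (V := E) (b := 1 / 2)
    (by norm_num) Complex.I t
  have h2 : ∀ x : E, (Real.toNNReal ((gaussConst E)⁻¹ * Real.exp (-(1 / 2) * ‖x‖ ^ 2))) •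
      Complex.exp ((⟪x, t⟫ : ℝ) * Complex.I) = ((gaussConst E)⁻¹ : ℝ) *
        Complex.exp (-(1 / 2) * (‖x‖ : ℂ) ^ 2 + Complex.I * (⟪t, x⟫ : ℝ)) := by
    intro x
    have hc := (inv_pos.2 (gaussConst_pos (E := E))).le
    rw [NNReal.smul_def, Real.coe_toNNReal _ (by positivity), Complex.exp_add,
      Complex.real_smul, real_inner_comm x t]
    push_cast
    ring_nf
  simp_rw [h2]
  rw [integral_const_mul, h, gaussConst_eq]
  have h3 : ((Real.pi : ℂ) / (1 / 2)) ^ (finrank ℝ E / 2 : ℂ) =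
      (((2 * Real.pi) ^ (finrank ℝ E / 2 : ℝ) : ℝ) : ℂ) := by
    rw [Complex.ofReal_cpow (by positivity)]
    push_cast
    congr 1
    ring
  rw [h3, ← mul_assoc, ← Complex.ofReal_mul, inv_mul_cancel₀ (by positivity), Complex.ofReal_one,
    one_mul, Complex.I_sq]
  congr 1
  ring

theorem integral_stdGaussian (H : E → ℝ) :
    ∫ x, H x ∂(stdGaussian E) = (gaussConst E)⁻¹ * ∫ x, H x * Real.exp (-(1 / 2) * ‖x‖ ^ 2) := by
  rw [stdGaussian_eq_withDensity]
  simp only [ENNReal.ofReal]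
  rw [integral_withDensity_eq_integral_smul (by fun_prop), ← integral_const_mul]
  congr 1 with x
  have hc := (inv_pos.2 (gaussConst_pos (E := E))).le
  rw [NNReal.smul_def, Real.coe_toNNReal _ (by positivity), smul_eq_mul]
  ring

variable [Nontrivial E]

/-- Polar coordinates for a function of the direction against an anisotropic Gaussian. -/
theorem integral_mul_gauss_quadratic {H : E → ℝ} (hH : Measurable H)
    (hom : ∀ r : ℝ, 0 < r → ∀ x, H (r • x) = H x)
    (hint : Integrable (fun ω : sphere (0 : E) 1 => H ω.1) (sphereProb E))
    {q : E → ℝ} (hq : Continuous q) (hqr : ∀ (r : ℝ) x, q (r • x) = r ^ 2 * q x)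
    {m : ℝ} (hm : 0 < m) (hqm : ∀ x, ‖x‖ = 1 → m ≤ q x) :
    ∫ x, H x * Real.exp (-(1 / 2) * q x) =
      sphereArea E * ((1 / 2 : ℝ) ^ (-(finrank ℝ E : ℝ) / 2) * (1 / 2) *
        Real.Gamma ((finrank ℝ E : ℝ) / 2)) *
      ∫ ω, H ω.1 * (q ω.1) ^ (-(finrank ℝ E : ℝ) / 2) ∂(sphereProb E) := by
  have hn : 1 ≤ finrank ℝ E := finrank_pos
  rw [integral_eq_integral_toSphere_prod]
  have h : ∀ p : sphere (0 : E) 1 × Ioi (0 : ℝ),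
      H (p.2.1 • p.1.1) * Real.exp (-(1 / 2) * q (p.2.1 • p.1.1)) =
        H p.1.1 * Real.exp (-(1 / 2 * q p.1.1) * p.2.1 ^ 2) := by
    rintro ⟨ω, r⟩
    simp only [hom r.1 r.2, hqr]
    ring_nf
  simp_rw [h]
  have hmeas : Measurable fun p : sphere (0 : E) 1 × Ioi (0 : ℝ) =>
      H p.1.1 * Real.exp (-(1 / 2 * q p.1.1) * p.2.1 ^ 2) := by
    have := hq.measurable
    fun_prop
  have hint' : Integrable (fun ω : sphere (0 : E) 1 => H ω.1) (volume : Measure E).toSphere := by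
    rw [toSphere_eq_smul_sphereProb]
    exact hint.smul_measure (measure_ne_top _ _)
  have hrad : Integrable (fun r : Ioi (0 : ℝ) => Real.exp (-(1 / 2 * m) * r.1 ^ 2))
      (Measure.volumeIoiPow (finrank ℝ E - 1)) := by
    rw [Measure.volumeIoiPow, integrable_withDensity_iff_integrable_smul' (by fun_prop) (by simp)]
    have := integrableOn_pow_mul_gauss (finrank ℝ E - 1) (b := 1 / 2 * m) (by positivity)
    rw [integrableOn_iff_comap_subtypeVal measurableSet_Ioi] at this
    refine this.congr (ae_of_all _ fun r => ?_)
    have hr : (0 : ℝ) < r.1 := r.2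
    simp [ENNReal.toReal_ofReal (pow_nonneg hr.le _)]
  rw [integral_prod]
  -- The radial integral of r^(n-1) exp(-q r²/2) is a constant times q^(-n/2).
  · have hin : ∀ ω : sphere (0 : E) 1, ∫ r : Ioi (0 : ℝ),
        H ω.1 * Real.exp (-(1 / 2 * q ω.1) * r.1 ^ 2) ∂(Measure.volumeIoiPow (finrank ℝ E - 1)) =
        ((1 / 2 : ℝ) ^ (-(finrank ℝ E : ℝ) / 2) * (1 / 2) * Real.Gamma ((finrank ℝ E : ℝ) / 2)) *
          (H ω.1 * (q ω.1) ^ (-(finrank ℝ E : ℝ) / 2)) := by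
      intro ω
      have hqω : 0 < q ω.1 := hm.trans_le (hqm _ (by simp))
      rw [integral_const_mul, integral_volumeIoiPow _ (fun r => Real.exp (-(1 / 2 * q ω.1) * r ^ 2)),
        integral_pow_mul_gauss _ (by positivity)]
      have hc : (((finrank ℝ E - 1 : ℕ) : ℝ) + 1) = finrank ℝ E := by
        push_cast [Nat.cast_sub hn]; ring
      rw [hc, Real.mul_rpow (by norm_num) hqω.le]
      ring
    simp_rw [hin]
    rw [integral_const_mul, integral_toSphere]
    ring
  -- Replacing `q` by its lower bound `m` on the sphere gives a product majorant, which justifies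
  -- Fubini.
  · refine ((hint'.norm).mul_prod hrad).mono' hmeas.aestronglyMeasurable (ae_of_all _ ?_)
    rintro ⟨ω, r⟩
    rw [norm_mul, Real.norm_of_nonneg (Real.exp_pos _).le]
    have := hqm ω.1 (by simp)
    gcongr

/-- The direction of a Gaussian vector: angular central Gaussian law. -/
theorem integral_stdGaussian_comp_linear (M : E ≃L[ℝ] E) : ∃ K : ℝ, ∀ H : E → ℝ, Measurable H →
    (∀ r : ℝ, 0 < r → ∀ x, H (r • x) = H x) →
    Integrable (fun ω : sphere (0 : E) 1 => H ω.1) (sphereProb E) →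
    ∫ x, H (M x) ∂(stdGaussian E) =
      K * ∫ ω, H ω.1 * (‖M.symm ω.1‖ ^ 2) ^ (-(finrank ℝ E : ℝ) / 2) ∂(sphereProb E) := by
  -- The constant collects the Gaussian normalisation, the Jacobian of `M` and the radial integral.
  -- Only its independence of `H` matters later.
  refine ⟨(gaussConst E)⁻¹ * (ENNReal.ofReal |(LinearMap.det (M : E →ₗ[ℝ] E))⁻¹|).toReal *
    (sphereArea E * ((1 / 2 : ℝ) ^ (-(finrank ℝ E : ℝ) / 2) * (1 / 2) *
        Real.Gamma ((finrank ℝ E : ℝ) / 2))), fun H hH hom hint => ?_⟩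
  have hdet : LinearMap.det (M : E →ₗ[ℝ] E) ≠ 0 := (LinearEquiv.isUnit_det' M.toLinearEquiv).ne_zero
  have hmap := Measure.map_linearMap_addHaar_eq_smul_addHaar (volume : Measure E) hdet
  rw [integral_stdGaussian]
  have hcv : ∫ x, H (M x) * Real.exp (-(1 / 2) * ‖x‖ ^ 2) =
      ∫ x, H x * Real.exp (-(1 / 2) * ‖M.symm x‖ ^ 2) ∂(Measure.map (M : E →ₗ[ℝ] E) volume) := by
    have := M.toHomeomorph.measurableEmbedding.integral_map (μ := (volume : Measure E))
      (fun x => H x * Real.exp (-(1 / 2) * ‖M.symm x‖ ^ 2))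
    refine Eq.trans ?_ this.symm
    simp
  rw [hcv, hmap, integral_smul_measure, smul_eq_mul]
  obtain ⟨m, hm, hqm⟩ : ∃ m : ℝ, 0 < m ∧ ∀ x : E, ‖x‖ = 1 → m ≤ ‖M.symm x‖ ^ 2 := by
    have h1 : ∀ x : E, ‖x‖ ≤ (‖(M : E →L[ℝ] E)‖ + 1) * ‖M.symm x‖ := by
      intro x
      have := (M : E →L[ℝ] E).le_opNorm (M.symm x)
      simp only [ContinuousLinearEquiv.coe_coe, ContinuousLinearEquiv.apply_symm_apply] at this
      nlinarith [norm_nonneg (M.symm x)]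
    refine ⟨((‖(M : E →L[ℝ] E)‖ + 1)⁻¹) ^ 2, by positivity, fun x hx => ?_⟩
    have := h1 x
    rw [hx] at this
    have h2 : (‖(M : E →L[ℝ] E)‖ + 1)⁻¹ ≤ ‖M.symm x‖ := by
      rw [inv_le_iff_one_le_mul₀ (by positivity), mul_comm]; exact this
    exact pow_le_pow_left₀ (by positivity) h2 2
  rw [integral_mul_gauss_quadratic hH hom hint (q := fun x => ‖M.symm x‖ ^ 2) (by fun_prop)
    (fun r x => by rw [map_smul, norm_smul, mul_pow, Real.norm_eq_abs, sq_abs]) hm hqm]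
  ring

end GaussianDensity

/-! ### Gaussian laws as linear images of the standard one -/

section Law

open Module

variable {E : Type*} [NormedAddCommGroup E] [InnerProductSpace ℝ E] [FiniteDimensional ℝ E]

local notation "⟪" x ", " y "⟫" => inner ℝ x y

/-- Take square roots of the eigenvalues in an orthonormal eigenbasis. -/
theorem LinearMap.IsSymmetric.exists_sqrt {A : E →ₗ[ℝ] E} (hA : A.IsSymmetric)
    (hpos : ∀ x, 0 ≤ ⟪A x, x⟫) : ∃ M : E →ₗ[ℝ] E, M.IsSymmetric ∧ ∀ x, M (M x) = A x := by
  set b := hA.eigenvectorBasis rfl with hb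
  set e := hA.eigenvalues rfl with he
  have hAb : ∀ i, A (b i) = e i • b i := fun i => hA.apply_eigenvectorBasis rfl i
  have he0 : ∀ i, 0 ≤ e i := by
    intro i
    have := hpos (b i)
    rw [hAb, real_inner_smul_left, real_inner_self_eq_norm_sq, b.norm_eq_one] at this
    simpa using this
  set M : E →ₗ[ℝ] E := b.toBasis.constr ℝ (fun i => √(e i) • b i) with hM
  have hMb : ∀ i, M (b i) = √(e i) • b i := by
    intro i
    have := b.toBasis.constr_basis ℝ (fun i => √(e i) • b i) i
    simp only [OrthonormalBasis.coe_toBasis] at this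
    exact this
  refine ⟨M, ?_, ?_⟩
  · intro x y
    have h1 : ∀ x, M x = ∑ i, (⟪b i, x⟫ * √(e i)) • b i := by
      intro x
      conv_lhs => rw [← b.sum_repr' x]
      simp only [map_sum, map_smul, hMb, smul_smul]
    rw [h1 x, h1 y, sum_inner, inner_sum]
    refine Finset.sum_congr rfl fun i _ => ?_
    rw [real_inner_smul_left, real_inner_smul_right, real_inner_comm (b i) x]
    ring
  · have : M ∘ₗ M = A := by
      refine b.toBasis.ext fun i => ?_
      simp only [LinearMap.comp_apply, OrthonormalBasis.coe_toBasis, hMb, map_smul, smul_smul,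
        Real.mul_self_sqrt (he0 i), hAb]
    intro x
    rw [← this]; rfl

variable [MeasurableSpace E] [BorelSpace E]

theorem charFun_map_stdGaussian {V : Type*} [NormedAddCommGroup V] [InnerProductSpace ℝ V]
    [FiniteDimensional ℝ V] [MeasurableSpace V] [BorelSpace V] (L : E →L[ℝ] V) (t : V) :
    charFun ((stdGaussian E).map L) t =
      Complex.exp (-(‖ContinuousLinearMap.adjoint L t‖ : ℂ) ^ 2 / 2) := by
  rw [← charFun_stdGaussian, charFun_apply, charFun_apply,
    integral_map L.continuous.measurable.aemeasurable (by fun_prop)]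
  simp only [ContinuousLinearMap.adjoint_inner_right]

/-- The hypothesis says that L L* and `S` have the same quadratic form, and the characteristic
functions depend on nothing else. -/
theorem multivariateGaussian_eq_map {B : ℕ} {S : Matrix (Fin B) (Fin B) ℝ} (hS : S.PosSemidef)
    (L : E →L[ℝ] EuclideanSpace ℝ (Fin B))
    (hL : ∀ t : EuclideanSpace ℝ (Fin B),
      ‖ContinuousLinearMap.adjoint L t‖ ^ 2 = t.ofLp ⬝ᵥ S.mulVec t.ofLp) :
    multivariateGaussian 0 S = (stdGaussian E).map L := by
  have : IsProbabilityMeasure ((stdGaussian E).map L) :=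
    Measure.isProbabilityMeasure_map L.continuous.measurable.aemeasurable
  apply Measure.ext_of_charFun
  ext t
  rw [charFun_multivariateGaussian hS, charFun_map_stdGaussian, ← hL]
  congr 1
  simp
  ring

end Law

/-! ### Differentiating powers of linear functionals under the integral -/

section QuadraticPower

open Metric Set Module

variable {E : Type*} [NormedAddCommGroup E] [InnerProductSpace ℝ E] [FiniteDimensional ℝ E]

local notation "⟪" x ", " y "⟫" => inner ℝ x y

/-- The linear functional `P ↦ ⟪x, P x⟫` on operators. -/
def quadEval (x : E) : (E →L[ℝ] E) →L[ℝ] ℝ :=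
  (innerSL ℝ x).comp (ContinuousLinearMap.apply ℝ E x)

@[simp]
theorem quadEval_apply (x : E) (P : E →L[ℝ] E) : quadEval x P = ⟪x, P x⟫ := rfl

theorem norm_quadEval_le (x : E) : ‖quadEval x‖ ≤ ‖x‖ ^ 2 := by
  refine ContinuousLinearMap.opNorm_le_bound _ (by positivity) fun P => ?_
  rw [quadEval_apply]
  calc ‖⟪x, P x⟫‖ ≤ ‖x‖ * ‖P x‖ := norm_inner_le_norm _ _
    _ ≤ ‖x‖ * (‖P‖ * ‖x‖) := by gcongr; exact P.le_opNorm x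
    _ = _ := by ring

theorem continuous_quadEval : Continuous (quadEval : E → ((E →L[ℝ] E) →L[ℝ] ℝ)) := by
  unfold quadEval
  exact ((innerSL ℝ).continuous).clm_comp ((ContinuousLinearMap.apply ℝ E).continuous)

theorem quadEval_ge_of_dist_lt {c : ℝ} {P : E →L[ℝ] E}
    (hP : dist P (c • (1 : E →L[ℝ] E)) < c / 2) {x : E} (hx : ‖x‖ = 1) : c / 2 ≤ ⟪x, P x⟫ := by
  have h1 := (quadEval x).le_opNorm (P - c • (1 : E →L[ℝ] E))
  have h2 := norm_quadEval_le x
  rw [dist_eq_norm] at hP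
  have h3 : quadEval x (P - c • (1 : E →L[ℝ] E)) = ⟪x, P x⟫ - c := by
    rw [map_sub, map_smul]
    simp [hx]
  rw [h3, Real.norm_eq_abs] at h1
  rw [hx, one_pow] at h2
  have h4 : |⟪x, P x⟫ - c| ≤ c / 2 := by
    nlinarith [norm_nonneg (P - c • (1 : E →L[ℝ] E)), norm_nonneg (quadEval x)]
  linarith [(abs_le.1 h4).1]

variable [MeasurableSpace E] [BorelSpace E] [Nontrivial E]

/-- Within distance c/2 of `p₀` the base stays above c/2. As s - 1 ≤ 0, its power is then at most
(c/2)^(s-1), so the derivative is dominated by a multiple of |F|. -/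
theorem hasFDerivAt_integral_rpow {W : Type*} [NormedAddCommGroup W] [NormedSpace ℝ W]
    {F : sphere (0 : E) 1 → ℝ} (hF : Integrable F (sphereProb E))
    {q : sphere (0 : E) 1 → (W →L[ℝ] ℝ)} (hq : Continuous q) (hq1 : ∀ ω, ‖q ω‖ ≤ 1)
    {c : ℝ} (hc : 0 < c) {p₀ : W} (hp₀ : ∀ ω, q ω p₀ = c) {s : ℝ} (hs : s ≤ 1) :
    ∃ D : W →L[ℝ] ℝ, HasFDerivAt (fun p => ∫ ω, F ω * (q ω p) ^ s ∂(sphereProb E)) D p₀ ∧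
      ∀ p, D p = s * c ^ (s - 1) * ∫ ω, F ω * q ω p ∂(sphereProb E) := by
  set F' : W → sphere (0 : E) 1 → (W →L[ℝ] ℝ) :=
    fun p ω => (F ω * (s * (q ω p) ^ (s - 1))) • q ω with hF'
  have hquad : Integrable (fun ω : sphere (0 : E) 1 => F ω • q ω) (sphereProb E) := by
    refine hF.norm.mono' (hF.1.smul hq.aestronglyMeasurable) (ae_of_all _ fun ω => ?_)
    rw [norm_smul]
    nlinarith [norm_nonneg (F ω), hq1 ω]
  have hF'0 : F' p₀ = fun ω => (s * c ^ (s - 1)) • (F ω • q ω) := by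
    funext ω
    simp only [hF', hp₀, smul_smul]
    congr 1; ring
  have hlow : ∀ ω, ∀ p ∈ ball p₀ (c / 2), c / 2 ≤ q ω p := by
    intro ω p hp
    have h1 := (q ω).le_opNorm (p - p₀)
    rw [map_sub, hp₀, Real.norm_eq_abs] at h1
    rw [mem_ball, dist_eq_norm] at hp
    have h4 : |q ω p - c| ≤ c / 2 := by
      nlinarith [norm_nonneg (p - p₀), norm_nonneg (q ω), hq1 ω]
    linarith [(abs_le.1 h4).1]
  have key := hasFDerivAt_integral_of_dominated_of_fderiv_le (𝕜 := ℝ) (μ := sphereProb E)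
    (F := fun p ω => F ω * (q ω p) ^ s) (F' := F') (x₀ := p₀)
    (s := ball p₀ (c / 2)) (bound := fun ω => ‖F ω‖ * (|s| * (c / 2) ^ (s - 1)))
    (ball_mem_nhds _ (by positivity))
    (Eventually.of_forall fun p => by
      have hm : Measurable fun ω => q ω p := (hq.clm_apply continuous_const).measurable
      exact hF.1.mul (hm.pow_const s).aestronglyMeasurable)
    (by simp only [hp₀]; exact hF.mul_const _)
    (by rw [hF'0]; exact (hquad.smul (s * c ^ (s - 1))).1)
    (ae_of_all _ fun ω p hp => by
      have h1 := hlow ω p hp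
      have h3 : (q ω p) ^ (s - 1) ≤ (c / 2) ^ (s - 1) :=
        Real.rpow_le_rpow_of_nonpos (by positivity) h1 (by linarith)
      have h4 : 0 ≤ (q ω p) ^ (s - 1) := Real.rpow_nonneg (by linarith) _
      simp only [hF', norm_smul, norm_mul, Real.norm_eq_abs, abs_of_nonneg h4]
      calc |F ω| * (|s| * (q ω p) ^ (s - 1)) * ‖q ω‖
          ≤ |F ω| * (|s| * (c / 2) ^ (s - 1)) * 1 := by gcongr; exact hq1 ω
        _ = _ := mul_one _)
    (hF.norm.mul_const _)
    (ae_of_all _ fun ω p hp => by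
      have h1 := hlow ω p hp
      have h3 := ((q ω).hasFDerivAt.rpow_const (x := p) (p := s)
        (Or.inl (by linarith [half_pos hc]))).const_mul (F ω)
      refine h3.congr_fderiv ?_
      simp only [hF', smul_smul])
  refine ⟨_, key, fun p => ?_⟩
  rw [hF'0, integral_smul, smul_apply, ContinuousLinearMap.integral_apply hquad]
  simp

theorem hasFDerivAt_integral_quadEval_rpow {F : sphere (0 : E) 1 → ℝ}
    (hF : Integrable F (sphereProb E)) {c : ℝ} (hc : 0 < c) {s : ℝ} (hs : s ≤ 1) :
    ∃ D : (E →L[ℝ] E) →L[ℝ] ℝ,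
      HasFDerivAt (fun P : E →L[ℝ] E => ∫ ω, F ω * ⟪ω.1, P ω.1⟫ ^ s ∂(sphereProb E)) D
        (c • (1 : E →L[ℝ] E)) ∧
      ∀ P : E →L[ℝ] E, D P = s * c ^ (s - 1) * ∫ ω, F ω * ⟪ω.1, P ω.1⟫ ∂(sphereProb E) :=
  hasFDerivAt_integral_rpow hF (continuous_quadEval.comp continuous_subtype_val)
    (fun ω => by simpa using norm_quadEval_le ω.1) hc
    (fun ω => by simp) hs

end QuadraticPower

/-! ### The derivative of angular means at a multiple of the identity -/

section Derivative

open Metric Set Module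

variable {E : Type*} [NormedAddCommGroup E] [InnerProductSpace ℝ E] [FiniteDimensional ℝ E]
  [MeasurableSpace E] [BorelSpace E] [Nontrivial E] {B : ℕ}

local notation "⟪" x ", " y "⟫" => inner ℝ x y

/-- The compression of a matrix to `E` along an isometry. -/
def compress (Q : E →ₗᵢ[ℝ] EuclideanSpace ℝ (Fin B)) :
    Matrix (Fin B) (Fin B) ℝ →ₗ[ℝ] (E →L[ℝ] E) where
  toFun S := (ContinuousLinearMap.adjoint Q.toContinuousLinearMap).comp
    ((Matrix.toEuclideanCLM (𝕜 := ℝ) S).comp Q.toContinuousLinearMap)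
  map_add' S T := by ext x; simp
  map_smul' c S := by ext x; simp

theorem inner_compress (Q : E →ₗᵢ[ℝ] EuclideanSpace ℝ (Fin B)) (S : Matrix (Fin B) (Fin B) ℝ)
    (x y : E) : ⟪x, compress Q S y⟫ = (Q x).ofLp ⬝ᵥ S.mulVec (Q y).ofLp := by
  simp only [compress, LinearMap.coe_mk, AddHom.coe_mk, ContinuousLinearMap.comp_apply]
  rw [ContinuousLinearMap.adjoint_inner_right]
  simp [Matrix.inner_toEuclideanCLM]

/-- Since QQ* = G and Q*Q = 1, also Q*GQ = 1. -/
theorem compress_centering (Q : E →ₗᵢ[ℝ] EuclideanSpace ℝ (Fin B))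
    (hQ : ∀ t : EuclideanSpace ℝ (Fin B), Q (ContinuousLinearMap.adjoint Q.toContinuousLinearMap t)
      = WithLp.toLp 2 ((centering B).mulVec t.ofLp)) (υ : ℝ) :
    compress Q (υ • centering B) = υ • (1 : E →L[ℝ] E) := by
  rw [map_smul]
  congr 1
  ext x
  apply ext_inner_left ℝ
  intro y
  have h := hQ (Q x)
  have h2 : ContinuousLinearMap.adjoint Q.toContinuousLinearMap (Q x) = x := by
    apply ext_inner_left ℝ
    intro z
    rw [ContinuousLinearMap.adjoint_inner_right]
    exact Q.inner_map_map z x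
  rw [h2] at h
  rw [inner_compress]
  have h3 : (centering B).mulVec (Q x).ofLp = (Q x).ofLp :=
    congrArg WithLp.ofLp h.symm
  rw [h3]
  have h4 := Q.inner_map_map y x
  rw [one_apply_eq_self, ← h4]
  simp only [PiLp.inner_apply, dotProduct, RCLike.inner_apply, conj_trivial, mul_comm]

/-- The image in `E` of the `k`-th coordinate functional. -/
def coordVec (Q : E →ₗᵢ[ℝ] EuclideanSpace ℝ (Fin B)) (k : Fin B) : E :=
  ContinuousLinearMap.adjoint Q.toContinuousLinearMap (EuclideanSpace.single k 1)

theorem inner_coordVec (Q : E →ₗᵢ[ℝ] EuclideanSpace ℝ (Fin B)) (k : Fin B) (x : E) :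
    ⟪coordVec Q k, x⟫ = Q x k := by
  rw [coordVec, ContinuousLinearMap.adjoint_inner_left]
  simp [PiLp.inner_apply]

/-- `Q` identifies `E` with the range of the centering matrix. -/
def IsCenteringIsometry (Q : E →ₗᵢ[ℝ] EuclideanSpace ℝ (Fin B)) : Prop :=
  ∀ t : EuclideanSpace ℝ (Fin B), Q (ContinuousLinearMap.adjoint Q.toContinuousLinearMap t)
      = WithLp.toLp 2 ((centering B).mulVec t.ofLp)

theorem inner_coordVec_coordVec {Q : E →ₗᵢ[ℝ] EuclideanSpace ℝ (Fin B)}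
    (hQ : IsCenteringIsometry Q) (k l : Fin B) :
    ⟪coordVec Q k, coordVec Q l⟫ = centering B k l := by
  rw [inner_coordVec, coordVec, hQ]
  simp

theorem inner_compress_self (Q : E →ₗᵢ[ℝ] EuclideanSpace ℝ (Fin B))
    (S : Matrix (Fin B) (Fin B) ℝ) (x : E) :
    ⟪x, compress Q S x⟫ = ∑ k, ∑ l, S k l * (⟪coordVec Q k, x⟫ * ⟪coordVec Q l, x⟫) := by
  rw [inner_compress]
  simp only [dotProduct, Matrix.mulVec, Finset.mul_sum, inner_coordVec]
  exact Finset.sum_congr rfl fun k _ => Finset.sum_congr rfl fun l _ => by ring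

theorem integral_mul_inner_compress (Q : E →ₗᵢ[ℝ] EuclideanSpace ℝ (Fin B))
    (S : Matrix (Fin B) (Fin B) ℝ) {F : sphere (0 : E) 1 → ℝ} (hF : Integrable F (sphereProb E)) :
    ∫ ω, F ω * ⟪ω.1, compress Q S ω.1⟫ ∂(sphereProb E) =
      ∑ k, ∑ l, S k l * sphereForm hF (coordVec Q k) (coordVec Q l) := by
  simp only [inner_compress_self, Finset.mul_sum, sphereForm_apply, ← integral_const_mul]
  have hi : ∀ k l, Integrable (fun ω : sphere (0 : E) 1 => F ω * (S k l *
      (⟪coordVec Q k, ω.1⟫ * ⟪coordVec Q l, ω.1⟫))) (sphereProb E) := by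
    intro k l
    refine ((hF.mul_inner_sphere (coordVec Q k) (coordVec Q l)).const_mul (S k l)).congr
      (ae_of_all _ fun ω => ?_)
    ring
  rw [integral_finsetSum _ fun k _ => integrable_finsetSum _ fun l _ => hi k l]
  refine Finset.sum_congr rfl fun k _ => ?_
  rw [integral_finsetSum _ fun l _ => hi k l]
  refine Finset.sum_congr rfl fun l _ => ?_
  congr 1 with ω
  ring

theorem symSpaceG_mul_centering (S : symSpaceG B) : S.1 * centering B = S.1 := by
  have h := S.2.2
  conv_lhs => rw [← h]
  rw [Matrix.mul_assoc, centering_mul_self, h]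

theorem symSpaceG_apply_comm (S : symSpaceG B) (k l : Fin B) : S.1 k l = S.1 l k :=
  congrFun (congrFun S.2.1 l) k

theorem sum_mul_centering (S : symSpaceG B) :
    ∑ k, ∑ l, S.1 k l * centering B k l = S.1.trace := by
  refine Finset.sum_congr rfl fun k _ => ?_
  have h := congrFun (congrFun (symSpaceG_mul_centering S) k) k
  rw [Matrix.mul_apply] at h
  rw [Matrix.diag_apply, ← h]
  refine Finset.sum_congr rfl fun l _ => ?_
  rw [show centering B k l = centering B l k from congrFun (congrFun (centering_transpose B) l) k]

/-- For F = 1 the second-moment form is a multiple of the inner product (take u = w = 0), so its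
contraction with `S` is a multiple of the trace. This is what removes the derivative of the
normaliser. -/
theorem integral_inner_compress_of_trace_eq_zero {Q : E →ₗᵢ[ℝ] EuclideanSpace ℝ (Fin B)}
    (hQ : IsCenteringIsometry Q) (hn : 3 ≤ finrank ℝ E) (S : symSpaceG B) (hS : S.1.trace = 0) :
    ∫ ω, ⟪ω.1, compress Q S.1 ω.1⟫ ∂(sphereProb E) = 0 := by
  have h1 : Integrable (fun _ : sphere (0 : E) 1 => (1 : ℝ)) (sphereProb E) := integrable_const _
  have h := integral_mul_inner_compress Q S.1 h1
  simp only [one_mul] at h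
  obtain ⟨τ, hτ⟩ := exists_sphereForm_orthogonal_const (u := (0 : E)) (w := 0)
    (G := fun _ _ => 1) h1 hn
  have h2 : ∀ k l, S.1 k l * sphereForm h1 (coordVec Q k) (coordVec Q l) =
      τ * (S.1 k l * centering B k l) := by
    intro k l
    have := hτ (coordVec Q k) (by simp) (by simp) (coordVec Q l)
    rw [inner_coordVec_coordVec hQ] at this
    change sphereForm h1 _ _ = _ at this
    rw [this]; ring
  simp_rw [h2, ← Finset.mul_sum] at h
  rw [h, sum_mul_centering, hS, mul_zero]

/-- Near υ·1 the compression A is positive definite. Writing A = M², the Gaussian is the law of Q M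
x with x standard, and |M⁻¹ω|² = ⟨ω, A⁻¹ω⟩. -/
theorem exists_integral_multivariateGaussian {Q : E →ₗᵢ[ℝ] EuclideanSpace ℝ (Fin B)}
    (hQ : IsCenteringIsometry Q) {υ : ℝ} (hυ : 0 < υ) (S : symSpaceG B)
    (hS : dist (compress Q S.1) (υ • (1 : E →L[ℝ] E)) < υ / 2) :
    IsUnit (compress Q S.1) ∧
    ∃ K : ℝ, ∀ H : EuclideanSpace ℝ (Fin B) → ℝ, Measurable H →
      (∀ r : ℝ, 0 < r → ∀ x, H (r • x) = H x) →
      Integrable (fun ω : sphere (0 : E) 1 => H (Q ω.1)) (sphereProb E) →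
      ∫ h, H h ∂(multivariateGaussian 0 S.1) = K * ∫ ω, H (Q ω.1) *
        ⟪ω.1, Ring.inverse (compress Q S.1) ω.1⟫ ^ (-(finrank ℝ E : ℝ) / 2) ∂(sphereProb E) := by
  set A := compress Q S.1 with hA
  set Qa := ContinuousLinearMap.adjoint Q.toContinuousLinearMap with hQa
  -- Because QQ* = G and GSG = S, the compression carries the whole quadratic form of `S`.
  have hform : ∀ t : EuclideanSpace ℝ (Fin B),
      ⟪Qa t, A (Qa t)⟫ = t.ofLp ⬝ᵥ S.1.mulVec t.ofLp := by
    intro t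
    have h2 := S.2.2
    rw [hA, inner_compress, hQ t]
    conv_rhs => rw [← h2]
    rw [Matrix.mul_assoc, ← Matrix.mulVec_mulVec, ← Matrix.mulVec_mulVec,
      Matrix.dotProduct_mulVec t.ofLp, ← Matrix.mulVec_transpose, centering_transpose]
  have hlow : ∀ x : E, υ / 2 * ‖x‖ ^ 2 ≤ ⟪x, A x⟫ := by
    intro x
    rcases eq_or_ne x 0 with rfl | hx
    · simp
    · have hx' : 0 < ‖x‖ := norm_pos_iff.2 hx
      have := quadEval_ge_of_dist_lt hS (x := ‖x‖⁻¹ • x) (by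
        rw [norm_smul, norm_inv, norm_norm, inv_mul_cancel₀ hx'.ne'])
      rw [map_smul, real_inner_smul_left, real_inner_smul_right] at this
      calc υ / 2 * ‖x‖ ^ 2 ≤ (‖x‖⁻¹ * (‖x‖⁻¹ * ⟪x, A x⟫)) * ‖x‖ ^ 2 := by gcongr
        _ = _ := by field_simp
  have hPSD : S.1.PosSemidef := by
    refine Matrix.PosSemidef.of_dotProduct_mulVec_nonneg S.2.1 fun v => ?_
    have h1 := hform (WithLp.toLp 2 v)
    have h2 := hlow (Qa (WithLp.toLp 2 v))
    simp only [star_trivial]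
    rw [← h1]
    exact le_trans (by positivity) h2
  have hsymm : (A : E →ₗ[ℝ] E).IsSymmetric := by
    intro x y
    simp only [ContinuousLinearMap.coe_coe]
    rw [real_inner_comm, hA, inner_compress, inner_compress, Matrix.dotProduct_mulVec,
      ← Matrix.mulVec_transpose, S.2.1, dotProduct_comm]
  obtain ⟨M, hMs, hMM⟩ := hsymm.exists_sqrt fun x => by
    rw [real_inner_comm]
    exact le_trans (by positivity) (hlow x)
  have hMinj : Function.Injective M := by
    rw [← LinearMap.ker_eq_bot, LinearMap.ker_eq_bot']
    intro x hx
    have h1 := hMM x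
    rw [hx, map_zero] at h1
    have h2 := hlow x
    have h3 : A x = 0 := h1.symm
    rw [h3, inner_zero_right] at h2
    have h4 : ‖x‖ ^ 2 ≤ 0 := by nlinarith
    exact norm_eq_zero.1 (pow_eq_zero_iff two_ne_zero |>.1 (le_antisymm h4 (by positivity)))
  set Me : E ≃L[ℝ] E := (LinearEquiv.ofInjectiveEndo M hMinj).toContinuousLinearEquiv with hMe
  have hMe1 : ∀ x, Me x = M x := fun x => rfl
  have hAe : ∀ x, A x = Me (Me x) := fun x => (hMM x).symm
  set Ainv : E →L[ℝ] E := (Me.symm : E →L[ℝ] E).comp (Me.symm : E →L[ℝ] E) with hAinv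
  let U : (E →L[ℝ] E)ˣ := ⟨A, Ainv, by ext x; simp [hAinv, hAe], by ext x; simp [hAinv, hAe]⟩
  have hU : IsUnit A := ⟨U, rfl⟩
  refine ⟨hU, ?_⟩
  have hinv : Ring.inverse A = Ainv := Ring.inverse_unit U
  have hMsymm : ∀ x y, ⟪Me.symm x, y⟫ = ⟪x, Me.symm y⟫ := by
    intro x y
    have := hMs (Me.symm x) (Me.symm y)
    rw [← hMe1, ← hMe1, Me.apply_symm_apply, Me.apply_symm_apply] at this
    exact this.symm
  have hq : ∀ x, ⟪x, Ring.inverse A x⟫ = ‖Me.symm x‖ ^ 2 := by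
    intro x
    rw [hinv, ← real_inner_self_eq_norm_sq, hMsymm]; rfl
  have hlaw := multivariateGaussian_eq_map hPSD
    (Q.toContinuousLinearMap.comp (Me : E →L[ℝ] E)) (fun t => by
      have h1 : ContinuousLinearMap.adjoint (Q.toContinuousLinearMap.comp (Me : E →L[ℝ] E)) t
          = M (Qa t) := by
        apply ext_inner_left ℝ
        intro z
        rw [ContinuousLinearMap.adjoint_inner_right, ← hMs z, hQa,
          ContinuousLinearMap.adjoint_inner_right]
        rfl
      rw [h1, ← hform, ← real_inner_self_eq_norm_sq, hMs, hMM]; rfl)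
  obtain ⟨K, hK⟩ := integral_stdGaussian_comp_linear Me
  refine ⟨K, fun H hH hom hint => ?_⟩
  rw [hlaw, integral_map (ContinuousLinearMap.continuous _).measurable.aemeasurable
    hH.aestronglyMeasurable]
  have hm : Measurable fun x : E => H (Q x) := hH.comp Q.continuous.measurable
  have := hK (fun x => H (Q x)) hm (fun r hr x => by rw [map_smul, hom r hr]) hint
  simp only [hq]
  exact this

/-- The mean of `F` under the angular central Gaussian law with covariance `P`. -/
def angularMean (F : sphere (0 : E) 1 → ℝ) (P : E →L[ℝ] E) : ℝ :=
  (∫ ω, F ω * ⟪ω.1, Ring.inverse P ω.1⟫ ^ (-(finrank ℝ E : ℝ) / 2) ∂(sphereProb E)) *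
    (∫ ω : sphere (0 : E) 1, 1 * ⟪ω.1, Ring.inverse P ω.1⟫ ^ (-(finrank ℝ E : ℝ) / 2)
      ∂(sphereProb E))⁻¹

/-- Taking H = 1 shows that `K` is the reciprocal of the normalising integral. -/
theorem integral_multivariateGaussian_eq_angularMean {Q : E →ₗᵢ[ℝ] EuclideanSpace ℝ (Fin B)}
    (hQ : IsCenteringIsometry Q) {υ : ℝ} (hυ : 0 < υ) (S : symSpaceG B)
    (hS : dist (compress Q S.1) (υ • (1 : E →L[ℝ] E)) < υ / 2)
    {H : EuclideanSpace ℝ (Fin B) → ℝ} (hH : Measurable H)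
    (hom : ∀ r : ℝ, 0 < r → ∀ x, H (r • x) = H x)
    (hint : Integrable (fun ω : sphere (0 : E) 1 => H (Q ω.1)) (sphereProb E)) :
    ∫ h, H h ∂(multivariateGaussian 0 S.1) =
      angularMean (fun ω => H (Q ω.1)) (compress Q S.1) := by
  obtain ⟨-, K, hK⟩ := exists_integral_multivariateGaussian hQ hυ S hS
  have e1 := hK H hH hom hint
  have e2 := hK (fun _ => 1) measurable_const (fun _ _ _ => rfl) (integrable_const _)
  simp only [integral_const, probReal_univ, smul_eq_mul, mul_one] at e2
  rw [e1, angularMean, ← div_eq_mul_inv, eq_div_iff (right_ne_zero_of_mul (e2 ▸ one_ne_zero))]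
  linear_combination (-∫ ω : sphere (0 : E) 1, H (Q ω.1) *
    ⟪ω.1, Ring.inverse (compress Q S.1) ω.1⟫ ^ (-(finrank ℝ E : ℝ) / 2) ∂(sphereProb E)) * e2

theorem ringInverse_smul_one {υ : ℝ} (hυ : υ ≠ 0) :
    Ring.inverse (υ • (1 : E →L[ℝ] E)) = υ⁻¹ • (1 : E →L[ℝ] E) :=
  Ring.inverse_unit (⟨υ • 1, υ⁻¹ • 1, by simp [smul_smul, hυ],
    by simp [smul_smul, hυ]⟩ : (E →L[ℝ] E)ˣ)

theorem integral_mul_inner_smul_one_rpow (F : sphere (0 : E) 1 → ℝ) (c s : ℝ) :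
    ∫ ω, F ω * ⟪ω.1, (c • (1 : E →L[ℝ] E)) ω.1⟫ ^ s ∂(sphereProb E) =
      c ^ s * ∫ ω, F ω ∂(sphereProb E) := by
  rw [← integral_const_mul]
  congr 1 with ω
  simp [inner_smul_right, mul_comm]

theorem angularMean_smul_one (F : sphere (0 : E) 1 → ℝ) {υ : ℝ} (hυ : 0 < υ) :
    angularMean F (υ • (1 : E →L[ℝ] E)) = ∫ ω, F ω ∂(sphereProb E) := by
  have hc := (Real.rpow_pos_of_pos (inv_pos.2 hυ) (-(finrank ℝ E : ℝ) / 2)).ne'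
  rw [angularMean, ringInverse_smul_one hυ.ne', integral_mul_inner_smul_one_rpow,
    integral_mul_inner_smul_one_rpow (fun _ => 1)]
  simp only [integral_const, probReal_univ, smul_eq_mul, mul_one]
  field_simp

/-- The quotient rule composed with inversion of operators. Restricting to `P` of spherical mean
zero makes the derivative of the denominator vanish. -/
theorem exists_hasFDerivAt_angularMean {F : sphere (0 : E) 1 → ℝ}
    (hF : Integrable F (sphereProb E)) {υ : ℝ} (hυ : 0 < υ) :
    ∃ D : (E →L[ℝ] E) →L[ℝ] ℝ, HasFDerivAt (angularMean F) D (υ • (1 : E →L[ℝ] E)) ∧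
      ∀ P : E →L[ℝ] E, ∫ ω, ⟪ω.1, P ω.1⟫ ∂(sphereProb E) = 0 →
        D P = (finrank ℝ E : ℝ) / (2 * υ) * ∫ ω, F ω * ⟪ω.1, P ω.1⟫ ∂(sphereProb E) := by
  set s : ℝ := -(finrank ℝ E : ℝ) / 2 with hs
  have hs0 : s ≤ 1 := by
    have : (0 : ℝ) ≤ finrank ℝ E := by positivity
    rw [hs]; linarith
  set N : (sphere (0 : E) 1 → ℝ) → (E →L[ℝ] E) → ℝ :=
    fun F P => ∫ ω, F ω * ⟪ω.1, P ω.1⟫ ^ s ∂(sphereProb E) with hN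
  set c := υ⁻¹ with hc
  have hc0 : 0 < c := inv_pos.2 hυ
  have h1int : Integrable (fun _ : sphere (0 : E) 1 => (1 : ℝ)) (sphereProb E) := integrable_const _
  obtain ⟨DF, hDF, hDF'⟩ := hasFDerivAt_integral_quadEval_rpow hF hc0 hs0
  obtain ⟨D1, hD1, hD1'⟩ := hasFDerivAt_integral_quadEval_rpow h1int hc0 hs0
  have hNval : ∀ F : sphere (0 : E) 1 → ℝ, N F (c • (1 : E →L[ℝ] E))
      = c ^ s * ∫ ω, F ω ∂(sphereProb E) := fun F => integral_mul_inner_smul_one_rpow F c s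
  have hN1 : N (fun _ => 1) (c • (1 : E →L[ℝ] E)) = c ^ s := by rw [hNval]; simp
  have hcs : c ^ s ≠ 0 := (Real.rpow_pos_of_pos hc0 s).ne'
  have hinv0 : Ring.inverse (υ • (1 : E →L[ℝ] E)) = c • (1 : E →L[ℝ] E) :=
    ringInverse_smul_one hυ.ne'
  have hRI : HasFDerivAt Ring.inverse (-ContinuousLinearMap.mulLeftRight ℝ (E →L[ℝ] E)
      (c • 1) (c • 1)) (υ • (1 : E →L[ℝ] E)) :=
    hasFDerivAt_ringInverse (𝕜 := ℝ) (⟨υ • 1, c • 1, by simp [smul_smul, hc, hυ.ne'],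
      by simp [smul_smul, hc, hυ.ne']⟩ : (E →L[ℝ] E)ˣ)
  have hdiv : HasFDerivAt (fun P => N F P * (N (fun _ => 1) P)⁻¹)
      (N F (c • 1) • (-(N (fun _ => 1) (c • 1) ^ 2)⁻¹ • D1)
        + (N (fun _ => 1) (c • 1))⁻¹ • DF) (c • (1 : E →L[ℝ] E)) := by
    have hi : HasFDerivAt (fun P => (N (fun _ => 1) P)⁻¹)
        (-(N (fun _ => 1) (c • 1) ^ 2)⁻¹ • D1) (c • (1 : E →L[ℝ] E)) :=
      (hasDerivAt_inv (by rw [hN1]; exact hcs)).comp_hasFDerivAt _ hD1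
    exact HasFDerivAt.mul hDF hi
  rw [← hinv0] at hdiv
  have hcomp := hdiv.comp (υ • (1 : E →L[ℝ] E)) hRI
  refine ⟨_, hcomp, fun P hP => ?_⟩
  simp only [ContinuousLinearMap.comp_apply, add_apply, smul_apply, neg_apply,
    ContinuousLinearMap.mulLeftRight_apply, hDF', hD1', hinv0, hN1, smul_eq_mul]
  have e : ∀ x, (c • (1 : E →L[ℝ] E) * P * c • (1 : E →L[ℝ] E)) x = (c * c) • P x := by
    intro x
    simp [smul_smul]
  -- Inversion has derivative -c²P with c = 1/υ, so the prefactor is s c^(s-1) · (-c²) / c^s = -s c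
  -- = n/(2υ).
  simp only [e, inner_neg_right, inner_smul_right, one_mul, mul_neg, integral_neg,
    integral_const_mul, hP, mul_left_comm _ (c * c)]
  rw [Real.rpow_sub_one hc0.ne', hs]
  rw [hs] at hcs
  have hcυ : c * υ = 1 := inv_mul_cancel₀ hυ.ne'
  simp only [mul_zero, neg_zero, zero_add]
  field_simp
  linear_combination (finrank ℝ E : ℝ) * (∫ ω, F ω * ⟪ω.1, P ω.1⟫ ∂(sphereProb E)) * hcυ

end Derivative

/-! ### The derivative of the covariance map and the fixed point -/

section NormCov

open Metric Set Module

section Matrices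

variable {V : Type*} [NormedAddCommGroup V] [NormedSpace ℝ V] {B : ℕ}

/-- Passes from derivatives of the entries to the derivative of a matrix-valued map between spaces
of symmetric matrices, `f` being known only near `S`. -/
theorem exists_hasFDerivAt_symSpace (f : symSpaceG B → symSpace B) (S : symSpaceG B)
   (L : symSpaceG B →ₗ[ℝ] V) (Φ : Fin B → Fin B → V → ℝ) (D : Fin B → Fin B → V →L[ℝ] ℝ)
   (hsymm : ∀ i j, Φ i j = Φ j i)
   (hD : ∀ i j, HasFDerivAt (Φ i j) (D i j) (L S)) {r : ℝ} (hr : 0 < r)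
   (hf : ∀ T, dist (L T) (L S) < r → ∀ i j, (f T).1 i j = Φ i j (L T)) :
   ∃ J : symSpaceG B →L[ℝ] symSpace B, HasFDerivAt f J S ∧ ∀ T i j, (J T).1 i j = D i j (L T) := by
  -- The derivative depends only on the topology, so a norm may be fixed for the argument.
  let : NormedAddCommGroup (Matrix (Fin B) (Fin B) ℝ) := Matrix.normedAddCommGroup
  let : NormedSpace ℝ (Matrix (Fin B) (Fin B) ℝ) := Matrix.normedSpace
  set Lc : symSpaceG B →L[ℝ] V := LinearMap.toContinuousLinearMap L
  have hΦ : HasFDerivAt (fun p : V => (fun i j => Φ i j p : Fin B → Fin B → ℝ))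
      (ContinuousLinearMap.pi fun i => ContinuousLinearMap.pi fun j => D i j) (L S) :=
    hasFDerivAt_pi.2 fun i => hasFDerivAt_pi.2 fun j => hD i j
  -- Averaging with the transpose lands in the symmetric matrices and does not alter the values of
  -- `f`, which are already symmetric.
  let P : (Fin B → Fin B → ℝ) →ₗ[ℝ] symSpace B :=
    { toFun := fun M => ⟨Matrix.of fun i j => (M i j + M j i) / 2, by
        change Matrix.transpose _ = _
        ext i j
        simp [add_comm]⟩
      map_add' := fun M N => by
        ext i j
        simp only [Matrix.of_apply, Submodule.coe_add, Matrix.add_apply, Pi.add_apply]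
        ring
      map_smul' := fun c M => by
        ext i j
        simp only [Matrix.of_apply, Submodule.coe_smul, Matrix.smul_apply, Pi.smul_apply,
          smul_eq_mul, RingHom.id_apply]
        ring }
  set Pc : (Fin B → Fin B → ℝ) →L[ℝ] symSpace B := LinearMap.toContinuousLinearMap P
  have h := (Pc.hasFDerivAt.comp (L S) hΦ).comp S Lc.hasFDerivAt
  have hev : f =ᶠ[𝓝 S] (Pc ∘ (fun p : V => (fun i j => Φ i j p : Fin B → Fin B → ℝ))) ∘ Lc := by
    have h1 : ∀ᶠ T in 𝓝 S, dist (L T) (L S) < r :=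
      Lc.continuous.continuousAt.eventually (Metric.ball_mem_nhds _ hr)
    filter_upwards [h1] with T hT
    ext i j
    have h2 := hf T hT i j
    have h3 := hf T hT j i
    have h4 : (f T).1 i j = (f T).1 j i := congrFun (congrFun (f T).2 j) i
    change (f T).1 i j = (Φ i j (L T) + Φ j i (L T)) / 2
    linarith
  refine ⟨_, h.congr_of_eventuallyEq hev, fun T i j => ?_⟩
  have hu : D j i = D i j := (hD j i).unique (hsymm i j ▸ hD i j)
  change (D i j (L T) + D j i (L T)) / 2 = D i j (L T)
  rw [hu]; ring

end Matrices

variable {E : Type*} [NormedAddCommGroup E] [InnerProductSpace ℝ E] [FiniteDimensional ℝ E]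
  [MeasurableSpace E] [BorelSpace E] [Nontrivial E] {B : ℕ}

local notation "⟪" x ", " y "⟫" => inner ℝ x y

theorem actNormalize_smul (φ : ℝ → ℝ) {r : ℝ} (hr : 0 < r) (x : EuclideanSpace ℝ (Fin B)) :
    actNormalize φ (r • x) = actNormalize φ x := by
  funext i
  have h : √(B : ℝ) / (r * ‖x‖) * r = √(B : ℝ) / ‖x‖ := by
    rw [div_mul_eq_mul_div, mul_comm √(B : ℝ) r, mul_div_mul_left _ _ hr.ne']
  simp only [actNormalize, normalizeVec, norm_smul, smul_smul, Real.norm_eq_abs, abs_of_pos hr, h]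

theorem measurable_actNormalize {φ : ℝ → ℝ} (hφ : Measurable φ) (i : Fin B) :
    Measurable fun x : EuclideanSpace ℝ (Fin B) => actNormalize φ x i := by
  simp only [actNormalize, normalizeVec]
  refine hφ.comp ?_
  simp only [PiLp.smul_apply, smul_eq_mul]
  have : Measurable fun x : EuclideanSpace ℝ (Fin B) => x i :=
    (EuclideanSpace.proj (𝕜 := ℝ) i).continuous.measurable
  exact (measurable_const.div measurable_norm).mul this

/-- The product of two coordinates of `φ ∘ n`, on the unit sphere of `E`. -/
def sphereProduct (φ : ℝ → ℝ) (Q : E →ₗᵢ[ℝ] EuclideanSpace ℝ (Fin B)) (i j : Fin B)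
    (ω : sphere (0 : E) 1) : ℝ :=
  actNormalize φ (Q ω.1) i * actNormalize φ (Q ω.1) j

theorem covTransform_apply_eq_angularMean {Q : E →ₗᵢ[ℝ] EuclideanSpace ℝ (Fin B)}
    (hQ : IsCenteringIsometry Q) {φ : ℝ → ℝ} (hφ : Measurable φ) {υ : ℝ} (hυ : 0 < υ)
    (S : symSpaceG B) (hS : dist (compress Q S.1) (υ • (1 : E →L[ℝ] E)) < υ / 2) {i j : Fin B}
    (hint : Integrable (sphereProduct φ Q i j) (sphereProb E)) :
    covTransform (actNormalize φ) S.1 i j =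
      angularMean (sphereProduct φ Q i j) (compress Q S.1) :=
  integral_multivariateGaussian_eq_angularMean hQ hυ S hS
    (H := fun x => actNormalize φ x i * actNormalize φ x j)
    ((measurable_actNormalize hφ i).mul (measurable_actNormalize hφ j))
    (fun r hr x => by rw [actNormalize_smul φ hr]) hint

/-- Near υG every entry of the covariance is an angular mean of the compression, which is linear in
the matrix. -/
theorem exists_hasFDerivAt_normCov {Q : E →ₗᵢ[ℝ] EuclideanSpace ℝ (Fin B)}
    (hQ : IsCenteringIsometry Q) (hn : 3 ≤ finrank ℝ E) {φ : ℝ → ℝ} (hφ : Measurable φ)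
    (hint : ∀ i j, Integrable (sphereProduct φ Q i j) (sphereProb E)) {υ : ℝ} (hυ : 0 < υ)
    (S : symSpaceG B) (hS : S.1 = υ • centering B) :
    ∃ J : symSpaceG B →L[ℝ] symSpace B, HasFDerivAt (normCov B φ) J S ∧
      ∀ T : symSpaceG B, T.1.trace = 0 → ∀ i j, (J T).1 i j = (finrank ℝ E : ℝ) / (2 * υ) *
        ∑ k, ∑ l, T.1 k l * sphereForm (hint i j) (coordVec Q k) (coordVec Q l) := by
  choose D hD hD' using fun i j => exists_hasFDerivAt_angularMean (hint i j) hυ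
  have hLS : (compress Q ∘ₗ (symSpaceG B).subtype) S = υ • (1 : E →L[ℝ] E) := by
    rw [LinearMap.comp_apply, Submodule.subtype_apply, hS, compress_centering Q hQ]
  obtain ⟨J, hJ, hJ'⟩ := exists_hasFDerivAt_symSpace (normCov B φ) S
    (compress Q ∘ₗ (symSpaceG B).subtype) (fun i j => angularMean (sphereProduct φ Q i j)) D
    (fun i j => by
      congr 1
      funext ω
      exact mul_comm _ _)
    (fun i j => by rw [hLS]; exact hD i j) (half_pos hυ)
    (fun T hT i j => covTransform_apply_eq_angularMean hQ hφ hυ T (by rwa [hLS] at hT) (hint i j))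
  refine ⟨J, hJ, fun T hT i j => ?_⟩
  rw [hJ']
  refine (hD' i j _ (integral_inner_compress_of_trace_eq_zero hQ hn T hT)).trans ?_
  exact congrArg _ (integral_mul_inner_compress Q T.1 (hint i j))

theorem gTensor_smul_one_add (S : symSpace B) {υ ν : ℝ}
    (hS : S.1 = υ • (1 : Matrix (Fin B) (Fin B) ℝ) + ν • onesMat B) :
    (gTensor B S).1 = υ • centering B := by
  have h : centering B * onesMat B = 0 := by
    ext i j
    have hB : (B : ℝ) ≠ 0 := by
      have : 0 < B := i.pos
      positivity
    simp [centering, onesMat, Matrix.mul_apply, Matrix.one_apply, hB]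
  change centering B * S.1 * centering B = _
  rw [hS, Matrix.mul_add, Matrix.mul_smul, Matrix.mul_smul, h, Matrix.mul_one, smul_zero, add_zero,
    Matrix.smul_mul, centering_mul_self]

/-- Both laws have the same characteristic function, because G is symmetric. -/
theorem map_centering_multivariateGaussian {S : Matrix (Fin B) (Fin B) ℝ} (hS : S.PosSemidef) :
    (multivariateGaussian 0 S).map (fun h => WithLp.toLp 2 ((centering B).mulVec h.ofLp)) =
      multivariateGaussian 0 (centering B * S * centering B) := by
  have hG : ((centering B) * S * (centering B)).PosSemidef := by
    have := hS.mul_mul_conjTranspose_same (centering B)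
    rwa [Matrix.conjTranspose_eq_transpose_of_trivial, centering_transpose] at this
  have hm : Continuous fun h : EuclideanSpace ℝ (Fin B) =>
      WithLp.toLp 2 ((centering B).mulVec h.ofLp) := by fun_prop
  have := Measure.isFiniteMeasure_map (multivariateGaussian 0 S)
    (fun h : EuclideanSpace ℝ (Fin B) => WithLp.toLp 2 ((centering B).mulVec h.ofLp))
  apply Measure.ext_of_charFun
  ext t
  rw [charFun_multivariateGaussian hG, charFun_apply,
    integral_map hm.measurable.aemeasurable (by fun_prop)]
  have h1 : ∀ x : EuclideanSpace ℝ (Fin B),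
      ⟪WithLp.toLp 2 ((centering B).mulVec x.ofLp), t⟫ =
        ⟪x, WithLp.toLp 2 ((centering B).mulVec t.ofLp)⟫ := by
    intro x
    simp only [EuclideanSpace.inner_eq_star_dotProduct, star_trivial]
    rw [Matrix.dotProduct_mulVec, ← Matrix.mulVec_transpose, centering_transpose]
  simp only [h1]
  rw [← charFun_apply, charFun_multivariateGaussian hS]
  have h2 : t.ofLp ⬝ᵥ (centering B * S * centering B).mulVec t.ofLp =
      (centering B).mulVec t.ofLp ⬝ᵥ S.mulVec ((centering B).mulVec t.ofLp) := by
    rw [Matrix.mul_assoc, ← Matrix.mulVec_mulVec, ← Matrix.mulVec_mulVec,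
      Matrix.dotProduct_mulVec t.ofLp, ← Matrix.mulVec_transpose, centering_transpose]
  simp [h2]

theorem covTransform_batchNorm {φ : ℝ → ℝ} (hφ : Measurable φ) (S : symSpace B)
    (hS : S.1.PosSemidef) :
    covTransform (batchNorm φ) S.1 = covTransform (actNormalize φ) (gTensor B S).1 := by
  ext i j
  have hm : Continuous fun h : EuclideanSpace ℝ (Fin B) =>
      WithLp.toLp 2 ((centering B).mulVec h.ofLp) := by fun_prop
  change _ = ∫ h, _ ∂(multivariateGaussian 0 (centering B * S.1 * centering B))
  rw [← map_centering_multivariateGaussian hS]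
  exact (integral_map (f := fun x => actNormalize φ x i * actNormalize φ x j)
    hm.measurable.aemeasurable
    ((measurable_actNormalize hφ i).mul (measurable_actNormalize hφ j)).aestronglyMeasurable).symm

/-- The fixed point equation expresses S_ij as a mean over the uniform sphere, and for S = υI + ν11ᵀ
one has S_ii - S_ij = υ. This becomes the denominator of both eigenvalues. -/
theorem IsBSB1FixedPoint.integral_sphereProduct {Q : E →ₗᵢ[ℝ] EuclideanSpace ℝ (Fin B)}
    (hQ : IsCenteringIsometry Q) {φ : ℝ → ℝ} (hφ : Measurable φ)
    (hint : ∀ i j, Integrable (sphereProduct φ Q i j) (sphereProb E)) {S : symSpace B}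
    (hS : IsBSB1FixedPoint φ S.1) (hB : 2 ≤ B) :
    ∃ υ : ℝ, 0 < υ ∧ (gTensor B S).1 = υ • centering B ∧ ∀ i j, i ≠ j →
      (∫ ω, sphereProduct φ Q i i ω ∂(sphereProb E)) -
        ∫ ω, sphereProduct φ Q i j ω ∂(sphereProb E) = υ := by
  obtain ⟨hpsd, ⟨υ, ν, hυ0, hS1⟩, hfix⟩ := hS
  have hυ : 0 < υ := by
    let i : Fin B := ⟨0, by omega⟩
    let j : Fin B := ⟨1, by omega⟩
    have hij : i ≠ j := by simp [i, j]
    -- On the difference of two coordinate vectors the quadratic form of `S` is 2υ.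
    have h := hpsd.dotProduct_mulVec_nonneg (Pi.single i 1 - Pi.single j 1)
    rw [hS1] at h
    simp [onesMat, Matrix.mulVec_sub, hij, hij.symm] at h
    exact h.lt_of_ne' hυ0
  have hG := gTensor_smul_one_add S hS1
  refine ⟨υ, hυ, hG, fun i j hij => ?_⟩
  -- S is the covariance of 𝓑_φ at `S`, hence that of φ ∘ n at GSG = υG, where the angular law is
  -- uniform.
  have hcov : ∀ i j, S.1 i j = ∫ ω, sphereProduct φ Q i j ω ∂(sphereProb E) := by
    intro i j
    have hc : compress Q (gTensor B S).1 = υ • (1 : E →L[ℝ] E) := by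
      rw [hG, compress_centering Q hQ]
    rw [← angularMean_smul_one (sphereProduct φ Q i j) hυ, ← hc,
      ← covTransform_apply_eq_angularMean hQ hφ hυ _ (by rw [hc, dist_self]; positivity)
        (hint i j), ← covTransform_batchNorm hφ S hpsd, hfix]
  rw [← hcov, ← hcov, hS1]
  simp [onesMat, hij]

end NormCov

/-! ### The hyperplane on which the centering acts as the identity -/

section SumZero

open Module

/-- The hyperplane of vectors with vanishing coordinate sum. -/
abbrev sumZero (B : ℕ) : Submodule ℝ (EuclideanSpace ℝ (Fin B)) :=
  (ℝ ∙ (WithLp.toLp 2 fun _ => (1 : ℝ) : EuclideanSpace ℝ (Fin B)))ᗮ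

theorem finrank_sumZero {B : ℕ} (hB : 1 ≤ B) : (finrank ℝ (sumZero B) : ℝ) = (B : ℝ) - 1 := by
  have hv : (WithLp.toLp 2 fun _ => (1 : ℝ) : EuclideanSpace ℝ (Fin B)) ≠ 0 := by
    intro h
    have := congrArg (fun x : EuclideanSpace ℝ (Fin B) => x ⟨0, hB⟩) h
    simp at this
  have h := Submodule.finrank_add_finrank_orthogonal
    (ℝ ∙ (WithLp.toLp 2 fun _ => (1 : ℝ) : EuclideanSpace ℝ (Fin B)))
  rw [finrank_span_singleton hv, finrank_euclideanSpace_fin] at h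
  have h' : (1 : ℝ) + (finrank ℝ (sumZero B) : ℝ) = B := by exact_mod_cast h
  linarith

theorem isCenteringIsometry_sumZero (B : ℕ) : IsCenteringIsometry (sumZero B).subtypeₗᵢ := by
  intro t
  have h1 : ContinuousLinearMap.adjoint (sumZero B).subtypeₗᵢ.toContinuousLinearMap
      = (sumZero B).orthogonalProjectionOnto := (sumZero B).adjoint_subtypeL
  rw [h1]
  change ((sumZero B).orthogonalProjectionOnto t : EuclideanSpace ℝ (Fin B)) = _
  rw [← Submodule.starProjection_apply, Submodule.starProjection_orthogonal_val,
    Submodule.starProjection_singleton]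
  ext i
  have h2 : ((centering B).mulVec t.ofLp) i = t i - (B : ℝ)⁻¹ * ∑ k, t k := by
    rw [centering, Matrix.sub_mulVec, Matrix.one_mulVec, Matrix.smul_mulVec]
    simp [onesMat, Matrix.mulVec, dotProduct]
  have h3 : ‖(WithLp.toLp 2 fun _ => (1 : ℝ) : EuclideanSpace ℝ (Fin B))‖ ^ 2 = B := by
    simp [EuclideanSpace.norm_sq_eq]
  refine Eq.trans ?_ h2.symm
  simp [PiLp.inner_apply, h3, div_eq_inv_mul]

end SumZero

/-! ### Double series supported on three diagonals -/

section Banded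

/-- Enlarging the square by the index `n` adds only the entry (n, n) and the two entries pairing `n`
with `n - 2`. -/
theorem sum_range_sum_range_of_banded (c : ℕ → ℕ → ℝ)
    (hc : ∀ l m, l ≠ m → m ≠ l + 2 → l ≠ m + 2 → c l m = 0) (N : ℕ) :
    ∑ l ∈ Finset.range (N + 2), ∑ m ∈ Finset.range (N + 2), c l m =
      ∑ l ∈ Finset.range (N + 2), c l l + ∑ l ∈ Finset.range N, (c l (l + 2) + c (l + 2) l) := by
  have hsucc : ∀ n, ∑ l ∈ Finset.range (n + 1), ∑ m ∈ Finset.range (n + 1), c l m =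
      ∑ l ∈ Finset.range n, ∑ m ∈ Finset.range n, c l m +
        ∑ l ∈ Finset.range n, (c l n + c n l) + c n n := by
    intro n
    rw [Finset.sum_range_succ]
    simp only [Finset.sum_range_succ _ n, Finset.sum_add_distrib]
    ring
  induction N with
  | zero =>
    have h1 := hc 0 1 (by omega) (by omega) (by omega)
    have h2 := hc 1 0 (by omega) (by omega) (by omega)
    simp [Finset.sum_range_succ, h1, h2]
  | succ N ih =>
    have h : ∑ l ∈ Finset.range (N + 2), (c l (N + 2) + c (N + 2) l) =
        c N (N + 2) + c (N + 2) N := by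
      refine Finset.sum_eq_single_of_mem N (by simp) fun l hl hne => ?_
      rw [Finset.mem_range] at hl
      rw [hc l _ (by omega) (by omega) (by omega), hc _ l (by omega) (by omega) (by omega),
        add_zero]
    rw [hsucc (N + 2), ih, h, Finset.sum_range_succ _ (N + 2), Finset.sum_range_succ _ N]
    ring

/-- The majorant makes the diagonal and off-diagonal series separately summable, so the limit of the
square partial sums can be rearranged into one series. -/
theorem hasSum_of_banded {c : ℕ → ℕ → ℝ} {g : ℕ → ℝ} {I : ℝ}
    (hc : ∀ l m, l ≠ m → m ≠ l + 2 → l ≠ m + 2 → c l m = 0)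
    (hg : Summable g) (hcg : ∀ l m, |c l m| ≤ g l + g m)
    (hI : Tendsto (fun N => ∑ l ∈ Finset.range N, ∑ m ∈ Finset.range N, c l m) atTop (𝓝 I)) :
    HasSum (fun l => c l l + (c l (l + 2) + c (l + 2) l)) I := by
  have hg2 : Summable fun l => g (l + 2) := (summable_nat_add_iff 2).2 hg
  have h1 : Summable fun l => c l l := (hg.add hg).of_norm_bounded fun l => hcg l l
  have h2 : Summable fun l => c l (l + 2) + c (l + 2) l :=
    ((hg.add hg2).of_norm_bounded fun l => hcg l (l + 2)).add
      ((hg2.add hg).of_norm_bounded fun l => hcg (l + 2) l)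
  have h3 := ((tendsto_add_atTop_iff_nat 2).2 h1.hasSum.tendsto_sum_nat).add
    h2.hasSum.tendsto_sum_nat
  have h4 := (tendsto_add_atTop_iff_nat 2).2 hI
  simp only [sum_range_sum_range_of_banded c hc] at h4
  rw [tendsto_nhds_unique h4 h3]
  exact h1.hasSum.add h2.hasSum

end Banded

/-! ### Limits of weighted products in L² -/

section SquareIntegrable

variable {Ω : Type*} [MeasurableSpace Ω] {μ : Measure Ω}

/-- Joint continuity of the inner product of L². -/
theorem tendsto_integral_mul_of_eLpNorm {f g : ℕ → Ω → ℝ} {f₀ g₀ : Ω → ℝ}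
    (hf : ∀ n, MemLp (f n) 2 μ) (hg : ∀ n, MemLp (g n) 2 μ) (hf₀ : MemLp f₀ 2 μ)
    (hg₀ : MemLp g₀ 2 μ) (hft : Tendsto (fun n => eLpNorm (f₀ - f n) 2 μ) atTop (𝓝 0))
    (hgt : Tendsto (fun n => eLpNorm (g₀ - g n) 2 μ) atTop (𝓝 0)) :
    Tendsto (fun n => ∫ x, f n x * g n x ∂μ) atTop (𝓝 (∫ x, f₀ x * g₀ x ∂μ)) := by
  have key : ∀ {f g : Ω → ℝ} (hf : MemLp f 2 μ) (hg : MemLp g 2 μ),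
      inner ℝ (hf.toLp f) (hg.toLp g) = ∫ x, f x * g x ∂μ := by
    intro f g hf hg
    rw [L2.inner_def]
    refine integral_congr_ae ?_
    filter_upwards [hf.coeFn_toLp, hg.coeFn_toLp] with x hx hy
    rw [hx, hy]
    simp [mul_comm]
  have h1 : Tendsto (fun n => (hf n).toLp (f n)) atTop (𝓝 (hf₀.toLp f₀)) := by
    rw [Lp.tendsto_Lp_iff_tendsto_eLpNorm'']
    simpa only [eLpNorm_sub_comm _ f₀] using hft
  have h2 : Tendsto (fun n => (hg n).toLp (g n)) atTop (𝓝 (hg₀.toLp g₀)) := by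
    rw [Lp.tendsto_Lp_iff_tendsto_eLpNorm'']
    simpa only [eLpNorm_sub_comm _ g₀] using hgt
  simpa only [key] using Filter.Tendsto.inner (𝕜 := ℝ) h1 h2

/-- Multiplication by ψ is a contraction of L², so ψ can be absorbed into one factor. -/
theorem tendsto_integral_bounded_mul_of_eLpNorm {f g : ℕ → Ω → ℝ} {f₀ g₀ ψ : Ω → ℝ}
    (hψ : AEStronglyMeasurable ψ μ) (hψ1 : ∀ x, |ψ x| ≤ 1)
    (hf : ∀ n, MemLp (f n) 2 μ) (hg : ∀ n, MemLp (g n) 2 μ) (hf₀ : MemLp f₀ 2 μ)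
    (hg₀ : MemLp g₀ 2 μ) (hft : Tendsto (fun n => eLpNorm (f₀ - f n) 2 μ) atTop (𝓝 0))
    (hgt : Tendsto (fun n => eLpNorm (g₀ - g n) 2 μ) atTop (𝓝 0)) :
    Tendsto (fun n => ∫ x, ψ x * (f n x * g n x) ∂μ) atTop
      (𝓝 (∫ x, ψ x * (f₀ x * g₀ x) ∂μ)) := by
  have hb : ∀ {f : Ω → ℝ} (x : Ω), ‖(ψ * f) x‖ ≤ 1 * ‖f x‖ := by
    intro f x
    rw [Pi.mul_apply, norm_mul]
    gcongr
    exact hψ1 x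
  have hm : ∀ {f : Ω → ℝ}, MemLp f 2 μ → MemLp (ψ * f) 2 μ := fun h =>
    h.of_le_mul (c := 1) (hψ.mul h.1) (ae_of_all _ hb)
  have := tendsto_integral_mul_of_eLpNorm (fun n => hm (hf n)) hg (hm hf₀) hg₀
    (tendsto_of_tendsto_of_tendsto_of_le_of_le tendsto_const_nhds hft (fun _ => zero_le)
      fun n => by
        rw [← mul_sub]
        exact (eLpNorm_le_mul_eLpNorm_of_ae_le_mul (ae_of_all _ hb) 2).trans (by simp)) hgt
  simpa only [Pi.mul_apply, mul_assoc] using this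

theorem integral_mul_sum_mul_sum (ψ : Ω → ℝ) (p q : ℕ → Ω → ℝ) (b : ℕ → ℝ)
    (hi : ∀ l m, Integrable (fun x => ψ x * (p l x * q m x)) μ) (N : ℕ) :
    ∫ x, ψ x * ((∑ l ∈ Finset.range N, b l * p l x) * ∑ m ∈ Finset.range N, b m * q m x) ∂μ =
      ∑ l ∈ Finset.range N, ∑ m ∈ Finset.range N, b l * b m * ∫ x, ψ x * (p l x * q m x) ∂μ := by
  have h : ∀ x, ψ x * ((∑ l ∈ Finset.range N, b l * p l x) * ∑ m ∈ Finset.range N, b m * q m x) =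
      ∑ l ∈ Finset.range N, ∑ m ∈ Finset.range N, b l * b m * (ψ x * (p l x * q m x)) := by
    intro x
    rw [Finset.sum_mul_sum, Finset.mul_sum]
    refine Finset.sum_congr rfl fun l _ => ?_
    rw [Finset.mul_sum]
    exact Finset.sum_congr rfl fun m _ => by ring
  simp only [h]
  rw [integral_finsetSum _ fun l _ => integrable_finsetSum _ fun m _ => (hi l m).const_mul _]
  refine Finset.sum_congr rfl fun l _ => ?_
  rw [integral_finsetSum _ fun m _ => (hi l m).const_mul _]
  exact Finset.sum_congr rfl fun m _ => integral_const_mul _ _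

theorem abs_mul_integral_le {ψ p q : Ω → ℝ} (hψ1 : ∀ x, |ψ x| ≤ 1) (s t : ℝ)
    (hp : Integrable (fun x => p x * p x) μ) (hq : Integrable (fun x => q x * q x) μ)
    (hi : Integrable (fun x => ψ x * (p x * q x)) μ) :
    |s * t * ∫ x, ψ x * (p x * q x) ∂μ| ≤
      s ^ 2 * (∫ x, p x * p x ∂μ) + t ^ 2 * ∫ x, q x * q x ∂μ := by
  rw [← integral_const_mul, ← integral_const_mul, ← integral_const_mul,
    ← integral_add (hp.const_mul _) (hq.const_mul _)]
  refine abs_integral_le_integral_abs.trans (integral_mono (hi.const_mul _).abs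
    ((hp.const_mul _).add (hq.const_mul _)) fun x => ?_)
  have h1 : |s * t * (ψ x * (p x * q x))| ≤ |s * p x| * |t * q x| := by
    rw [← abs_mul, show s * t * (ψ x * (p x * q x)) = ψ x * (s * p x * (t * q x)) by ring, abs_mul]
    exact mul_le_of_le_one_left (abs_nonneg _) (hψ1 x)
  refine h1.trans ?_
  have h2 : (s * p x) ^ 2 = s ^ 2 * (p x * p x) := by ring
  have h3 : (t * q x) ^ 2 = t ^ 2 * (q x * q x) := by ring
  simp only [← h2, ← h3, ← sq_abs (s * p x), ← sq_abs (t * q x)]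
  nlinarith [sq_nonneg (|s * p x| - |t * q x|), sq_nonneg |s * p x|, sq_nonneg |t * q x|]

end SquareIntegrable

/-! ### Gegenbauer expansions carried to the sphere -/

section Expansion

open Metric Set Module Polynomial

variable {E : Type*} [NormedAddCommGroup E] [InnerProductSpace ℝ E] [FiniteDimensional ℝ E]
  [MeasurableSpace E] [BorelSpace E] [Nontrivial E] {α : ℝ}

local notation "⟪" x ", " y "⟫" => inner ℝ x y

theorem measurable_inner_sphere (u : E) :
    Measurable fun ω : sphere (0 : E) 1 => ⟪u, ω.1⟫ := by fun_prop

theorem eLpNorm_comp_inner_sphere {u : E} (hu : ‖u‖ = 1) (hα : 1 / 2 ≤ α)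
    (hn : (finrank ℝ E : ℝ) = 2 * α + 2) {f : ℝ → ℝ} (hf : Measurable f) :
    eLpNorm (fun ω : sphere (0 : E) 1 => f ⟪u, ω.1⟫) 2 (sphereProb E) =
      (gegMeasure α univ)⁻¹ ^ (1 / 2 : ENNReal).toReal • eLpNorm f 2 (gegMeasure α) := by
  rw [← eLpNorm_smul_measure_of_ne_top (by norm_num), ← map_inner_sphereProb hu hα hn,
    eLpNorm_map_measure hf.aestronglyMeasurable (measurable_inner_sphere u).aemeasurable]
  rfl

theorem memLp_comp_inner_sphere {u : E} (hu : ‖u‖ = 1) (hα : 1 / 2 ≤ α)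
    (hn : (finrank ℝ E : ℝ) = 2 * α + 2) {f : ℝ → ℝ} (hf : Measurable f)
    (hf2 : MemLp f 2 (gegMeasure α)) :
    MemLp (fun ω : sphere (0 : E) 1 => f ⟪u, ω.1⟫) 2 (sphereProb E) := by
  refine ⟨(hf.comp (measurable_inner_sphere u)).aestronglyMeasurable, ?_⟩
  rw [eLpNorm_comp_inner_sphere hu hα hn hf]
  exact ENNReal.mul_lt_top (ENNReal.rpow_lt_top_of_nonneg (by positivity)
    (ENNReal.inv_ne_top.2 (gegMeasure_ne_zero hα))) hf2.2

theorem tendsto_eLpNorm_comp_inner_sphere {u : E} (hu : ‖u‖ = 1) (hα : 1 / 2 ≤ α)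
    (hn : (finrank ℝ E : ℝ) = 2 * α + 2) {f : ℕ → ℝ → ℝ} (hf : ∀ n, Measurable (f n))
    (hft : Tendsto (fun n => eLpNorm (f n) 2 (gegMeasure α)) atTop (𝓝 0)) :
    Tendsto (fun n => eLpNorm (fun ω : sphere (0 : E) 1 => f n ⟪u, ω.1⟫) 2 (sphereProb E))
      atTop (𝓝 0) := by
  simp only [eLpNorm_comp_inner_sphere hu hα hn (hf _)]
  have := ENNReal.Tendsto.const_mul (a := (gegMeasure α univ)⁻¹ ^ (1 / 2 : ENNReal).toReal) hft
    (Or.inr (ENNReal.rpow_lt_top_of_nonneg (by positivity)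
      (ENNReal.inv_ne_top.2 (gegMeasure_ne_zero hα))).ne)
  simpa using this

theorem continuous_gegenbauer (α : ℝ) (l : ℕ) : Continuous (gegenbauer α l) := by
  simp only [← funext fun x => eval_gegPoly α x l]
  exact (gegPoly α l).continuous

/-- The coefficients `b` give the expansion of `f` in Gegenbauer polynomials in
`L²((1 - x²)^(α - 1/2))`. -/
structure IsGegenbauerExpansion (α : ℝ) (f : ℝ → ℝ) (b : ℕ → ℝ) : Prop where
  measurable : Measurable f
  memLp : MemLp f 2 (gegMeasure α)
  tendsto : Tendsto (fun n => eLpNorm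
    (fun x => f x - ∑ l ∈ Finset.range n, b l * gegenbauer α l x) 2 (gegMeasure α)) atTop (𝓝 0)

namespace IsGegenbauerExpansion

variable {f : ℝ → ℝ} {b : ℕ → ℝ}

theorem integrable_mul (H : IsGegenbauerExpansion α f b) (hα : 1 / 2 ≤ α)
    (hn : (finrank ℝ E : ℝ) = 2 * α + 2) {u w : E} (hu : ‖u‖ = 1) (hw : ‖w‖ = 1) :
    Integrable (fun ω : sphere (0 : E) 1 => f ⟪u, ω.1⟫ * f ⟪w, ω.1⟫) (sphereProb E) :=
  (memLp_comp_inner_sphere hu hα hn H.measurable H.memLp).integrable_mul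
    (memLp_comp_inner_sphere hw hα hn H.measurable H.memLp)

theorem tendsto_double_sum (H : IsGegenbauerExpansion α f b) (hα : 1 / 2 ≤ α)
    (hn : (finrank ℝ E : ℝ) = 2 * α + 2) {u w : E} (hu : ‖u‖ = 1) (hw : ‖w‖ = 1)
    {ψ : sphere (0 : E) 1 → ℝ} (hψ : Continuous ψ) (hψ1 : ∀ ω, |ψ ω| ≤ 1) :
    Tendsto (fun N => ∑ l ∈ Finset.range N, ∑ m ∈ Finset.range N, b l * b m *
        ∫ ω, ψ ω * (gegenbauer α l ⟪u, ω.1⟫ * gegenbauer α m ⟪w, ω.1⟫) ∂(sphereProb E)) atTop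
      (𝓝 (∫ ω, ψ ω * (f ⟪u, ω.1⟫ * f ⟪w, ω.1⟫) ∂(sphereProb E))) := by
  have hc : ∀ l (v : E), Continuous fun ω : sphere (0 : E) 1 => gegenbauer α l ⟪v, ω.1⟫ :=
    fun l v => (continuous_gegenbauer α l).comp (by fun_prop)
  have hs : ∀ n (v : E), Continuous fun ω : sphere (0 : E) 1 =>
      ∑ l ∈ Finset.range n, b l * gegenbauer α l ⟪v, ω.1⟫ :=
    fun n v => continuous_finsetSum _ fun l _ => continuous_const.mul (hc l v)
  have hsm : ∀ n (v : E), MemLp (fun ω : sphere (0 : E) 1 =>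
      ∑ l ∈ Finset.range n, b l * gegenbauer α l ⟪v, ω.1⟫) 2 (sphereProb E) :=
    fun n v => (hs n v).memLp_of_hasCompactSupport (HasCompactSupport.of_compactSpace _)
  have hmeas : ∀ n, Measurable fun x =>
      f x - ∑ l ∈ Finset.range n, b l * gegenbauer α l x := fun n =>
    H.measurable.sub (continuous_finsetSum _ fun l _ =>
      continuous_const.mul (continuous_gegenbauer α l)).measurable
  have ht : ∀ v : E, ‖v‖ = 1 → Tendsto (fun n => eLpNorm
      ((fun ω : sphere (0 : E) 1 => f ⟪v, ω.1⟫) -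
        fun ω => ∑ l ∈ Finset.range n, b l * gegenbauer α l ⟪v, ω.1⟫) 2 (sphereProb E))
      atTop (𝓝 0) := fun v hv =>
    tendsto_eLpNorm_comp_inner_sphere hv hα hn
      (f := fun n x => f x - ∑ l ∈ Finset.range n, b l * gegenbauer α l x) hmeas H.tendsto
  have key := tendsto_integral_bounded_mul_of_eLpNorm (μ := sphereProb E)
    hψ.aestronglyMeasurable hψ1 (fun n => hsm n u) (fun n => hsm n w)
    (memLp_comp_inner_sphere hu hα hn H.measurable H.memLp)
    (memLp_comp_inner_sphere hw hα hn H.measurable H.memLp) (ht u hu) (ht w hw)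
  have hfin := integral_mul_sum_mul_sum (μ := sphereProb E) ψ
    (fun l ω => gegenbauer α l ⟪u, ω.1⟫) (fun l ω => gegenbauer α l ⟪w, ω.1⟫) b
    (fun l m => (hψ.mul ((hc l u).mul (hc m w))).integrable_sphereProb)
  simp only [hfin] at key
  exact key

theorem integral_gegenbauer_mul (hα : 1 / 2 ≤ α) (hn : (finrank ℝ E : ℝ) = 2 * α + 2) {u w : E}
    (hu : ‖u‖ = 1) (hw : ‖w‖ = 1) (l m : ℕ) :
    ∫ ω : sphere (0 : E) 1, gegenbauer α l ⟪u, ω.1⟫ * gegenbauer α m ⟪w, ω.1⟫ ∂(sphereProb E) =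
      if l = m then α / (l + α) * gegenbauer α l ⟪u, w⟫ else 0 := by
  have hz := isZonalPairing hu hw hn
  have h := zonalPairing_apply u w (gegPoly α l) (gegPoly α m)
  simp only [eval_gegPoly] at h
  rw [← h]
  split_ifs with hlm
  · subst hlm
    exact hz.diag (by linarith) l
  · exact hz.orthogonal (by linarith) hlm

/-- Parseval: with u = w and ψ = 1 the double sums reduce to their diagonal, whose terms are squared
norms and hence nonnegative. -/
theorem summable_sq (H : IsGegenbauerExpansion α f b) (hα : 1 / 2 ≤ α)
    (hn : (finrank ℝ E : ℝ) = 2 * α + 2) {u : E} (hu : ‖u‖ = 1) :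
    Summable fun l => b l ^ 2 * (α / (l + α) * gegenbauer α l 1) := by
  have h := H.tendsto_double_sum hα hn hu hu (ψ := fun _ => 1) continuous_const (by simp)
  have hval : ∀ l, α / (l + α) * gegenbauer α l 1 =
      ∫ ω : sphere (0 : E) 1, gegenbauer α l ⟪u, ω.1⟫ * gegenbauer α l ⟪u, ω.1⟫ ∂(sphereProb E) := by
    intro l
    rw [integral_gegenbauer_mul hα hn hu hu, if_pos rfl, real_inner_self_eq_norm_sq, hu]
    norm_num
  have hnn : ∀ l, 0 ≤ b l ^ 2 * (α / (l + α) * gegenbauer α l 1) := by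
    intro l
    rw [hval]
    exact mul_nonneg (sq_nonneg _) (integral_nonneg fun ω => mul_self_nonneg _)
  refine ((hasSum_iff_tendsto_nat_of_nonneg hnn _).2 (h.congr fun N => ?_)).summable
  refine Finset.sum_congr rfl fun l hl => ?_
  simp only [one_mul, integral_gegenbauer_mul hα hn hu hu]
  rw [Finset.sum_eq_single_of_mem l hl fun m _ hm => by rw [if_neg hm.symm, mul_zero], if_pos rfl,
    real_inner_self_eq_norm_sq, hu]
  ring_nf

/-- The weights ψ used later multiply by polynomials of degree two, so their matrices `M` are
supported where m - l ∈ {0, ±2}. -/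
theorem hasSum_integral (H : IsGegenbauerExpansion α f b) (hα : 1 / 2 ≤ α)
    (hn : (finrank ℝ E : ℝ) = 2 * α + 2) {u w : E} (hu : ‖u‖ = 1) (hw : ‖w‖ = 1)
    {ψ : sphere (0 : E) 1 → ℝ} (hψ : Continuous ψ) (hψ1 : ∀ ω, |ψ ω| ≤ 1) {M : ℕ → ℕ → ℝ}
    (hM : ∀ l m, ∫ ω, ψ ω * (gegenbauer α l ⟪u, ω.1⟫ * gegenbauer α m ⟪w, ω.1⟫) ∂(sphereProb E)
      = M l m)
    (hM0 : ∀ l m, l ≠ m → m ≠ l + 2 → l ≠ m + 2 → M l m = 0) :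
    HasSum (fun l => b l ^ 2 * M l l + b l * b (l + 2) * (M l (l + 2) + M (l + 2) l))
      (∫ ω, ψ ω * (f ⟪u, ω.1⟫ * f ⟪w, ω.1⟫) ∂(sphereProb E)) := by
  have hc : ∀ l (v : E), Continuous fun ω : sphere (0 : E) 1 => gegenbauer α l ⟪v, ω.1⟫ :=
    fun l v => (continuous_gegenbauer α l).comp (by fun_prop)
  have h := H.tendsto_double_sum hα hn hu hw hψ hψ1
  simp only [hM] at h
  have hval : ∀ l (v : E), ‖v‖ = 1 → α / (l + α) * gegenbauer α l 1 =
      ∫ ω : sphere (0 : E) 1, gegenbauer α l ⟪v, ω.1⟫ * gegenbauer α l ⟪v, ω.1⟫ ∂(sphereProb E) := by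
    intro l v hv
    rw [integral_gegenbauer_mul hα hn hv hv, if_pos rfl, real_inner_self_eq_norm_sq, hv]
    norm_num
  convert! hasSum_of_banded (c := fun l m => b l * b m * M l m)
    (fun l m h1 h2 h3 => by rw [hM0 l m h1 h2 h3, mul_zero])
    (g := fun l => b l ^ 2 * (α / (l + α) * gegenbauer α l 1)) (H.summable_sq hα hn hu)
    ?_ h using 1
  · funext l
    ring
  -- Since |ψ| ≤ 1, each term is bounded by the sum of two Parseval terms.
  · intro l m
    rw [← hM, hval l u hu, hval m w hw]
    exact abs_mul_integral_le hψ1 (b l) (b m) ((hc l u).mul (hc l u)).integrable_sphereProb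
      ((hc m w).mul (hc m w)).integrable_sphereProb
      (hψ.mul ((hc l u).mul (hc m w))).integrable_sphereProb

end IsGegenbauerExpansion

end Expansion

/-! ### Multiplication by x in the Gegenbauer basis -/

section Jacobi

open Polynomial

/-- The upper coefficient of `x C_l = p C_{l+1} + q C_{l-1}`. -/
def jacUp (α : ℝ) (l : ℕ) : ℝ := (l + 1) / (2 * (l + α))

/-- The lower coefficient of `x C_l = p C_{l+1} + q C_{l-1}`. -/
def jacDown (α : ℝ) (l : ℕ) : ℝ := if l = 0 then 0 else (l - 1 + 2 * α) / (2 * (l + α))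

/-- The pairing of `C_l` with itself. -/
def zonalDiag (α y : ℝ) (l : ℕ) : ℝ := α / (l + α) * gegenbauer α l y

@[simp] theorem jacDown_zero (α : ℝ) : jacDown α 0 = 0 := if_pos rfl

theorem jacDown_succ (α : ℝ) (l : ℕ) : jacDown α (l + 1) = (l + 2 * α) / (2 * (l + 1 + α)) := by
  rw [jacDown, if_neg (Nat.succ_ne_zero l)]
  push_cast
  ring

theorem X_mul_gegPoly {α : ℝ} (hα : 0 < α) (l : ℕ) :
    X * gegPoly α l = C (jacUp α l) * gegPoly α (l + 1) + C (jacDown α l) * gegPoly α (l - 1) := by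
  rcases l with _ | l
  · rw [X_mul_gegPoly_zero hα]
    simp [jacUp]
  · rw [X_mul_gegPoly_succ hα, jacDown_succ, jacUp]
    push_cast
    congr 4
    ring

namespace IsZonalPairing

variable {α y : ℝ} {Φ : ℝ[X] →ₗ[ℝ] ℝ[X] →ₗ[ℝ] ℝ}

theorem gegPoly_gegPoly (H : IsZonalPairing α y Φ) (hα : 0 < α) (l m : ℕ) :
    Φ (gegPoly α l) (gegPoly α m) = if l = m then zonalDiag α y l else 0 := by
  split_ifs with h
  · subst h
    exact H.diag hα l
  · exact H.orthogonal hα h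

/-- The truncated index `l - 1` at `l = 0` (likewise for `m`) is harmless, because `jacDown α 0 =
0`. -/
theorem X_mul_X_mul (H : IsZonalPairing α y Φ) (hα : 0 < α) (l m : ℕ) :
    Φ (X * gegPoly α l) (X * gegPoly α m) =
      jacUp α l * (jacUp α m * (if l + 1 = m + 1 then zonalDiag α y (l + 1) else 0)
        + jacDown α m * (if l + 1 = m - 1 then zonalDiag α y (l + 1) else 0))
      + jacDown α l * (jacUp α m * (if l - 1 = m + 1 then zonalDiag α y (l - 1) else 0)
        + jacDown α m * (if l - 1 = m - 1 then zonalDiag α y (l - 1) else 0)) := by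
  simp only [X_mul_gegPoly hα, map_add, LinearMap.add_apply, map_C_mul_left, map_C_mul_right,
    H.gegPoly_gegPoly hα]
  ring

theorem X_mul_X_mul_of_ne (H : IsZonalPairing α y Φ) (hα : 0 < α) {l m : ℕ} (h : l ≠ m)
    (h1 : m ≠ l + 2) (h2 : l ≠ m + 2) : Φ (X * gegPoly α l) (X * gegPoly α m) = 0 := by
  rw [H.X_mul_X_mul hα, if_neg (by omega), if_neg (by omega), if_neg (by omega)]
  rcases l with _ | l
  · simp
  · rcases m with _ | m
    · simp
    · rw [if_neg (by omega)]
      ring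

theorem X_mul_X_mul_self (H : IsZonalPairing α y Φ) (hα : 0 < α) (l : ℕ) :
    Φ (X * gegPoly α l) (X * gegPoly α l) =
      jacUp α l ^ 2 * zonalDiag α y (l + 1) + jacDown α l ^ 2 * zonalDiag α y (l - 1) := by
  rw [H.X_mul_X_mul hα, if_pos rfl, if_neg (by omega), if_neg (by omega), if_pos rfl]
  ring

theorem X_mul_X_mul_add_two (H : IsZonalPairing α y Φ) (hα : 0 < α) (l : ℕ) :
    Φ (X * gegPoly α l) (X * gegPoly α (l + 2)) + Φ (X * gegPoly α (l + 2)) (X * gegPoly α l) =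
      2 * jacUp α l * jacDown α (l + 2) * zonalDiag α y (l + 1) := by
  rw [H.X_mul_X_mul hα, H.X_mul_X_mul hα]
  simp only [Nat.reduceSubDiff]
  split_ifs <;> first | omega | ring

theorem X_mul_X_mul_left (H : IsZonalPairing α y Φ) (hα : 0 < α) (l m : ℕ) :
    Φ (X * (X * gegPoly α l)) (gegPoly α m) =
      jacUp α l * (jacUp α (l + 1) * (if l + 2 = m then zonalDiag α y (l + 2) else 0)
        + jacDown α (l + 1) * (if l = m then zonalDiag α y l else 0))
      + jacDown α l * (jacUp α (l - 1) * (if l - 1 + 1 = m then zonalDiag α y (l - 1 + 1) else 0)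
        + jacDown α (l - 1) * (if l - 1 - 1 = m then zonalDiag α y (l - 1 - 1) else 0)) := by
  simp only [X_mul_gegPoly hα, mul_add, mul_left_comm X (C _), map_add, LinearMap.add_apply,
    map_C_mul_left, H.gegPoly_gegPoly hα]
  rfl

theorem X_mul_X_mul_left_of_ne (H : IsZonalPairing α y Φ) (hα : 0 < α) {l m : ℕ} (h : l ≠ m)
    (h1 : m ≠ l + 2) (h2 : l ≠ m + 2) : Φ (X * (X * gegPoly α l)) (gegPoly α m) = 0 := by
  rw [H.X_mul_X_mul_left hα, if_neg (by omega), if_neg (by omega)]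
  rcases l with _ | _ | l
  · simp
  · simp [h]
  · rw [if_neg (by omega), if_neg (by omega)]
    ring

theorem X_mul_X_mul_left_self (H : IsZonalPairing α y Φ) (hα : 0 < α) (l : ℕ) :
    Φ (X * (X * gegPoly α l)) (gegPoly α l) =
      (jacUp α l * jacDown α (l + 1) + jacDown α l * jacUp α (l - 1)) * zonalDiag α y l := by
  rw [H.X_mul_X_mul_left hα, if_neg (by omega), if_pos rfl]
  rcases l with _ | _ | l
  · simp [mul_assoc]
  · simp; ring
  · rw [if_pos (by omega), if_neg (by omega)]
    simp only [Nat.add_sub_cancel]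
    ring

theorem X_mul_X_mul_left_add_two (H : IsZonalPairing α y Φ) (hα : 0 < α) (l : ℕ) :
    Φ (X * (X * gegPoly α l)) (gegPoly α (l + 2)) +
      Φ (X * (X * gegPoly α (l + 2))) (gegPoly α l) =
      jacUp α l * jacUp α (l + 1) * zonalDiag α y (l + 2)
        + jacDown α (l + 2) * jacDown α (l + 1) * zonalDiag α y l := by
  rw [H.X_mul_X_mul_left hα, H.X_mul_X_mul_left hα]
  simp only [Nat.reduceSubDiff]
  split_ifs <;> first | omega | ring

end IsZonalPairing

end Jacobi

/-! ### Series for the zeroth and second spherical moments -/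

section Moments

open Metric Set Module Polynomial

variable {E : Type*} [NormedAddCommGroup E] [InnerProductSpace ℝ E] [FiniteDimensional ℝ E]
  [MeasurableSpace E] [BorelSpace E] [Nontrivial E] {α : ℝ}

local notation "⟪" x ", " y "⟫" => inner ℝ x y

/-- The terms of the series of `E[f(u·ω) f(w·ω)]`. -/
def termZ (α y : ℝ) (b : ℕ → ℝ) (l : ℕ) : ℝ := b l ^ 2 * zonalDiag α y l

/-- The terms of the series of `E[f(u·ω) f(w·ω) (u·ω)²]`. -/
def termX (α y : ℝ) (b : ℕ → ℝ) (l : ℕ) : ℝ :=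
  b l ^ 2 * ((jacUp α l * jacDown α (l + 1) + jacDown α l * jacUp α (l - 1)) * zonalDiag α y l)
    + b l * b (l + 2) * (jacUp α l * jacUp α (l + 1) * zonalDiag α y (l + 2)
        + jacDown α (l + 2) * jacDown α (l + 1) * zonalDiag α y l)

/-- The terms of the series of `E[f(u·ω) f(w·ω) (u·ω) (w·ω)]`. -/
def termY (α y : ℝ) (b : ℕ → ℝ) (l : ℕ) : ℝ :=
  b l ^ 2 * (jacUp α l ^ 2 * zonalDiag α y (l + 1) + jacDown α l ^ 2 * zonalDiag α y (l - 1))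
    + b l * b (l + 2) * (2 * jacUp α l * jacDown α (l + 2) * zonalDiag α y (l + 1))

namespace IsGegenbauerExpansion

variable {f : ℝ → ℝ} {b : ℕ → ℝ}

theorem hasSum_termZ (H : IsGegenbauerExpansion α f b) (hα : 1 / 2 ≤ α)
    (hn : (finrank ℝ E : ℝ) = 2 * α + 2) {u w : E} (hu : ‖u‖ = 1) (hw : ‖w‖ = 1) :
    HasSum (termZ α ⟪u, w⟫ b)
      (∫ ω : sphere (0 : E) 1, f ⟪u, ω.1⟫ * f ⟪w, ω.1⟫ ∂(sphereProb E)) := by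
  have hz := isZonalPairing hu hw hn
  have hα0 : 0 < α := by linarith
  have h := H.hasSum_integral hα hn hu hw (ψ := fun _ => 1) continuous_const (by simp)
    (M := fun l m => zonalPairing u w (gegPoly α l) (gegPoly α m))
    (fun l m => by simp only [zonalPairing_apply, eval_gegPoly, one_mul])
    (fun l m h _ _ => hz.orthogonal hα0 h)
  simp only [one_mul] at h
  convert! h using 1
  funext l
  rw [hz.gegPoly_gegPoly hα0, if_pos rfl, hz.gegPoly_gegPoly hα0, if_neg (by omega),
    hz.gegPoly_gegPoly hα0, if_neg (by omega), termZ]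
  ring

theorem hasSum_termX (H : IsGegenbauerExpansion α f b) (hα : 1 / 2 ≤ α)
    (hn : (finrank ℝ E : ℝ) = 2 * α + 2) {u w : E} (hu : ‖u‖ = 1) (hw : ‖w‖ = 1) :
    HasSum (termX α ⟪u, w⟫ b) (∫ ω : sphere (0 : E) 1,
      f ⟪u, ω.1⟫ * f ⟪w, ω.1⟫ * (⟪u, ω.1⟫ * ⟪u, ω.1⟫) ∂(sphereProb E)) := by
  have hz := isZonalPairing hu hw hn
  have hα0 : 0 < α := by linarith
  have h := H.hasSum_integral hα hn hu hw (ψ := fun ω => ⟪u, ω.1⟫ * ⟪u, ω.1⟫) (by fun_prop)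
    (fun ω => by
      have := abs_inner_sphere_le u ω
      rw [hu] at this
      rw [abs_mul]
      exact mul_le_one₀ this (abs_nonneg _) this)
    (M := fun l m => zonalPairing u w (X * (X * gegPoly α l)) (gegPoly α m))
    (fun l m => by
      simp only [zonalPairing_apply, eval_mul, eval_X, eval_gegPoly]
      congr 1 with ω
      ring)
    (fun l m h h1 h2 => hz.X_mul_X_mul_left_of_ne hα0 h h1 h2)
  convert! h using 1
  · funext l
    rw [hz.X_mul_X_mul_left_self hα0, hz.X_mul_X_mul_left_add_two hα0, termX]
  · congr 1 with ω
    ring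

theorem hasSum_termY (H : IsGegenbauerExpansion α f b) (hα : 1 / 2 ≤ α)
    (hn : (finrank ℝ E : ℝ) = 2 * α + 2) {u w : E} (hu : ‖u‖ = 1) (hw : ‖w‖ = 1) :
    HasSum (termY α ⟪u, w⟫ b) (∫ ω : sphere (0 : E) 1,
      f ⟪u, ω.1⟫ * f ⟪w, ω.1⟫ * (⟪u, ω.1⟫ * ⟪w, ω.1⟫) ∂(sphereProb E)) := by
  have hz := isZonalPairing hu hw hn
  have hα0 : 0 < α := by linarith
  have h := H.hasSum_integral hα hn hu hw (ψ := fun ω => ⟪u, ω.1⟫ * ⟪w, ω.1⟫) (by fun_prop)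
    (fun ω => by
      have h1 := abs_inner_sphere_le u ω
      have h2 := abs_inner_sphere_le w ω
      rw [hu] at h1
      rw [hw] at h2
      rw [abs_mul]
      exact mul_le_one₀ h1 (abs_nonneg _) h2)
    (M := fun l m => zonalPairing u w (X * gegPoly α l) (X * gegPoly α m))
    (fun l m => by
      simp only [zonalPairing_apply, eval_mul, eval_X, eval_gegPoly]
      congr 1 with ω
      ring)
    (fun l m h h1 h2 => hz.X_mul_X_mul_of_ne hα0 h h1 h2)
  convert! h using 1
  · funext l
    rw [hz.X_mul_X_mul_self hα0, hz.X_mul_X_mul_add_two hα0, termY]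
  · congr 1 with ω
    ring

end IsGegenbauerExpansion

end Moments

/-! ### From the shape of the derivative to the eigenvalues -/

section Eigenspaces

variable {B : ℕ}

theorem centering_apply (i j : Fin B) :
    centering B i j = (if i = j then 1 else 0) - 1 / (B : ℝ) := by
  simp [centering, onesMat, Matrix.one_apply]

theorem sum_centering (hB : B ≠ 0) (i : Fin B) : ∑ k, centering B i k = 0 := by
  have hB' : (B : ℝ) ≠ 0 := by exact_mod_cast hB
  simp [centering_apply, hB']

theorem centering_mul_diagonal_mul_centering_apply {d : Fin B → ℝ} (hd : ∑ i, d i = 0)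
    (i j : Fin B) : (centering B * Matrix.diagonal d * centering B) i j =
      (if i = j then d i else 0) - (d i + d j) / B := by
  rw [Matrix.mul_apply]
  simp only [Matrix.mul_diagonal, centering_apply]
  have h : ∀ k, ((if i = k then (1 : ℝ) else 0) - 1 / (B : ℝ)) * d k *
      ((if k = j then 1 else 0) - 1 / (B : ℝ)) =
      (if i = k then (if k = j then d k else 0) - d k / B else 0) - (if k = j then d k / B else 0)
        + d k * (1 / (B : ℝ) * (1 / (B : ℝ))) := by
    intro k
    split_ifs <;> ring
  simp only [h, Finset.sum_add_distrib, Finset.sum_sub_distrib, ← Finset.sum_mul, hd]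
  simp
  ring

/-- The matrix is d1ᵀ + 1dᵀ, and G annihilates 1. -/
theorem centering_mul_rank_two_mul_centering (d : Fin B → ℝ) :
    centering B * (Matrix.of fun i j => d i + d j) * centering B = 0 := by
  have h1 : (Matrix.of fun i j => d i + d j : Matrix (Fin B) (Fin B) ℝ) =
      Matrix.vecMulVec d 1 + Matrix.vecMulVec 1 d := by
    ext i j
    simp
  have h2 : (centering B).mulVec 1 = 0 := by
    ext i
    have := sum_centering (B := B) (Nat.pos_iff_ne_zero.1 i.pos) i
    simpa [Matrix.mulVec, dotProduct] using this
  have h3 : Matrix.vecMul 1 (centering B) = 0 := by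
    rw [← Matrix.mulVec_transpose, centering_transpose, h2]
  rw [h1, Matrix.mul_add, Matrix.add_mul, Matrix.mul_vecMulVec, Matrix.mul_vecMulVec, h2,
    Matrix.vecMulVec_mul, Matrix.vecMulVec_mul, h3]
  simp

theorem trace_spaceL {S : symSpaceG B} (hS : S ∈ spaceL B) : S.1.trace = 0 := by
  obtain ⟨d, hd, hSd⟩ := hS
  simp only [Matrix.trace, Matrix.diag_apply, hSd, centering_mul_diagonal_mul_centering_apply hd,
    if_true]
  simp [← Finset.sum_div, Finset.sum_add_distrib, hd]

theorem trace_spaceM {S : symSpaceG B} (hS : S ∈ spaceM B) : S.1.trace = 0 :=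
  Finset.sum_eq_zero fun i _ => hS i

/-- For the difference of two coordinate vectors, the first diagonal entry of GDG is 1 - 2/B. -/
theorem spaceL_ne_bot (hB : 4 ≤ B) : spaceL B ≠ ⊥ := by
  let i : Fin B := ⟨0, by omega⟩
  let j : Fin B := ⟨1, by omega⟩
  have hij : i ≠ j := by simp [i, j]
  let d : Fin B → ℝ := Pi.single i 1 - Pi.single j 1
  have hd : ∑ k, d k = 0 := by simp [d]
  let D : symSpace B := ⟨Matrix.diagonal d, Matrix.diagonal_transpose d⟩
  have hmem : gTensor B D ∈ spaceL B := ⟨d, hd, rfl⟩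
  intro h
  rw [h, Submodule.mem_bot] at hmem
  have h1 : (gTensor B D).1 i i = 0 := by rw [hmem]; rfl
  have h2 := centering_mul_diagonal_mul_centering_apply hd i i
  rw [show (centering B * Matrix.diagonal d * centering B) i i = 0 from h1] at h2
  have hB' : (4 : ℝ) ≤ B := by exact_mod_cast hB
  have hdi : d i = 1 := by simp [d, hij]
  rw [hdi, if_pos rfl, eq_comm, sub_eq_zero, eq_div_iff (by positivity)] at h2
  linarith

/-- The witness efᵀ + feᵀ has zero diagonal because `e` and `f`, of coordinate sum zero, have
disjoint supports; this uses four indices. -/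
theorem spaceM_ne_bot (hB : 4 ≤ B) : spaceM B ≠ ⊥ := by
  let e : Fin B → ℝ := Pi.single ⟨0, by omega⟩ 1 - Pi.single ⟨1, by omega⟩ 1
  let f : Fin B → ℝ := Pi.single ⟨2, by omega⟩ 1 - Pi.single ⟨3, by omega⟩ 1
  have he : ∑ k, e k = 0 := by simp [e]
  have hf : ∑ k, f k = 0 := by simp [f]
  have hG : ∀ v : Fin B → ℝ, ∑ k, v k = 0 → (centering B).mulVec v = v := by
    intro v hv
    ext i
    simp [Matrix.mulVec, dotProduct, centering_apply, sub_mul, ← Finset.mul_sum, hv]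
  have hG' : ∀ v : Fin B → ℝ, ∑ k, v k = 0 → Matrix.vecMul v (centering B) = v := by
    intro v hv
    rw [← Matrix.mulVec_transpose, centering_transpose, hG v hv]
  let M : Matrix (Fin B) (Fin B) ℝ := Matrix.vecMulVec e f + Matrix.vecMulVec f e
  have hM : M ∈ symSpaceG B := by
    refine ⟨?_, ?_⟩
    · rw [Matrix.transpose_add, Matrix.transpose_vecMulVec, Matrix.transpose_vecMulVec, add_comm]
    · rw [Matrix.mul_add, Matrix.add_mul, Matrix.mul_vecMulVec, Matrix.mul_vecMulVec,
        Matrix.vecMulVec_mul, Matrix.vecMulVec_mul, hG e he, hG f hf, hG' e he, hG' f hf]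
  have hmem : (⟨M, hM⟩ : symSpaceG B) ∈ spaceM B := by
    intro k
    simp only [M, Matrix.add_apply, Matrix.vecMulVec_apply, e, f, Pi.sub_apply, Pi.single_apply,
      Fin.ext_iff]
    split_ifs <;> first | omega | norm_num
  intro h
  rw [h, Submodule.mem_bot] at hmem
  have h1 : M ⟨0, by omega⟩ ⟨2, by omega⟩ = 0 := congrFun (congrFun (congrArg Subtype.val hmem) _) _
  simp [M, Matrix.vecMulVec_apply, e, f] at h1

/-- With zero diagonal, only the term 2q S_ij survives, and G leaves `S` unchanged. -/
theorem isEigenvalueOn_spaceM (hB : 4 ≤ B) {J : symSpaceG B →ₗ[ℝ] symSpace B} {p q r : ℝ}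
    (hoff : ∀ S : symSpaceG B, S.1.trace = 0 → ∀ i j, i ≠ j →
      (J S).1 i j = p * (S.1 i i + S.1 j j) + 2 * q * S.1 i j)
    (hdiag : ∀ S : symSpaceG B, S.1.trace = 0 → ∀ i, (J S).1 i i = r * S.1 i i) :
    IsEigenvalueOn (gTensor B ∘ₗ J) (spaceM B) (2 * q) := by
  refine ⟨spaceM_ne_bot hB, fun S hS => ?_⟩
  have h : (J S).1 = (2 * q) • S.1 := by
    ext i j
    rcases eq_or_ne i j with rfl | hij
    · simp [hdiag S (trace_spaceM hS), hS i]
    · simp [hoff S (trace_spaceM hS) i j hij, hS i, hS j]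
  ext1
  change centering B * (J S).1 * centering B = (2 * q) • S.1
  rw [h, Matrix.mul_smul, Matrix.smul_mul, S.2.2]

theorem isEigenvalueOn_spaceL (hB : 4 ≤ B) {J : symSpaceG B →ₗ[ℝ] symSpace B} {p q r : ℝ}
    (hoff : ∀ S : symSpaceG B, S.1.trace = 0 → ∀ i j, i ≠ j →
      (J S).1 i j = p * (S.1 i i + S.1 j j) + 2 * q * S.1 i j)
    (hdiag : ∀ S : symSpaceG B, S.1.trace = 0 → ∀ i, (J S).1 i i = r * S.1 i i) :
    IsEigenvalueOn (gTensor B ∘ₗ J) (spaceL B)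
      ((((B : ℝ) - 2) * (r - 2 * p) + 4 * q) / B) := by
  refine ⟨spaceL_ne_bot hB, fun S hS => ?_⟩
  have htr := trace_spaceL hS
  obtain ⟨d, hd, hSd⟩ := hS
  have hB' : (B : ℝ) ≠ 0 := by
    have : 0 < B := by omega
    positivity
  -- Here S_ii = (B-2)d_i/B and S_ij = -(d_i + d_j)/B. The off-diagonal entries determine `t`, the
  -- diagonal ones then `s`, and the `t` part is annihilated by G.
  set s : ℝ := (((B : ℝ) - 2) * (r - 2 * p) + 4 * q) / B with hs
  set t : ℝ := (((B : ℝ) - 2) * p - 2 * q) / B with ht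
  have hS1 : ∀ i j, S.1 i j = (if i = j then d i else 0) - (d i + d j) / B := by
    intro i j
    rw [hSd, centering_mul_diagonal_mul_centering_apply hd]
  have h : (J S).1 = s • Matrix.diagonal d + t • Matrix.of fun i j => d i + d j := by
    ext i j
    rcases eq_or_ne i j with rfl | hij
    · rw [hdiag S htr, hS1]
      simp [hs, ht]
      field_simp
      ring
    · rw [hoff S htr i j hij, hS1, hS1, hS1]
      simp [hs, ht, hij]
      field_simp
      ring
  ext1
  change centering B * (J S).1 * centering B = s • S.1
  rw [h, hSd, Matrix.mul_add, Matrix.add_mul, Matrix.mul_smul, Matrix.smul_mul, Matrix.mul_smul,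
    Matrix.smul_mul, centering_mul_rank_two_mul_centering, smul_zero, add_zero]

end Eigenspaces

/-! ### Linear equations for the coefficients of the second-moment form -/

section Coefficients

open Metric Set Module

variable {E : Type*} [NormedAddCommGroup E] [InnerProductSpace ℝ E] [FiniteDimensional ℝ E]
  [MeasurableSpace E] [BorelSpace E] [Nontrivial E] {α : ℝ}

local notation "⟪" x ", " y "⟫" => inner ℝ x y

theorem sum_inner_mul_inner_stdOrthonormalBasis (u w : E) :
    ∑ k, ⟪u, stdOrthonormalBasis ℝ E k⟫ * ⟪w, stdOrthonormalBasis ℝ E k⟫ = ⟪u, w⟫ := by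
  rw [← (stdOrthonormalBasis ℝ E).sum_inner_mul_inner u w]
  simp only [real_inner_comm]

namespace IsGegenbauerExpansion

variable {f : ℝ → ℝ} {b : ℕ → ℝ}

/-- The equations come from evaluating the form at (u, u) and (u, w) and from its trace. The sums X,
Y, Z depend on the pair only through `y`, which makes the derivative uniform in the indices. -/
theorem exists_sphereForm_eq_of_inner (H : IsGegenbauerExpansion α f b) (hα : 1 / 2 ≤ α)
    (hn : (finrank ℝ E : ℝ) = 2 * α + 2) {u w : E} (hu : ‖u‖ = 1) (hw : ‖w‖ = 1) {y : ℝ}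
    (hy : ⟪u, w⟫ = y) (hy1 : y ^ 2 ≠ 1) :
    ∃ A C τ X Y Z : ℝ, HasSum (termX α y b) X ∧ HasSum (termY α y b) Y ∧ HasSum (termZ α y b) Z ∧
      (∀ a c, sphereForm (H.integrable_mul hα hn hu hw) a c =
        A * (⟪u, a⟫ * ⟪u, c⟫ + ⟪w, a⟫ * ⟪w, c⟫) + C * (⟪u, a⟫ * ⟪w, c⟫ + ⟪w, a⟫ * ⟪u, c⟫)
          + τ * ⟪a, c⟫) ∧
      A * (1 + y ^ 2) + 2 * C * y + τ = X ∧ 2 * A * y + C * (1 + y ^ 2) + τ * y = Y ∧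
      2 * A + 2 * C * y + (2 * α + 2) * τ = Z := by
  subst hy
  set y := ⟪u, w⟫ with hy
  have hy' : ⟪w, u⟫ = y := real_inner_comm _ _
  have hn3 : 3 ≤ finrank ℝ E := by
    have : (3 : ℝ) ≤ finrank ℝ E := by rw [hn]; linarith
    exact_mod_cast this
  have huu : ⟪u, u⟫ = 1 := by rw [real_inner_self_eq_norm_sq, hu]; norm_num
  have hww : ⟪w, w⟫ = 1 := by rw [real_inner_self_eq_norm_sq, hw]; norm_num
  have hX := H.hasSum_termX hα hn hu hw
  have hX' := H.hasSum_termX hα hn hw hu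
  have hY := H.hasSum_termY hα hn hu hw
  have hZ := H.hasSum_termZ hα hn hu hw
  rw [hy'] at hX'
  obtain ⟨A, A', C, τ, h⟩ := exists_sphereForm_eq (G := fun s t => f s * f t)
    (H.integrable_mul hα hn hu hw) hn3 hu hw hy1
  have e1 := h u u
  have e2 := h w w
  have e3 := h u w
  have e4 := sphereForm_trace (H.integrable_mul hα hn hu hw)
  simp only [h, Finset.sum_add_distrib, ← Finset.mul_sum,
    sum_inner_mul_inner_stdOrthonormalBasis] at e4
  have e5 : ∑ k, ⟪stdOrthonormalBasis ℝ E k, stdOrthonormalBasis ℝ E k⟫ = 2 * α + 2 := by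
    simp [hn]
  rw [sphereForm_apply] at e1 e2 e3
  have e6 : (∫ ω : sphere (0 : E) 1, f ⟪u, ω.1⟫ * f ⟪w, ω.1⟫ * (⟪w, ω.1⟫ * ⟪w, ω.1⟫)
      ∂(sphereProb E)) = ∫ ω : sphere (0 : E) 1, f ⟪w, ω.1⟫ * f ⟪u, ω.1⟫ * (⟪w, ω.1⟫ * ⟪w, ω.1⟫)
      ∂(sphereProb E) := by
    congr 1 with ω
    ring
  rw [e6, hX'.unique hX] at e2
  simp only [huu, hww, hy', ← hy] at e1 e2 e3 e4
  rw [e5] at e4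
  -- The values at (u, u) and (w, w) are sums of one series, so the two coefficients coincide as 1 -
  -- y² ≠ 0.
  have hA : A' = A := by
    have h1 : (A' - A) * (1 - y ^ 2) = 0 := by linear_combination e1 - e2
    have h2 : 1 - y ^ 2 ≠ 0 := fun h => hy1 (by linarith)
    have := (mul_eq_zero.1 h1).resolve_right h2
    linarith
  subst hA
  refine ⟨A', C, τ, _, _, _, hX, hY, hZ, fun a c => by rw [h]; ring, ?_, ?_, ?_⟩
  · rw [e1]; ring
  · rw [e3]; ring
  · rw [← e4]; ring

theorem exists_sphereForm_eq_self (H : IsGegenbauerExpansion α f b) (hα : 1 / 2 ≤ α)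
    (hn : (finrank ℝ E : ℝ) = 2 * α + 2) {u : E} (hu : ‖u‖ = 1) :
    ∃ A τ X Z : ℝ, HasSum (termX α 1 b) X ∧ HasSum (termZ α 1 b) Z ∧
      (∀ a c, sphereForm (H.integrable_mul hα hn hu hu) a c =
        A * (⟪u, a⟫ * ⟪u, c⟫) + τ * ⟪a, c⟫) ∧
      A + τ = X ∧ A + (2 * α + 2) * τ = Z := by
  have hn3 : 3 ≤ finrank ℝ E := by
    have : (3 : ℝ) ≤ finrank ℝ E := by rw [hn]; linarith
    exact_mod_cast this
  have huu : ⟪u, u⟫ = 1 := by rw [real_inner_self_eq_norm_sq, hu]; norm_num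
  have hX := H.hasSum_termX hα hn hu hu
  have hZ := H.hasSum_termZ hα hn hu hu
  rw [huu] at hX hZ
  obtain ⟨A, τ, h⟩ := exists_sphereForm_eq_of_eq (g := fun s => f s * f s)
    (H.integrable_mul hα hn hu hu) hn3 hu
  have e1 := h u u
  have e4 := sphereForm_trace (H.integrable_mul hα hn hu hu)
  simp only [h, Finset.sum_add_distrib, ← Finset.mul_sum,
    sum_inner_mul_inner_stdOrthonormalBasis] at e4
  have e5 : ∑ k, ⟪stdOrthonormalBasis ℝ E k, stdOrthonormalBasis ℝ E k⟫ = 2 * α + 2 := by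
    simp [hn]
  rw [sphereForm_apply] at e1
  simp only [huu] at e1 e4
  rw [e5] at e4
  refine ⟨A, τ, _, _, hX, hZ, h, ?_, ?_⟩
  · rw [e1]; ring
  · rw [← e4]; ring

end IsGegenbauerExpansion

end Coefficients

/-! ### Matching with the stated coefficients -/

section ClosedForms

variable {B : ℕ}

theorem zonalDiag_gegIndex (hB : 4 ≤ B) (y : ℝ) (l : ℕ) :
    zonalDiag (gegIndex B) y l = zonalConst B l * gegenbauer (gegIndex B) l y := by
  have hB' : (4 : ℝ) ≤ B := by exact_mod_cast hB
  have h : (B : ℝ) - 3 + 2 * l ≠ 0 := by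
    have : (0 : ℝ) ≤ l := by positivity
    linarith
  rw [zonalDiag, zonalConst, gegIndex]
  have h' : (l : ℝ) + ((B : ℝ) - 3) / 2 ≠ 0 := fun h0 => h (by linarith)
  congr 1
  rw [div_eq_div_iff h' h]
  ring

theorem termZ_sub_termZ (hB : 4 ≤ B) (a : ℕ → ℝ) (l : ℕ) :
    termZ (gegIndex B) 1 (fun l => a l * (zonalConst B l)⁻¹) l
      - termZ (gegIndex B) (-1 / ((B : ℝ) - 1)) (fun l => a l * (zonalConst B l)⁻¹) l
      = a l ^ 2 * coeffV B l := by
  have hB' : (4 : ℝ) ≤ B := by exact_mod_cast hB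
  have hl : (0 : ℝ) ≤ l := by positivity
  have h : zonalConst B l ≠ 0 := by
    rw [zonalConst]
    exact div_ne_zero (by linarith) (by linarith)
  simp only [termZ, zonalDiag_gegIndex hB, coeffV, gegOne, gegOff]
  field_simp

/-- κ₀ is the diagonal entry of multiplication by x², reached by a step up and down or down and up;
κ_{±2} below are the entries two degrees away. -/
theorem kappaZero_gegIndex (hB : 4 ≤ B) (l : ℕ) :
    kappaZero l (gegIndex B) = jacUp (gegIndex B) l * jacDown (gegIndex B) (l + 1)
      + jacDown (gegIndex B) l * jacUp (gegIndex B) (l - 1) := by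
  have hB' : (4 : ℝ) ≤ B := by exact_mod_cast hB
  rcases l with _ | l
  · simp only [kappaZero, jacUp, jacDown_succ, jacDown_zero, gegIndex]
    have h1 : (B : ℝ) - 3 ≠ 0 := by linarith
    have h2 : (B : ℝ) - 1 ≠ 0 := by linarith
    norm_num
    field_simp
    ring
  · have hl : (0 : ℝ) ≤ l := by positivity
    simp only [kappaZero, jacUp, jacDown_succ, gegIndex, Nat.add_sub_cancel]
    push_cast
    have h1 : (l : ℝ) + (B - 3) / 2 ≠ 0 := by linarith
    have h2 : (l : ℝ) + 1 + (B - 3) / 2 ≠ 0 := by linarith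
    have h3 : (l : ℝ) + 1 + 1 + (B - 3) / 2 ≠ 0 := by linarith
    have h4 : (l : ℝ) + 1 - 1 + (B - 3) / 2 ≠ 0 := by linarith
    field_simp
    ring

theorem kappaUp_gegIndex (hB : 4 ≤ B) (l : ℕ) :
    kappaUp l (gegIndex B) = jacUp (gegIndex B) l * jacUp (gegIndex B) (l + 1) := by
  have hB' : (4 : ℝ) ≤ B := by exact_mod_cast hB
  have hl : (0 : ℝ) ≤ l := by positivity
  simp only [kappaUp, jacUp, gegIndex]
  push_cast
  have h1 : (l : ℝ) + (B - 3) / 2 ≠ 0 := by linarith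
  have h2 : (l : ℝ) + 1 + (B - 3) / 2 ≠ 0 := by linarith
  field_simp
  ring

theorem kappaDown_gegIndex (hB : 4 ≤ B) (l : ℕ) :
    kappaDown (l + 2) (gegIndex B) = jacDown (gegIndex B) (l + 2) * jacDown (gegIndex B) (l + 1) := by
  have hB' : (4 : ℝ) ≤ B := by exact_mod_cast hB
  have hl : (0 : ℝ) ≤ l := by positivity
  simp only [kappaDown, jacDown_succ, gegIndex]
  push_cast
  have h1 : (l : ℝ) + 1 + (B - 3) / 2 ≠ 0 := by linarith
  have h2 : (l : ℝ) + 1 + 1 + (B - 3) / 2 ≠ 0 := by linarith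
  have h3 : (l : ℝ) + 2 + (B - 3) / 2 ≠ 0 := by linarith
  have h4 : (l : ℝ) + 2 - 1 + (B - 3) / 2 ≠ 0 := by linarith
  field_simp
  ring

theorem termX_gegIndex (hB : 4 ≤ B) (y : ℝ) (a : ℕ → ℝ) (l : ℕ) :
    termX (gegIndex B) y (fun l => a l * (zonalConst B l)⁻¹) l =
      a l ^ 2 * (kappaZero l (gegIndex B) * (zonalConst B l)⁻¹ * gegenbauer (gegIndex B) l y)
      + a l * a (l + 2) *
        ((zonalConst B l)⁻¹ * kappaUp l (gegIndex B) * gegenbauer (gegIndex B) (l + 2) y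
        + (zonalConst B (l + 2))⁻¹ * kappaDown (l + 2) (gegIndex B)
          * gegenbauer (gegIndex B) l y) := by
  have hB' : (4 : ℝ) ≤ B := by exact_mod_cast hB
  have h : ∀ l, zonalConst B l ≠ 0 := by
    intro l
    have hl : (0 : ℝ) ≤ l := by positivity
    rw [zonalConst]
    exact div_ne_zero (by linarith) (by linarith)
  have h1 := h l
  have h2 := h (l + 2)
  simp only [termX, zonalDiag_gegIndex hB, ← kappaZero_gegIndex hB, ← kappaUp_gegIndex hB,
    ← kappaDown_gegIndex hB]
  field_simp

/-- The left side is the termwise form of υ times the eigenvalue on 𝕃, after the linear equations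
are solved for the form coefficients. -/
theorem termL_eq (hB : 4 ≤ B) (a : ℕ → ℝ) (l : ℕ) :
    1 / 2 * ((((B : ℝ) - 1) * termX (gegIndex B) 1 (fun l => a l * (zonalConst B l)⁻¹) l
        - termZ (gegIndex B) 1 (fun l => a l * (zonalConst B l)⁻¹) l)
      - 2 * ((B : ℝ) - 1) / ((B : ℝ) - 2) *
        (((B : ℝ) - 1) * termX (gegIndex B) (-1 / ((B : ℝ) - 1))
            (fun l => a l * (zonalConst B l)⁻¹) l
          - termZ (gegIndex B) (-1 / ((B : ℝ) - 1)) (fun l => a l * (zonalConst B l)⁻¹) l))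
      = a l ^ 2 * coeffW B l + a l * a (l + 2) * coeffU B l := by
  have hB' : (4 : ℝ) ≤ B := by exact_mod_cast hB
  have hl : (0 : ℝ) ≤ l := by positivity
  have h : zonalConst B l ≠ 0 := by
    rw [zonalConst]
    exact div_ne_zero (by linarith) (by linarith)
  have hZ : ∀ y, termZ (gegIndex B) y (fun l => a l * (zonalConst B l)⁻¹) l =
      a l ^ 2 * ((zonalConst B l)⁻¹ * gegenbauer (gegIndex B) l y) := by
    intro y
    simp only [termZ, zonalDiag_gegIndex hB]
    field_simp
  have h1 : (B : ℝ) - 1 ≠ 0 := by linarith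
  simp only [hZ, termX_gegIndex hB, coeffW, coeffU, gegDiff, gegOne, gegOff]
  generalize gegenbauer (gegIndex B) l (-1 / ((B : ℝ) - 1)) = g0
  generalize gegenbauer (gegIndex B) (l + 2) (-1 / ((B : ℝ) - 1)) = g2
  linear_combination (1 / 2 : ℝ) * (a l ^ 2 * (zonalConst B l)⁻¹ *
    (gegenbauer (gegIndex B) l 1 - 2 * ((B : ℝ) - 1) / ((B : ℝ) - 2) * g0)) *
      (mul_one_div_cancel h1)

theorem inv_zonalConst (l : ℕ) :
    (zonalConst B l)⁻¹ = ((B : ℝ) - 3 + 2 * l) / ((B : ℝ) - 3) := by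
  rw [zonalConst, inv_div]

theorem inv_zonalConst_mul_kappaUp (hB : 4 ≤ B) (l : ℕ) :
    (zonalConst B l)⁻¹ * kappaUp l (gegIndex B) =
      ((l : ℝ) + 1) * (l + 2) / (((B : ℝ) - 3) * ((B : ℝ) - 1 + 2 * l)) := by
  have hB' : (4 : ℝ) ≤ B := by exact_mod_cast hB
  have hl : (0 : ℝ) ≤ l := by positivity
  have h0 : (B : ℝ) - 3 ≠ 0 := by linarith
  have h1 : (B : ℝ) - 3 + 2 * l ≠ 0 := by linarith
  have h2 : (B : ℝ) - 1 + 2 * l ≠ 0 := by linarith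
  rw [inv_zonalConst, kappaUp, gegIndex,
    show (4 : ℝ) * (l + (B - 3) / 2) * (l + 1 + (B - 3) / 2) =
      (B - 3 + 2 * l) * (B - 1 + 2 * l) by ring]
  field_simp

theorem inv_zonalConst_mul_kappaDown (hB : 4 ≤ B) (l : ℕ) :
    (zonalConst B (l + 2))⁻¹ * kappaDown (l + 2) (gegIndex B) =
      ((B : ℝ) - 3 + l) * ((B : ℝ) - 2 + l) / (((B : ℝ) - 3) * ((B : ℝ) - 1 + 2 * l)) := by
  have hB' : (4 : ℝ) ≤ B := by exact_mod_cast hB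
  have hl : (0 : ℝ) ≤ l := by positivity
  have h0 : (B : ℝ) - 3 ≠ 0 := by linarith
  have h1 : (B : ℝ) - 3 + 2 * (l + 2) ≠ 0 := by linarith
  have h2 : (B : ℝ) - 1 + 2 * l ≠ 0 := by linarith
  rw [inv_zonalConst, kappaDown, gegIndex]
  push_cast
  rw [show (4 : ℝ) * (l + 2 + (B - 3) / 2) * (l + 2 - 1 + (B - 3) / 2) =
      (B - 3 + 2 * (l + 2)) * (B - 1 + 2 * l) by ring]
  field_simp
  ring

theorem jacUp_sq_mul_zonalConst (hB : 4 ≤ B) (l : ℕ) :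
    (zonalConst B l)⁻¹ ^ 2 * (jacUp (gegIndex B) l ^ 2 * zonalConst B (l + 1)) =
      ((l : ℝ) + 1) ^ 2 / (((B : ℝ) - 3) * ((B : ℝ) + 2 * l - 1)) := by
  have hB' : (4 : ℝ) ≤ B := by exact_mod_cast hB
  have hl : (0 : ℝ) ≤ l := by positivity
  have h0 : (B : ℝ) - 3 ≠ 0 := by linarith
  have h1 : (B : ℝ) - 3 + 2 * l ≠ 0 := by linarith
  have h2 : (B : ℝ) + 2 * l - 1 ≠ 0 := by linarith
  rw [inv_zonalConst, jacUp, zonalConst, gegIndex,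
    show 2 * ((l : ℝ) + (B - 3) / 2) = B - 3 + 2 * l by ring]
  push_cast
  rw [show (B : ℝ) - 3 + 2 * (l + 1) = B + 2 * l - 1 by ring]
  field_simp

theorem jacDown_sq_mul_zonalConst (hB : 4 ≤ B) (l : ℕ) :
    (zonalConst B (l + 1))⁻¹ ^ 2 * (jacDown (gegIndex B) (l + 1) ^ 2 * zonalConst B l) =
      ((B : ℝ) - 3 + l) ^ 2 / (((B : ℝ) - 3) * ((B : ℝ) + 2 * l - 3)) := by
  have hB' : (4 : ℝ) ≤ B := by exact_mod_cast hB
  have hl : (0 : ℝ) ≤ l := by positivity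
  have h0 : (B : ℝ) - 3 ≠ 0 := by linarith
  have h1 : (B : ℝ) - 3 + 2 * (l + 1) ≠ 0 := by linarith
  have h2 : (B : ℝ) + 2 * l - 3 ≠ 0 := by linarith
  rw [inv_zonalConst, jacDown_succ, zonalConst, gegIndex,
    show (B : ℝ) - 3 + 2 * l = B + 2 * l - 3 by ring]
  push_cast
  rw [show 2 * ((l : ℝ) + 1 + (B - 3) / 2) = B - 3 + 2 * (l + 1) by ring]
  field_simp
  ring

theorem jacUp_mul_jacDown_mul_zonalConst (hB : 4 ≤ B) (l : ℕ) :
    (zonalConst B l)⁻¹ * (zonalConst B (l + 2))⁻¹ *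
      (jacUp (gegIndex B) l * jacDown (gegIndex B) (l + 2) * zonalConst B (l + 1)) =
      ((l : ℝ) + 1) * ((B : ℝ) - 2 + l) / (((B : ℝ) - 3) * ((B : ℝ) - 1 + 2 * l)) := by
  have hB' : (4 : ℝ) ≤ B := by exact_mod_cast hB
  have hl : (0 : ℝ) ≤ l := by positivity
  have h0 : (B : ℝ) - 3 ≠ 0 := by linarith
  have h1 : (B : ℝ) - 3 + 2 * l ≠ 0 := by linarith
  have h2 : (B : ℝ) - 1 + 2 * l ≠ 0 := by linarith
  have h3 : (B : ℝ) - 3 + 2 * (l + 2) ≠ 0 := by linarith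
  rw [inv_zonalConst, inv_zonalConst, jacDown_succ, jacUp, zonalConst, gegIndex]
  push_cast
  rw [show (B : ℝ) - 3 + 2 * (l + 1) = B - 1 + 2 * l by ring,
    show 2 * ((l : ℝ) + (B - 3) / 2) = B - 3 + 2 * l by ring,
    show 2 * ((l : ℝ) + 1 + 1 + (B - 3) / 2) = B - 3 + 2 * (l + 2) by ring]
  field_simp
  ring

theorem termY_gegIndex (hB : 4 ≤ B) (y : ℝ) (a : ℕ → ℝ) (l : ℕ) :
    termY (gegIndex B) y (fun l => a l * (zonalConst B l)⁻¹) l =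
      a l ^ 2 * (((l : ℝ) + 1) ^ 2 / (((B : ℝ) - 3) * ((B : ℝ) + 2 * l - 1))
          * gegenbauer (gegIndex B) (l + 1) y
        + if l = 0 then 0 else ((B : ℝ) - 4 + l) ^ 2 / (((B : ℝ) - 3) * ((B : ℝ) + 2 * l - 5))
          * gegenbauer (gegIndex B) (l - 1) y)
      + a l * a (l + 2) *
        (2 * (((l : ℝ) + 1) * ((B : ℝ) - 2 + l) / (((B : ℝ) - 3) * ((B : ℝ) - 1 + 2 * l)))
          * gegenbauer (gegIndex B) (l + 1) y) := by
  rw [← jacUp_sq_mul_zonalConst hB, ← jacUp_mul_jacDown_mul_zonalConst hB]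
  simp only [termY, zonalDiag_gegIndex hB]
  rcases l with _ | l
  · simp only [jacDown_zero, if_true]
    ring
  · have h := jacDown_sq_mul_zonalConst hB l
    rw [if_neg (Nat.succ_ne_zero l), Nat.add_sub_cancel]
    push_cast
    rw [show (B : ℝ) - 4 + (l + 1) = B - 3 + l by ring,
      show (B : ℝ) + 2 * (l + 1) - 5 = B + 2 * l - 3 by ring, ← h]
    ring

/-- The left side is the termwise form of B·C, which is υ times the eigenvalue on 𝕄. -/
theorem termM_eq (hB : 4 ≤ B) (a : ℕ → ℝ) (l : ℕ) :
    (2 * ((B : ℝ) - 1) ^ 3 * termX (gegIndex B) (-1 / ((B : ℝ) - 1))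
          (fun l => a l * (zonalConst B l)⁻¹) l
        + ((B : ℝ) - 2) * ((B : ℝ) - 1) ^ 3 * termY (gegIndex B) (-1 / ((B : ℝ) - 1))
          (fun l => a l * (zonalConst B l)⁻¹) l
        - ((B : ℝ) - 1) * B * termZ (gegIndex B) (-1 / ((B : ℝ) - 1))
          (fun l => a l * (zonalConst B l)⁻¹) l) / (B * ((B : ℝ) - 2) * ((B : ℝ) - 3))
      = a l ^ 2 * coeffWTilde B l + a l * a (l + 2) * coeffUTilde B l := by
  have hB' : (4 : ℝ) ≤ B := by exact_mod_cast hB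
  have hl : (0 : ℝ) ≤ l := by positivity
  have h : zonalConst B l ≠ 0 := by
    rw [zonalConst]
    exact div_ne_zero (by linarith) (by linarith)
  have hZ : ∀ y, termZ (gegIndex B) y (fun l => a l * (zonalConst B l)⁻¹) l =
      a l ^ 2 * ((zonalConst B l)⁻¹ * gegenbauer (gegIndex B) l y) := by
    intro y
    simp only [termZ, zonalDiag_gegIndex hB]
    field_simp
  have h0 : (B : ℝ) ≠ 0 := by linarith
  have h2 : (B : ℝ) - 2 ≠ 0 := by linarith
  have h3 : (B : ℝ) - 3 ≠ 0 := by linarith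
  have h5 : (B : ℝ) - 1 + 2 * l ≠ 0 := by linarith
  have h6 : (B : ℝ) + 2 * l - 1 ≠ 0 := by linarith
  rw [hZ, termX_gegIndex hB, termY_gegIndex hB, inv_zonalConst_mul_kappaUp hB,
    inv_zonalConst_mul_kappaDown hB, inv_zonalConst]
  simp only [coeffWTilde, coeffUTilde, gegOff]
  generalize gegenbauer (gegIndex B) l (-1 / ((B : ℝ) - 1)) = g0
  generalize gegenbauer (gegIndex B) (l + 1) (-1 / ((B : ℝ) - 1)) = g1
  generalize gegenbauer (gegIndex B) (l + 2) (-1 / ((B : ℝ) - 1)) = g2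
  generalize gegenbauer (gegIndex B) (l - 1) (-1 / ((B : ℝ) - 1)) = g
  generalize kappaZero l (gegIndex B) = κ
  -- At `l = 0` the denominator B + 2l - 5 may vanish, but its summand is absent; for `l ≥ 1` it is
  -- positive.
  rcases l with _ | l
  · simp only [if_true, Nat.cast_zero] at h6 h5 ⊢
    field_simp
    ring
  · have h7 : (B : ℝ) + 2 * ((l + 1 : ℕ) : ℝ) - 5 ≠ 0 := by
      push_cast
      have : (0 : ℝ) ≤ l := by positivity
      linarith
    simp only [if_neg (Nat.succ_ne_zero l)]
    generalize ((l + 1 : ℕ) : ℝ) = x at h5 h6 h7 ⊢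
    field_simp
    ring

theorem kappaZero_sub (hB : 4 ≤ B) (l : ℕ) :
    ((B : ℝ) - 1) / 2 * (kappaZero l (gegIndex B) - 1 / ((B : ℝ) - 1)) =
      (l : ℝ) * ((B : ℝ) - 3 + l) * ((B : ℝ) - 3)
          / (((B : ℝ) - 5 + 2 * l) * ((B : ℝ) - 1 + 2 * l)) := by
  have hB' : (4 : ℝ) ≤ B := by exact_mod_cast hB
  have h1 : (B : ℝ) - 1 ≠ 0 := by linarith
  have h3 : (B : ℝ) - 3 ≠ 0 := by linarith
  rcases l with _ | l
  -- The second summand of κ₀ has numerator zero, so the value is 1/(B-1) even for B = 5.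
  · have h : kappaZero 0 (gegIndex B) = 1 / ((B : ℝ) - 1) := by
      simp only [kappaZero, gegIndex, Nat.cast_zero]
      rw [show (4 : ℝ) * (0 + (B - 3) / 2) * (0 + 1 + (B - 3) / 2) = (B - 3) * (B - 1) by ring,
        mul_zero, zero_div]
      field_simp
      ring
    rw [h]
    simp
  · have hl : (0 : ℝ) ≤ l := by positivity
    simp only [kappaZero, gegIndex]
    push_cast
    rw [show (4 : ℝ) * (l + 1 + (B - 3) / 2) * (l + 1 + 1 + (B - 3) / 2) =
      (B - 1 + 2 * l) * (B + 1 + 2 * l) by ring,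
      show (4 : ℝ) * (l + 1 + (B - 3) / 2) * (l + 1 - 1 + (B - 3) / 2) =
      (B - 1 + 2 * l) * (B - 3 + 2 * l) by ring,
      show ((B : ℝ) - 5 + 2 * (l + 1)) * (B - 1 + 2 * (l + 1)) =
        (B - 3 + 2 * l) * (B + 1 + 2 * l) by ring]
    have h4 : (B : ℝ) - 1 + 2 * l ≠ 0 := by linarith
    have h5 : (B : ℝ) + 1 + 2 * l ≠ 0 := by linarith
    have h6 : (B : ℝ) - 3 + 2 * l ≠ 0 := by linarith
    field_simp
    ring

theorem coeffW_eq (hB : 4 ≤ B) (l : ℕ) : coeffW B l =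
      (l : ℝ) * ((B : ℝ) - 3 + l) * ((B : ℝ) - 3)
          / (((B : ℝ) - 5 + 2 * l) * ((B : ℝ) - 1 + 2 * l))
        * (zonalConst B l)⁻¹ * gegDiff B l := by
  rw [coeffW, kappaZero_sub hB]

theorem coeffW_eq' (hB : 4 ≤ B) (l : ℕ) : coeffW B l =
      (l : ℝ) * ((B : ℝ) - 3 + l) * ((B : ℝ) - 3 + 2 * l)
          / (((B : ℝ) - 5 + 2 * l) * ((B : ℝ) - 1 + 2 * l)) * gegDiff B l := by
  have hB' : (4 : ℝ) ≤ B := by exact_mod_cast hB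
  have h3 : (B : ℝ) - 3 ≠ 0 := by linarith
  rw [coeffW_eq hB, inv_zonalConst, div_mul_div_comm,
    show (l : ℝ) * ((B : ℝ) - 3 + l) * ((B : ℝ) - 3) * ((B : ℝ) - 3 + 2 * l) =
      l * ((B : ℝ) - 3 + l) * ((B : ℝ) - 3 + 2 * l) * ((B : ℝ) - 3) by ring,
    mul_div_mul_right _ _ h3]

theorem coeffU_eq (hB : 4 ≤ B) (l : ℕ) : coeffU B l =
      ((B : ℝ) - 1) / 2 *
        (((B : ℝ) - 3 + l) * ((B : ℝ) - 2 + l) / (((B : ℝ) - 3) * ((B : ℝ) - 1 + 2 * l))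
            * gegDiff B l
          + ((l : ℝ) + 1) * ((l : ℝ) + 2) / (((B : ℝ) - 3) * ((B : ℝ) - 1 + 2 * l))
            * gegDiff B (l + 2)) := by
  rw [coeffU, inv_zonalConst_mul_kappaUp hB, inv_zonalConst_mul_kappaDown hB]

theorem mul_kappaZero (hB : 4 ≤ B) (l : ℕ) (hl : B + 2 * l ≠ 5) :
    ((B : ℝ) - 3 + 2 * l) * kappaZero l (gegIndex B) =
      ((B : ℝ) + 2 * l - 3) * (2 * B * l + B + 2 * (l : ℝ) ^ 2 - 6 * l - 5)
        / (((B : ℝ) + 2 * l - 5) * ((B : ℝ) + 2 * l - 1)) := by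
  have hB' : (4 : ℝ) ≤ B := by exact_mod_cast hB
  have hl0 : (0 : ℝ) ≤ l := by positivity
  have h5 : (B : ℝ) + 2 * l - 5 ≠ 0 := sub_ne_zero.2 (by exact_mod_cast hl)
  have h3 : (B : ℝ) + 2 * l - 3 ≠ 0 := by linarith
  have h1 : (B : ℝ) + 2 * l - 1 ≠ 0 := by linarith
  simp only [kappaZero, gegIndex]
  rw [show (4 : ℝ) * (l + (B - 3) / 2) * (l + 1 + (B - 3) / 2) =
      (B + 2 * l - 3) * (B + 2 * l - 1) by ring,
    show (4 : ℝ) * (l + (B - 3) / 2) * (l - 1 + (B - 3) / 2) =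
      (B + 2 * l - 3) * (B + 2 * l - 5) by ring]
  field_simp
  ring

end ClosedForms

/-! ### The regular simplex and the final assembly -/

section Main

open Metric Set Module

/-- Uniqueness of the derivative, obtained by choosing a norm compatible with the topology. -/
theorem HasFDerivAt.fderiv_symSpace {B : ℕ} {f : symSpaceG B → symSpace B} {S : symSpaceG B}
    {J : symSpaceG B →L[ℝ] symSpace B} (h : HasFDerivAt f J S) : fderiv ℝ f S = J := by
  let : NormedAddCommGroup (Matrix (Fin B) (Fin B) ℝ) := Matrix.normedAddCommGroup
  let : NormedSpace ℝ (Matrix (Fin B) (Fin B) ℝ) := Matrix.normedSpace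
  exact HasFDerivAt.fderiv h

theorem HasGegenbauerExpansion.isGegenbauerExpansion {B : ℕ} {φ : ℝ → ℝ} (hφ : Measurable φ)
    {a : ℕ → ℝ} (ha : HasGegenbauerExpansion B φ a) :
    IsGegenbauerExpansion (gegIndex B) (fun x => φ (√((B : ℝ) - 1) * x))
      (fun l => a l * (zonalConst B l)⁻¹) where
  measurable := hφ.comp (measurable_const_mul _)
  memLp := ha.1
  tendsto := ha.2

variable {E : Type*} [NormedAddCommGroup E] [InnerProductSpace ℝ E] [FiniteDimensional ℝ E]
  [MeasurableSpace E] [BorelSpace E] [Nontrivial E] {B : ℕ}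

local notation "⟪" x ", " y "⟫" => inner ℝ x y

/-- The normalised image in `E` of the `k`-th coordinate functional. -/
def unitVec (Q : E →ₗᵢ[ℝ] EuclideanSpace ℝ (Fin B)) (k : Fin B) : E :=
  √((B : ℝ) / ((B : ℝ) - 1)) • coordVec Q k

variable {Q : E →ₗᵢ[ℝ] EuclideanSpace ℝ (Fin B)}

/-- The coordinate vectors have Gram matrix G, with diagonal (B-1)/B. Normalised, they are the
vertices of a regular simplex. -/
theorem inner_unitVec_unitVec (hQ : IsCenteringIsometry Q) (hB : 4 ≤ B) (i j : Fin B) :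
    ⟪unitVec Q i, unitVec Q j⟫ = if i = j then 1 else -1 / ((B : ℝ) - 1) := by
  have hB' : (4 : ℝ) ≤ B := by exact_mod_cast hB
  have h1 : (B : ℝ) - 1 ≠ 0 := by linarith
  have h0 : (B : ℝ) ≠ 0 := by linarith
  have hs : √((B : ℝ) / ((B : ℝ) - 1)) * √((B : ℝ) / ((B : ℝ) - 1)) = (B : ℝ) / ((B : ℝ) - 1) :=
    Real.mul_self_sqrt (div_nonneg (by linarith) (by linarith))
  rw [unitVec, unitVec, real_inner_smul_left, real_inner_smul_right, ← mul_assoc, hs,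
    inner_coordVec_coordVec hQ, centering_apply]
  split_ifs
  · field_simp
  · field_simp
    ring

theorem norm_unitVec (hQ : IsCenteringIsometry Q) (hB : 4 ≤ B) (i : Fin B) :
    ‖unitVec Q i‖ = 1 := by
  have h := inner_unitVec_unitVec hQ hB i i
  rw [if_pos rfl, real_inner_self_eq_norm_sq] at h
  exact (pow_eq_one_iff_of_nonneg (norm_nonneg _) two_ne_zero).1 h

/-- On the unit sphere `n` multiplies by √B, and √B = √(B-1) · √(B/(B-1)) passes to the normalised
coordinate vectors. -/
theorem sphereProduct_eq (hB : 4 ≤ B) (φ : ℝ → ℝ) (i j : Fin B) :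
    sphereProduct φ Q i j = fun ω : sphere (0 : E) 1 =>
      φ (√((B : ℝ) - 1) * ⟪unitVec Q i, ω.1⟫) * φ (√((B : ℝ) - 1) * ⟪unitVec Q j, ω.1⟫) := by
  have hB' : (4 : ℝ) ≤ B := by exact_mod_cast hB
  have h1 : (B : ℝ) - 1 ≠ 0 := by linarith
  have hs : √((B : ℝ) - 1) * √((B : ℝ) / ((B : ℝ) - 1)) = √(B : ℝ) := by
    rw [← Real.sqrt_mul (by linarith), mul_div_cancel₀ _ h1]
  funext ω
  have h : ∀ k, actNormalize φ (Q ω.1) k = φ (√((B : ℝ) - 1) * ⟪unitVec Q k, ω.1⟫) := by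
    intro k
    rw [unitVec, real_inner_smul_left, ← mul_assoc, hs, inner_coordVec]
    simp [actNormalize, normalizeVec]
  rw [sphereProduct, h, h]

theorem sum_mul_centering_mul_centering (S : symSpaceG B) (i j : Fin B) :
    ∑ k, ∑ l, S.1 k l * (centering B i k * centering B j l) = S.1 i j := by
  have h := congrFun (congrFun S.2.2 i) j
  rw [Matrix.mul_assoc, Matrix.mul_apply] at h
  rw [← h]
  refine Finset.sum_congr rfl fun k _ => ?_
  rw [Matrix.mul_apply, Finset.mul_sum]
  refine Finset.sum_congr rfl fun l _ => ?_
  rw [show centering B j l = centering B l j from congrFun (congrFun (centering_transpose B) l) j]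
  ring

theorem sum_mul_inner_unitVec (hQ : IsCenteringIsometry Q) (hB : 4 ≤ B) (S : symSpaceG B)
    (i j : Fin B) :
    ∑ k, ∑ l, S.1 k l * (⟪unitVec Q i, coordVec Q k⟫ * ⟪unitVec Q j, coordVec Q l⟫) =
      (B : ℝ) / ((B : ℝ) - 1) * S.1 i j := by
  have hB' : (4 : ℝ) ≤ B := by exact_mod_cast hB
  have hs : √((B : ℝ) / ((B : ℝ) - 1)) * √((B : ℝ) / ((B : ℝ) - 1)) = (B : ℝ) / ((B : ℝ) - 1) :=
    Real.mul_self_sqrt (div_nonneg (by linarith) (by linarith))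
  rw [← sum_mul_centering_mul_centering S i j, Finset.mul_sum]
  refine Finset.sum_congr rfl fun k _ => ?_
  rw [Finset.mul_sum]
  refine Finset.sum_congr rfl fun l _ => ?_
  rw [unitVec, unitVec, real_inner_smul_left, real_inner_smul_left, inner_coordVec_coordVec hQ,
    inner_coordVec_coordVec hQ]
  linear_combination S.1 k l * centering B i k * centering B j l * hs

theorem sum_mul_inner_coordVec (hQ : IsCenteringIsometry Q) {S : symSpaceG B}
    (hS : S.1.trace = 0) : ∑ k, ∑ l, S.1 k l * ⟪coordVec Q k, coordVec Q l⟫ = 0 := by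
  simp only [inner_coordVec_coordVec hQ, sum_mul_centering, hS]

/-- Contraction with `S` turns u_i⊗u_j into a multiple of S_ij by GSG = S, and turns the inner
product into the trace, which is zero. -/
theorem sum_mul_bilinear_of_eq (hQ : IsCenteringIsometry Q) (hB : 4 ≤ B) {S : symSpaceG B}
    (hS : S.1.trace = 0) (i j : Fin B) {T : E →ₗ[ℝ] E →ₗ[ℝ] ℝ} {A C τ : ℝ}
    (hT : ∀ a c, T a c = A * (⟪unitVec Q i, a⟫ * ⟪unitVec Q i, c⟫
        + ⟪unitVec Q j, a⟫ * ⟪unitVec Q j, c⟫)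
      + C * (⟪unitVec Q i, a⟫ * ⟪unitVec Q j, c⟫ + ⟪unitVec Q j, a⟫ * ⟪unitVec Q i, c⟫)
      + τ * ⟪a, c⟫) :
    ∑ k, ∑ l, S.1 k l * T (coordVec Q k) (coordVec Q l) =
      (B : ℝ) / ((B : ℝ) - 1) * (A * (S.1 i i + S.1 j j) + 2 * C * S.1 i j) := by
  have h : ∀ k l, S.1 k l * T (coordVec Q k) (coordVec Q l) =
      A * (S.1 k l * (⟪unitVec Q i, coordVec Q k⟫ * ⟪unitVec Q i, coordVec Q l⟫))
      + A * (S.1 k l * (⟪unitVec Q j, coordVec Q k⟫ * ⟪unitVec Q j, coordVec Q l⟫))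
      + C * (S.1 k l * (⟪unitVec Q i, coordVec Q k⟫ * ⟪unitVec Q j, coordVec Q l⟫))
      + C * (S.1 k l * (⟪unitVec Q j, coordVec Q k⟫ * ⟪unitVec Q i, coordVec Q l⟫))
      + τ * (S.1 k l * ⟪coordVec Q k, coordVec Q l⟫) := by
    intro k l
    rw [hT]
    ring
  simp only [h, Finset.sum_add_distrib, ← Finset.mul_sum, sum_mul_inner_unitVec hQ hB,
    sum_mul_inner_coordVec hQ hS, symSpaceG_apply_comm S j i]
  ring

/-- Solves the linear system at y = -1/(B-1) for exactly the two combinations that enter the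
eigenvalues. -/
theorem eq_of_moment_equations (hB : 4 ≤ B) {A C τ X Y Z : ℝ}
    (h1 : A * (1 + (-1 / ((B : ℝ) - 1)) ^ 2) + 2 * C * (-1 / ((B : ℝ) - 1)) + τ = X)
    (h2 : 2 * A * (-1 / ((B : ℝ) - 1)) + C * (1 + (-1 / ((B : ℝ) - 1)) ^ 2)
      + τ * (-1 / ((B : ℝ) - 1)) = Y)
    (h3 : 2 * A + 2 * C * (-1 / ((B : ℝ) - 1)) + (2 * gegIndex B + 2) * τ = Z) :
    (B : ℝ) * C = (2 * ((B : ℝ) - 1) ^ 3 * X + ((B : ℝ) - 2) * ((B : ℝ) - 1) ^ 3 * Y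
        - ((B : ℝ) - 1) * B * Z) / (B * ((B : ℝ) - 2) * ((B : ℝ) - 3)) ∧
      -2 * ((B : ℝ) - 2) * A + 4 * C =
        - (2 * ((B : ℝ) - 1) / ((B : ℝ) - 2)) * (((B : ℝ) - 1) * X - Z) := by
  have hB' : (4 : ℝ) ≤ B := by exact_mod_cast hB
  have g0 : (B : ℝ) ≠ 0 := by linarith
  have g1 : (B : ℝ) - 1 ≠ 0 := by linarith
  have g2 : (B : ℝ) - 2 ≠ 0 := by linarith
  have g3 : (B : ℝ) - 3 ≠ 0 := by linarith
  rw [← h1, ← h2, ← h3, gegIndex]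
  constructor
  · field_simp
    ring
  · field_simp
    ring

end Main

theorem mainTheorem10 (B : ℕ) (hB : 4 ≤ B) (φ : ℝ → ℝ) (hφ : Measurable φ) (a : ℕ → ℝ)
    (ha : HasGegenbauerExpansion B φ a)
    (S : symSpace B) (hS : IsBSB1FixedPoint φ S.1) :
    -- the three series converge and the denominator does not vanish
    Summable (fun l => a l ^ 2 * coeffW B l + a l * a (l + 2) * coeffU B l) ∧
    Summable (fun l => a l ^ 2 * coeffWTilde B l + a l * a (l + 2) * coeffUTilde B l) ∧
    Summable (fun l => a l ^ 2 * coeffV B l) ∧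
    (∑' l, a l ^ 2 * coeffV B l) ≠ 0 ∧
    -- the linearization exists and acts on `𝕃` and `𝕄` by the two ratios
    DifferentiableAt ℝ (normCov B φ) (gTensor B S) ∧
    IsEigenvalueOn (linearized B φ (gTensor B S)) (spaceL B)
      ((∑' l, (a l ^ 2 * coeffW B l + a l * a (l + 2) * coeffU B l))
        / ∑' l, a l ^ 2 * coeffV B l) ∧
    IsEigenvalueOn (linearized B φ (gTensor B S)) (spaceM B)
      ((∑' l, (a l ^ 2 * coeffWTilde B l + a l * a (l + 2) * coeffUTilde B l))
        / ∑' l, a l ^ 2 * coeffV B l) ∧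
    -- closed forms of the coefficients
    (∀ l : ℕ, coeffW B l =
      (l : ℝ) * ((B : ℝ) - 3 + l) * ((B : ℝ) - 3)
          / (((B : ℝ) - 5 + 2 * l) * ((B : ℝ) - 1 + 2 * l))
        * (zonalConst B l)⁻¹ * gegDiff B l) ∧
    (∀ l : ℕ, coeffW B l =
      (l : ℝ) * ((B : ℝ) - 3 + l) * ((B : ℝ) - 3 + 2 * l)
          / (((B : ℝ) - 5 + 2 * l) * ((B : ℝ) - 1 + 2 * l)) * gegDiff B l) ∧
    (∀ l : ℕ, coeffU B l =
      ((B : ℝ) - 1) / 2 *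
        (((B : ℝ) - 3 + l) * ((B : ℝ) - 2 + l) / (((B : ℝ) - 3) * ((B : ℝ) - 1 + 2 * l))
            * gegDiff B l
          + ((l : ℝ) + 1) * ((l : ℝ) + 2) / (((B : ℝ) - 3) * ((B : ℝ) - 1 + 2 * l))
            * gegDiff B (l + 2))) ∧
    (∀ l : ℕ, B + 2 * l ≠ 5 → coeffWTilde B l =
      ((B : ℝ) - 1) / (((B : ℝ) - 3) ^ 2 * ((B : ℝ) - 2)) *
        ((2 * ((B : ℝ) - 1) ^ 2 * ((B : ℝ) + 2 * l - 3)
              * (2 * B * l + B + 2 * (l : ℝ) ^ 2 - 6 * l - 5)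
              / (B * ((B : ℝ) + 2 * l - 5) * ((B : ℝ) + 2 * l - 1))
            - ((B : ℝ) - 3 + 2 * l)) * gegOff B l
          + ((B : ℝ) - 2) * ((B : ℝ) - 1) ^ 2 * ((l : ℝ) + 1) ^ 2
              / (B * ((B : ℝ) + 2 * l - 1)) * gegOff B (l + 1)
          + (if l = 0 then 0 else
              ((B : ℝ) - 2) * ((B : ℝ) - 1) ^ 2 * ((B : ℝ) - 4 + l) ^ 2
                / (B * ((B : ℝ) + 2 * l - 5)) * gegOff B (l - 1)))) := by
  have hB' : (4 : ℝ) ≤ B := by exact_mod_cast hB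
  have g0 : (B : ℝ) ≠ 0 := by linarith
  have g1 : (B : ℝ) - 1 ≠ 0 := by linarith
  have g2 : (B : ℝ) - 2 ≠ 0 := by linarith
  have hα : 1 / 2 ≤ gegIndex B := by rw [gegIndex]; linarith
  have hn : (Module.finrank ℝ (sumZero B) : ℝ) = 2 * gegIndex B + 2 := by
    rw [finrank_sumZero (by omega), gegIndex]
    ring
  have hn3 : 3 ≤ Module.finrank ℝ (sumZero B) := by
    have : (3 : ℝ) ≤ Module.finrank ℝ (sumZero B) := by rw [hn]; linarith
    exact_mod_cast this
  have : Nontrivial (sumZero B) := Module.nontrivial_of_finrank_pos (R := ℝ) (by omega)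
  have hQ := isCenteringIsometry_sumZero B
  set Q := (sumZero B).subtypeₗᵢ
  set y : ℝ := -1 / ((B : ℝ) - 1) with hy
  have hy1 : y ^ 2 ≠ 1 := by
    rw [hy, div_pow, Ne, div_eq_iff (pow_ne_zero 2 g1)]
    nlinarith
  have H := ha.isGegenbauerExpansion hφ
  set b : ℕ → ℝ := fun l => a l * (zonalConst B l)⁻¹ with hb
  have hu : ∀ i, ‖unitVec Q i‖ = 1 := norm_unitVec hQ hB
  have huy : ∀ i j, i ≠ j → inner ℝ (unitVec Q i) (unitVec Q j) = y := fun i j hij => by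
    rw [inner_unitVec_unitVec hQ hB, if_neg hij]
  have hint : ∀ i j, Integrable (sphereProduct φ Q i j) (sphereProb (sumZero B)) := fun i j => by
    rw [sphereProduct_eq hB]
    exact H.integrable_mul hα hn (hu i) (hu j)
  have hform : ∀ i j v w, sphereForm (hint i j) v w =
      sphereForm (H.integrable_mul hα hn (hu i) (hu j)) v w := fun i j v w => by
    simp only [sphereForm_apply, sphereProduct_eq hB]
  obtain ⟨υ, hυ, hS₀, hυeq⟩ := hS.integral_sphereProduct hQ hφ hint (by omega)
  obtain ⟨J, hJ, hJ'⟩ := exists_hasFDerivAt_normCov hQ hn3 hφ hint hυ (gTensor B S) hS₀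
  -- One fixed pair of indices provides X, Y, Z; uniqueness of sums transfers them to all other
  -- pairs.
  let i₀ : Fin B := ⟨0, by omega⟩
  let i₁ : Fin B := ⟨1, by omega⟩
  have hi : i₀ ≠ i₁ := by simp [i₀, i₁]
  obtain ⟨-, -, -, X, Y, Z, hX, hY, hZ, -⟩ :=
    H.exists_sphereForm_eq_of_inner hα hn (hu i₀) (hu i₁) (huy i₀ i₁ hi) hy1
  obtain ⟨A₁, τ₁, X₁, Z₁, hX₁, hZ₁, -, hA₁, hA₁'⟩ :=
    H.exists_sphereForm_eq_self hα hn (hu i₀)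
  have hsumM := (((hX.mul_left (2 * ((B : ℝ) - 1) ^ 3)).add
    (hY.mul_left (((B : ℝ) - 2) * ((B : ℝ) - 1) ^ 3))).sub
    (hZ.mul_left (((B : ℝ) - 1) * B))).div_const (B * ((B : ℝ) - 2) * ((B : ℝ) - 3))
  simp only [hb, hy, termM_eq hB] at hsumM
  have hsumL := (((hX₁.mul_left ((B : ℝ) - 1)).sub hZ₁).sub
    (((hX.mul_left ((B : ℝ) - 1)).sub hZ).mul_left (2 * ((B : ℝ) - 1) / ((B : ℝ) - 2)))).mul_left
      (1 / 2 : ℝ)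
  simp only [hb, hy, termL_eq hB] at hsumL
  have hsumV := hZ₁.sub hZ
  simp only [hb, hy, termZ_sub_termZ hB] at hsumV
  -- Z₁ and Z are the means of a diagonal and an off-diagonal product, so the fixed point equation
  -- gives their difference.
  have hυZ : Z₁ - Z = υ := by
    have h1 := H.hasSum_termZ hα hn (hu i₀) (hu i₀)
    have h2 := H.hasSum_termZ hα hn (hu i₀) (hu i₁)
    rw [inner_unitVec_unitVec hQ hB, if_pos rfl] at h1
    rw [huy i₀ i₁ hi] at h2
    rw [hZ₁.unique h1, hZ.unique h2, ← hυeq i₀ i₁ hi, sphereProduct_eq hB, sphereProduct_eq hB]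
  rw [hυZ] at hsumV
  -- The numbers `c`, `d`, `r` are B·C, A and the diagonal coefficient A, written through the sums
  -- alone so that they do not depend on the indices.
  set c : ℝ := (2 * ((B : ℝ) - 1) ^ 3 * X + ((B : ℝ) - 2) * ((B : ℝ) - 1) ^ 3 * Y
        - ((B : ℝ) - 1) * B * Z) / (B * ((B : ℝ) - 2) * ((B : ℝ) - 3)) with hc
  set d : ℝ := (4 * c / B + 2 * ((B : ℝ) - 1) / ((B : ℝ) - 2) * (((B : ℝ) - 1) * X - Z))
    / (2 * ((B : ℝ) - 2)) with hd
  set r : ℝ := (((B : ℝ) - 1) * X₁ - Z₁) / ((B : ℝ) - 2) with hr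
  have hoff : ∀ T : symSpaceG B, T.1.trace = 0 → ∀ i j, i ≠ j → (J T).1 i j =
      B * d / (2 * υ) * (T.1 i i + T.1 j j) + 2 * (c / (2 * υ)) * T.1 i j := by
    intro T hT i j hij
    obtain ⟨A, C, τ, X', Y', Z', hX', hY', hZ', hF, e1, e2, e3⟩ :=
      H.exists_sphereForm_eq_of_inner hα hn (hu i) (hu j) (huy i j hij) hy1
    rw [hX'.unique hX] at e1
    rw [hY'.unique hY] at e2
    rw [hZ'.unique hZ] at e3
    obtain ⟨e4, e5⟩ := eq_of_moment_equations hB e1 e2 e3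
    have hC : c = B * C := e4.symm
    have hA : d = A := by
      rw [hd, hC, div_eq_iff (mul_ne_zero two_ne_zero g2), mul_div_assoc,
        mul_div_cancel_left₀ _ g0]
      linear_combination e5
    rw [hJ' T hT, hA, hC]
    simp only [hform]
    rw [sum_mul_bilinear_of_eq hQ hB hT i j hF, finrank_sumZero (by omega)]
    field_simp
  have hdiag : ∀ T : symSpaceG B, T.1.trace = 0 → ∀ i, (J T).1 i i =
      B * r / (2 * υ) * T.1 i i := by
    intro T hT i
    obtain ⟨A, τ, X', Z', hX', hZ', hF, e1, e2⟩ := H.exists_sphereForm_eq_self hα hn (hu i)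
    rw [hX'.unique hX₁] at e1
    rw [hZ'.unique hZ₁, gegIndex] at e2
    have hA : r = A := by
      rw [hr, div_eq_iff g2]
      linear_combination -((B : ℝ) - 1) * e1 + e2
    rw [hJ' T hT, hA]
    simp only [hform]
    -- With equal indices the two squares coincide, hence the coefficient A/2.
    rw [sum_mul_bilinear_of_eq hQ hB hT i i (A := A / 2) (C := 0) (τ := τ)
      (fun v w => by rw [hF]; ring), finrank_sumZero (by omega)]
    field_simp
    ring
  have hlin : linearized B φ (gTensor B S) = gTensor B ∘ₗ J.toLinearMap := by
    rw [linearized, hJ.fderiv_symSpace]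
  refine ⟨hsumL.summable, hsumM.summable, hsumV.summable, ?_, ⟨J, hJ⟩, ?_, ?_, coeffW_eq hB,
    coeffW_eq' hB, coeffU_eq hB, fun l hl => ?_⟩
  · rw [hsumV.tsum_eq]
    exact hυ.ne'
  · rw [hsumL.tsum_eq, hsumV.tsum_eq, hlin]
    convert! isEigenvalueOn_spaceL hB hoff hdiag using 1
    rw [hr, hd]
    field_simp
    ring
  · rw [hsumM.tsum_eq, hsumV.tsum_eq, hlin]
    convert! isEigenvalueOn_spaceM hB hoff hdiag using 1
    field_simp
  · rw [coeffWTilde, mul_kappaZero hB l hl]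
    congr 4
    field_simp

end
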